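/- Let $d\ge 1$, let $f:\mathbb R^d\to\mathbb R$ be twice differentiable and bounded below, with $L$-Lipschitz gradient and with Hessian $\rho$-Lipschitz in the spectral norm ($L,\rho>0$). Let $x_{int}\in\mathbb R^d$, $\triangle_f=f(x_{int})-\inf f$, $\epsilon>0$, $\chi\ge 1$, and put $$\eta=\frac1{4L},\quad B=\frac{1}{288\chi^2}\sqrt{\frac{\epsilon}{\rho}},\quad \theta=\frac12\Big(\frac{\epsilon\rho}{L^2}\Big)^{1/4},\quad K=\frac{2\chi}{\theta},\quad r=\min\Big\{\frac B2,\frac{\theta B}{20K},\sqrt{\frac{\theta B^2}{2K}}\Big\},$$ where $\theta<1$ is assumed. Perturbed restarted AGD: start with $x^{-1}=x^0=x_{int}$, $k=0$. While $k<K$: set $y^k=x^k+(1-\theta)(x^k-x^{k-1})$, $x^{k+1}=y^k-\eta\nabla f(y^k)$, $k\leftarrow k+1$; if then $k\sum_{t=0}^{k-1}\|x^{t+1}-x^t\|^2>B^2$, restart with $x^{-1}=x^0=x^k+\xi\,1_{\|\nabla f(y^{k-1})\|\le B/\eta}$, $k=0$, where $\xi$ is a fresh perturbation in the closed ball of radius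 $r$ around $0$. After the loop choose $K_0\in\arg\min_{\lfloor K/2\rfloor\le k\le K-1}\|x^{k+1}-x^k\|$ and output $\hat y=\frac1{K_0+1}\sum_{k=0}^{K_0}y^k$. The run up to the first restart is called the first epoch. There are absolute constants $c,C>0$ such that for all such data the following holds. (i) $r\le C\epsilon/L$. For all perturbations of norm at most $r$, the method terminates after at most $$C\left(\frac{\triangle_f L^{1/2}\rho^{1/4}\chi^6}{\epsilon^{7/4}}+\frac{L^{1/2}\chi}{(\epsilon\rho)^{1/4}}\right)$$ gradient evaluations, and its output satisfies $\|\nabla f(\hat y)\|\le\epsilon$. (The second term is of the order of $K$, the length of the last epoch; it is dominated by the first as soon as $\triangle_f\ge\epsilon^{3/2}/(\sqrt\rho\,\chi^5)$.) (ii) Let $0<\zeta<1$, let $\chi\ge c\,\ell$ with $$\ell=\max\Big\{1,\log\frac{dL\,(1+\triangle_f\sqrt\rho\,\epsilon^{-3/2})}{\zeta\sqrt{\epsilon\rho}}\Big\},$$ and let the perturbations be independent and uniform in the ball of radius $r$. If the first epoch ends in a restart, or if $\lambda_{\min}(\nabla^2 f(x_{int}))\ge-\sqrt{\epsilon\rho}$,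 then with probability at least $1-\zeta$ the method stops within the bound of (i) with $\|\nabla f(\hat y)\|\le\epsilon$ and $\lambda_{\min}(\nabla^2 f(\hat y))\ge-1.011\sqrt{\epsilon\rho}$. If the initial point is perturbed by the same rule, that is, if the method is started at $x_{int}+\xi\,1_{\|\nabla f(x_{int})\|\le B/\eta}$ instead of $x_{int}$, then this holds without any condition on $x_{int}$. Moreover $\ell=O\big(\max\{1,\log\frac{d}{\zeta\epsilon}\}\big)$, with a constant that depends only on $L$, $\rho$ and an upper bound of $\triangle_f$; so $\chi$ can be chosen of this order. -/

import Mathlib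

open MeasureTheory ProbabilityTheory

noncomputable section

/-- `ℝ^d` with the Euclidean norm. -/
abbrev Vec (d : ℕ) : Type := EuclideanSpace ℝ (Fin d)

/-- The Hessian `∇²f(x)`, as the derivative of the gradient field. -/
def hess {d : ℕ} (f : Vec d → ℝ) (x : Vec d) : Vec d →L[ℝ] Vec d :=
  fderiv ℝ (gradient f) x

/-- The smallest eigenvalue. -/
def lambdaMin {d : ℕ} (A : Vec d →L[ℝ] Vec d) : ℝ :=
  sInf {μ : ℝ | Module.End.HasEigenvalue (A : Vec d →ₗ[ℝ] Vec d) μ}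

/-- `f` is twice differentiable, with `L`-Lipschitz gradient and `ρ`-Lipschitz Hessian
(in the spectral norm), and is bounded below. -/
structure SmoothObjective {d : ℕ} (f : Vec d → ℝ) (L ρ : ℝ) : Prop where
  diff : Differentiable ℝ f
  diff_grad : Differentiable ℝ (gradient f)
  lip_grad : ∀ x y, ‖gradient f x - gradient f y‖ ≤ L * ‖x - y‖
  lip_hess : ∀ x y, ‖hess f x - hess f y‖ ≤ ρ * ‖x - y‖
  bdd : BddBelow (Set.range f)

/-- `Δ_f = f(x) - inf f`. -/
def gap {d : ℕ} (f : Vec d → ℝ) (x : Vec d) : ℝ := f x - ⨅ z, f z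

/-- Parameters of the restarted accelerated gradient method. -/
structure Params where
  η : ℝ
  θ : ℝ
  B : ℝ
  K : ℝ

/-- The parameter choice `η = 1/(4L)`, `θ = (1/2)(ερ/L²)^{1/4}`, `B = (1/(288χ²))√(ε/ρ)`,
`K = 2χ/θ` (not rounded). -/
def params (L ρ ε χ : ℝ) : Params where
  η := 1 / (4 * L)
  θ := 1 / 2 * (ε * ρ / L ^ 2) ^ (1 / 4 : ℝ)
  B := 1 / (288 * χ ^ 2) * √(ε / ρ)
  K := 2 * χ / (1 / 2 * (ε * ρ / L ^ 2) ^ (1 / 4 : ℝ))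

/-- The perturbation radius `r = min {B/2, θB/(20K), √(θB²/(2K))}`. -/
def Params.radius (p : Params) : ℝ :=
  min (p.B / 2) (min (p.θ * p.B / (20 * p.K)) √(p.θ * p.B ^ 2 / (2 * p.K)))

section Algorithm

variable {d : ℕ} (f : Vec d → ℝ) (p : Params)

/-- The extrapolation step `y = x + (1-θ)(x - x⁻)`, where `x⁻` is the previous iterate. -/
def extrapolate (xprev x : Vec d) : Vec d := x + (1 - p.θ) • (x - xprev)

/-- The pair `(x^{k-1}, x^k)` of accelerated gradient iterates of the epoch that starts
at `x^{-1} = x^0 = x₀`. -/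
def agdPair (x₀ : Vec d) : ℕ → Vec d × Vec d
  | 0 => (x₀, x₀)
  | k + 1 =>
    let s := agdPair x₀ k
    let y := extrapolate p s.1 s.2
    (s.2, y - p.η • gradient f y)

/-- The iterate `x^k` of the epoch that starts at `x₀`. -/
def agdX (x₀ : Vec d) (k : ℕ) : Vec d := (agdPair f p x₀ k).2

/-- The extrapolated point `y^k` of the epoch that starts at `x₀`. -/
def agdY (x₀ : Vec d) (k : ℕ) : Vec d :=
  extrapolate p (agdPair f p x₀ k).1 (agdPair f p x₀ k).2

/-- The restart condition `k ∑_{t<k} ‖x^{t+1} - x^t‖² > B²`. -/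
def Triggers (x₀ : Vec d) (k : ℕ) : Prop :=
  p.B ^ 2 < k * ∑ t ∈ Finset.range k, ‖agdX f p x₀ (t + 1) - agdX f p x₀ t‖ ^ 2

/-- The epoch that starts at `x₀` ends in a restart: the condition triggers at some `k` reached
by the loop `while k < K`. -/
def EpochRestarts (x₀ : Vec d) : Prop :=
  ∃ k : ℕ, k ≤ ⌈p.K⌉₊ ∧ Triggers f p x₀ k

open Classical in
/-- `x + ξ · 1[‖∇f(y)‖ ≤ B/η]`. -/
def perturb (x y ξ : Vec d) : Vec d :=
  if ‖gradient f y‖ ≤ p.B / p.η then x + ξ else x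

/-- State of the algorithm: the point `x^0` at which the current epoch started, the counter `k`,
and the number of restarts so far. The iterates of the current epoch are
`agdX f p start 0, …, agdX f p start k`. -/
structure State (d : ℕ) where
  start : Vec d
  k : ℕ
  restarts : ℕ

open Classical in
/-- One pass through the body of the loop `while k < K`; it evaluates one new gradient, at `y^k`.
The perturbation used at the `n`-th restart (counting from `0`) is `ξ n`.
A state with `k ≥ K` has left the loop. -/
def step (ξ : ℕ → Vec d) (s : State d) : State d :=
  if (s.k : ℝ) < p.K then
    if Triggers f p s.start (s.k + 1) then
      { start := perturb f p (agdX f p s.start (s.k + 1)) (agdY f p s.start s.k) (ξ s.restarts)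
        k := 0
        restarts := s.restarts + 1 }
    else { s with k := s.k + 1 }
  else s

/-- State after `t` passes, when the method is started at `x^{-1} = x^0 = x₀`. -/
def run (x₀ : Vec d) (ξ : ℕ → Vec d) (t : ℕ) : State d :=
  (step f p ξ)^[t] { start := x₀, k := 0, restarts := 0 }

/-- The loop is left after exactly `T` passes, that is after `T` gradient evaluations. -/
def HaltsAt (x₀ : Vec d) (ξ : ℕ → Vec d) (T : ℕ) : Prop :=
  p.K ≤ (run f p x₀ ξ T).k ∧ ∀ t < T, ((run f p x₀ ξ t).k : ℝ) < p.K

/-- `yhat = (1/(K₀+1)) ∑_{k ≤ K₀} y^k` for the epoch that starts at `x₀`, where `K₀` minimizes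
`‖x^{k+1} - x^k‖` over the integers `⌊K/2⌋ ≤ k ≤ K-1`. Every minimizer is admitted. -/
def IsOutput (x₀ yhat : Vec d) : Prop :=
  ∃ K₀ : ℕ, (⌊p.K / 2⌋₊ ≤ K₀ ∧ (K₀ : ℝ) ≤ p.K - 1) ∧
    (∀ k : ℕ, ⌊p.K / 2⌋₊ ≤ k → (k : ℝ) ≤ p.K - 1 →
      ‖agdX f p x₀ (K₀ + 1) - agdX f p x₀ K₀‖ ≤ ‖agdX f p x₀ (k + 1) - agdX f p x₀ k‖) ∧
    yhat = (1 / ((K₀ : ℝ) + 1)) • ∑ k ∈ Finset.range (K₀ + 1), agdY f p x₀ k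

/-- The method started at `x₀` stops after exactly `T` gradient evaluations and may
return `yhat`. -/
def Returns (x₀ : Vec d) (ξ : ℕ → Vec d) (T : ℕ) (yhat : Vec d) : Prop :=
  HaltsAt f p x₀ ξ T ∧ IsOutput f p (run f p x₀ ξ T).start yhat

/-- Whatever minimizer `K₀` is chosen, the method started at `x₀` stops after at most `N`
gradient evaluations, returns some point, and each point it may return satisfies `Q`. -/
def Achieves (x₀ : Vec d) (ξ : ℕ → Vec d) (N : ℝ) (Q : Vec d → Prop) : Prop :=
  ∃ T : ℕ, (T : ℝ) ≤ N ∧ (∃ yhat, Returns f p x₀ ξ T yhat) ∧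
    ∀ yhat, Returns f p x₀ ξ T yhat → Q yhat

end Algorithm

/-- `Δ L^{1/2} ρ^{1/4} χ⁶ / ε^{7/4}`, plus the order `L^{1/2} χ / (ερ)^{1/4}` of the length `K`
of the last epoch, which is run even when `Δ = 0`. -/
def evalBound (L ρ ε χ Δ : ℝ) : ℝ :=
  Δ * L ^ (1 / 2 : ℝ) * ρ ^ (1 / 4 : ℝ) * χ ^ 6 / ε ^ (7 / 4 : ℝ) +
    L ^ (1 / 2 : ℝ) * χ / (ε * ρ) ^ (1 / 4 : ℝ)

/-- `max {1, log (d L (1 + Δ ρ^{1/2} / ε^{3/2}) / (ζ √(ερ)))}`: the order of `χ`. -/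
def logFactor (d : ℕ) (L ρ ε ζ Δ : ℝ) : ℝ :=
  max 1 (Real.log (d * L * (1 + Δ * √ρ / ε ^ (3 / 2 : ℝ)) / (ζ * √(ε * ρ))))

end

/-! Before the restart condition triggers, the iterates of an epoch stay within `B` of its start,
where `f` is nearly quadratic. In an eigenbasis of the Hessian at the start the iteration splits
into scalar recursions, along each of which the quadratic plus a nonnegative momentum term decreases
by a multiple of the squared steps. An epoch that ends in a restart has made steps of total square
at least of order `B² / K`, or has met a large gradient, and so decreases `f` by a fixed amount; as
`f` is bounded below, there are boundedly many restarts. In the last epoch the gradient at the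
averaged point is nearly the average of the gradients, which telescopes to differences
`x^{k+1} - x^k`, small by the choice of `K₀`.

Near a point where the Hessian has an eigenvalue below `-√(ερ)`, two runs that start a little apart
along the eigenvector separate exponentially fast and cannot both stay within `B`. The perturbations
after which the epoch is not restarted thus form a set all of whose chords in that direction are
short; disjoint translates of it fit into a slightly larger ball, so it has small probability. A
union bound over the epochs shows that with high probability the last epoch starts near a point
without such an eigenvalue. -/

open scoped RealInnerProductSpace

section Taylor

variable {E F : Type*} [NormedAddCommGroup E] [NormedSpace ℝ E]
  [NormedAddCommGroup F] [NormedSpace ℝ F]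

lemma norm_sub_le_of_norm_fderiv_le_mul_norm_pow {g : E → F} {g' : E → E →L[ℝ] F} {x y : E}
    {c : ℝ} (n : ℕ) (hg : ∀ z, HasFDerivAt g (g' z) z) (hb : ∀ z, ‖g' z‖ ≤ c * ‖z - x‖ ^ n) :
    ‖g y - g x‖ ≤ c / (n + 1) * ‖y - x‖ ^ (n + 1) := by
  have h_curve : ∀ t : ℝ, HasDerivAt (fun t : ℝ => g (x + t • (y - x)) - g x)
      (g' (x + t • (y - x)) (y - x)) t := fun t =>
    ((hg _).comp_hasDerivAt t
      (by simpa using ((hasDerivAt_id t).smul_const (y - x)).const_add x)).sub_const _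
  have h_bound : ∀ t : ℝ, HasDerivAt (fun t : ℝ => c / (n + 1) * ‖y - x‖ ^ (n + 1) * t ^ (n + 1))
      (c * ‖y - x‖ ^ (n + 1) * t ^ n) t := fun t => by
    have hn : (n : ℝ) + 1 ≠ 0 := by positivity
    refine ((hasDerivAt_pow (n + 1) t).const_mul _).congr_deriv ?_
    push_cast
    field_simp
  have h_speed : ∀ t ∈ Set.Ico (0 : ℝ) 1,
      ‖g' (x + t • (y - x)) (y - x)‖ ≤ c * ‖y - x‖ ^ (n + 1) * t ^ n := fun t ht =>
    calc ‖g' (x + t • (y - x)) (y - x)‖ ≤ ‖g' (x + t • (y - x))‖ * ‖y - x‖ :=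
          ContinuousLinearMap.le_opNorm _ _
      _ ≤ c * ‖x + t • (y - x) - x‖ ^ n * ‖y - x‖ := by gcongr; exact hb _
      _ = c * ‖y - x‖ ^ (n + 1) * t ^ n := by
          rw [add_sub_cancel_left, norm_smul, Real.norm_of_nonneg ht.1]
          ring
  simpa using image_norm_le_of_norm_deriv_right_le_deriv_boundary
    (fun t _ => (h_curve t).continuousAt.continuousWithinAt)
    (fun t _ => (h_curve t).hasDerivWithinAt) (by simp) h_bound h_speed
    (Set.right_mem_Icc.2 zero_le_one)

end Taylor

namespace SmoothObjective

variable {d : ℕ} {f : Vec d → ℝ} {L ρ : ℝ}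

lemma hasFDerivAt (hf : SmoothObjective f L ρ) (x : Vec d) :
    HasFDerivAt f (innerSL ℝ (gradient f x)) x :=
  (hf.diff x).hasGradientAt.hasFDerivAt

lemma hasFDerivAt_gradient (hf : SmoothObjective f L ρ) (x : Vec d) :
    HasFDerivAt (gradient f) (hess f x) x :=
  (hf.diff_grad x).hasFDerivAt

lemma continuous_gradient (hf : SmoothObjective f L ρ) : Continuous (gradient f) :=
  hf.diff_grad.continuous

lemma isSymmetric_hess (hf : SmoothObjective f L ρ) (x : Vec d) :
    (hess f x : Vec d →ₗ[ℝ] Vec d).IsSymmetric := fun v w => by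
  have h : ⟪hess f x v, w⟫ = ⟪hess f x w, v⟫ := second_derivative_symmetric hf.hasFDerivAt
    ((innerSL ℝ : Vec d →L[ℝ] _).hasFDerivAt.comp x (hf.hasFDerivAt_gradient x)) v w
  exact h.trans (real_inner_comm v _)

lemma norm_hess_le (hf : SmoothObjective f L ρ) (hL : 0 ≤ L) (x : Vec d) : ‖hess f x‖ ≤ L :=
  norm_fderiv_le_of_lip' ℝ hL (Filter.Eventually.of_forall fun y => hf.lip_grad y x)

lemma abs_sub_linear_le (hf : SmoothObjective f L ρ) (x y : Vec d) :
    |f y - f x - ⟪gradient f x, y - x⟫| ≤ L / 2 * ‖y - x‖ ^ 2 :=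
  calc |f y - f x - ⟪gradient f x, y - x⟫|
      = ‖(f y - ⟪gradient f x, y⟫) - (f x - ⟪gradient f x, x⟫)‖ := by
        rw [Real.norm_eq_abs, inner_sub_right, sub_sub_sub_comm]
    _ ≤ L / ((1 : ℕ) + 1) * ‖y - x‖ ^ (1 + 1) :=
        norm_sub_le_of_norm_fderiv_le_mul_norm_pow 1
          (fun z => (hf.hasFDerivAt z).fun_sub (innerSL ℝ (gradient f x)).hasFDerivAt)
          fun z => by
            rw [← map_sub, innerSL_apply_norm, pow_one]
            exact hf.lip_grad z x
    _ = L / 2 * ‖y - x‖ ^ 2 := by norm_num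

lemma norm_gradient_sub_linear_le (hf : SmoothObjective f L ρ) (x y : Vec d) :
    ‖gradient f y - gradient f x - hess f x (y - x)‖ ≤ ρ / 2 * ‖y - x‖ ^ 2 :=
  calc ‖gradient f y - gradient f x - hess f x (y - x)‖
      = ‖(gradient f y - hess f x y) - (gradient f x - hess f x x)‖ := by
        rw [map_sub, sub_sub_sub_comm]
    _ ≤ ρ / ((1 : ℕ) + 1) * ‖y - x‖ ^ (1 + 1) :=
        norm_sub_le_of_norm_fderiv_le_mul_norm_pow 1
          (fun z => (hf.hasFDerivAt_gradient z).fun_sub (hess f x).hasFDerivAt)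
          fun z => by simpa only [pow_one] using hf.lip_hess z x
    _ = ρ / 2 * ‖y - x‖ ^ 2 := by norm_num

lemma hasFDerivAt_hess_quadratic (hf : SmoothObjective f L ρ) (x z : Vec d) :
    HasFDerivAt (fun z => 1 / 2 * ⟪hess f x (z - x), z - x⟫) (innerSL ℝ (hess f x (z - x))) z := by
  have h_shift : HasFDerivAt (fun z : Vec d => z - x) (.id ℝ (Vec d)) z :=
    (hasFDerivAt_id z).sub_const x
  refine (((hess f x).hasFDerivAt.comp z h_shift).inner ℝ h_shift).const_mul (1 / 2)
    |>.congr_fderiv ?_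
  ext v
  have h_symm : ⟪hess f x v, z - x⟫ = ⟪hess f x (z - x), v⟫ := by
    rw [real_inner_comm]
    exact (hf.isSymmetric_hess x (z - x) v).symm
  change 1 / 2 * (⟪hess f x (z - x), v⟫ + ⟪hess f x v, z - x⟫) = ⟪hess f x (z - x), v⟫
  rw [h_symm]
  ring

lemma abs_sub_quadratic_le (hf : SmoothObjective f L ρ) (x y : Vec d) :
    |f y - f x - ⟪gradient f x, y - x⟫ - 1 / 2 * ⟪hess f x (y - x), y - x⟫|
      ≤ ρ / 6 * ‖y - x‖ ^ 3 := by
  set q : Vec d → ℝ := fun z => 1 / 2 * ⟪hess f x (z - x), z - x⟫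
  have hq : q x = 0 := by simp [q]
  calc |f y - f x - ⟪gradient f x, y - x⟫ - q y|
      = ‖(f y - ⟪gradient f x, y⟫ - q y) - (f x - ⟪gradient f x, x⟫ - q x)‖ := by
        rw [Real.norm_eq_abs, inner_sub_right, hq]
        ring_nf
    _ ≤ ρ / 2 / ((2 : ℕ) + 1) * ‖y - x‖ ^ (2 + 1) :=
        norm_sub_le_of_norm_fderiv_le_mul_norm_pow 2
          (fun z => ((hf.hasFDerivAt z).fun_sub (innerSL ℝ (gradient f x)).hasFDerivAt).fun_sub
            (hf.hasFDerivAt_hess_quadratic x z))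
          fun z => by
            rw [← map_sub, ← map_sub, innerSL_apply_norm]
            exact hf.norm_gradient_sub_linear_le x z
    _ = ρ / 6 * ‖y - x‖ ^ 3 := by push_cast; ring

lemma norm_gradient_sub_gradient_sub_hess_le (hf : SmoothObjective f L ρ) (hρ : 0 ≤ ρ) {R : ℝ}
    (x : Vec d) {y z : Vec d} (hy : ‖y - x‖ ≤ R) (hz : ‖z - x‖ ≤ R) :
    ‖gradient f y - gradient f z - hess f x (y - z)‖ ≤ ρ * R * ‖y - z‖ := by
  have h := (convex_closedBall x R).norm_image_sub_le_of_norm_hasFDerivWithin_le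
    (fun u _ => ((hf.hasFDerivAt_gradient u).sub (hess f x).hasFDerivAt).hasFDerivWithinAt)
    (fun u hu => (hf.lip_hess u x).trans
      (mul_le_mul_of_nonneg_left (mem_closedBall_iff_norm.1 hu) hρ))
    (mem_closedBall_iff_norm.2 hz) (mem_closedBall_iff_norm.2 hy)
  rwa [Pi.sub_apply, Pi.sub_apply, sub_sub_sub_comm, ← map_sub] at h

lemma gap_nonneg (hf : SmoothObjective f L ρ) (x : Vec d) : 0 ≤ gap f x :=
  sub_nonneg.2 (ciInf_le hf.bdd x)

end SmoothObjective

section Spectral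

section

variable {𝕜 E : Type*} [RCLike 𝕜] [NormedAddCommGroup E] [InnerProductSpace 𝕜 E]
  [FiniteDimensional 𝕜 E] {n : ℕ} {T : E →ₗ[𝕜] E}

lemma inner_eigenvectorBasis_apply (hT : T.IsSymmetric) (hn : Module.finrank 𝕜 E = n) (i : Fin n)
    (v : E) : inner 𝕜 (hT.eigenvectorBasis hn i) (T v)
      = hT.eigenvalues hn i * inner 𝕜 (hT.eigenvectorBasis hn i) v := by
  simpa only [OrthonormalBasis.repr_apply_apply] using
    hT.eigenvectorBasis_apply_self_apply hn v i

end

lemma inner_apply_self_eq_sum_eigenvalues {E : Type*} [NormedAddCommGroup E]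
    [InnerProductSpace ℝ E] [FiniteDimensional ℝ E] {n : ℕ} {T : E →ₗ[ℝ] E} (hT : T.IsSymmetric)
    (hn : Module.finrank ℝ E = n) (v : E) :
    ⟪T v, v⟫ = ∑ i, hT.eigenvalues hn i * ⟪hT.eigenvectorBasis hn i, v⟫ ^ 2 := by
  rw [← (hT.eigenvectorBasis hn).sum_inner_mul_inner]
  refine Finset.sum_congr rfl fun i _ => ?_
  rw [real_inner_comm, inner_eigenvectorBasis_apply]
  exact (mul_assoc _ _ _).trans (by rw [sq]; rfl)

lemma abs_le_opNorm_of_hasEigenvalue {E : Type*} [NormedAddCommGroup E] [NormedSpace ℝ E]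
    {A : E →L[ℝ] E} {μ : ℝ} (h : Module.End.HasEigenvalue (A : E →ₗ[ℝ] E) μ) : |μ| ≤ ‖A‖ := by
  obtain ⟨v, hv⟩ := h.exists_hasEigenvector
  have h_norm := A.le_opNorm v
  rw [show A v = μ • v from hv.apply_eq_smul, norm_smul, Real.norm_eq_abs] at h_norm
  exact le_of_mul_le_mul_right h_norm (norm_pos_iff.2 hv.2)

variable {d : ℕ} {A A' : Vec d →L[ℝ] Vec d}

lemma lambdaMin_eq_iInf (hA : (A : Vec d →ₗ[ℝ] Vec d).IsSymmetric)
    (hn : Module.finrank ℝ (Vec d) = d) : lambdaMin A = ⨅ i, hA.eigenvalues hn i := by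
  refine congr_arg sInf (Set.ext fun μ => ⟨fun hμ => ?_, ?_⟩)
  · exact hA.exists_eigenvalues_eq hn hμ
  · rintro ⟨i, rfl⟩
    exact hA.hasEigenvalue_eigenvalues hn i

lemma lambdaMin_le_eigenvalues (hA : (A : Vec d →ₗ[ℝ] Vec d).IsSymmetric)
    (hn : Module.finrank ℝ (Vec d) = d) (i : Fin d) : lambdaMin A ≤ hA.eigenvalues hn i :=
  (lambdaMin_eq_iInf hA hn).trans_le (ciInf_le (Set.finite_range _).bddBelow i)

-- For `d = 0` there is no eigenvalue, and `lambdaMin A = sInf ∅ = 0` is a junk value.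
lemma exists_eigenvalues_eq_lambdaMin (hd : 0 < d) (hA : (A : Vec d →ₗ[ℝ] Vec d).IsSymmetric)
    (hn : Module.finrank ℝ (Vec d) = d) : ∃ i, hA.eigenvalues hn i = lambdaMin A := by
  have : Nonempty (Fin d) := ⟨⟨0, hd⟩⟩
  rw [lambdaMin_eq_iInf hA hn]
  exact exists_eq_ciInf_of_finite

lemma lambdaMin_mul_norm_sq_le (hA : (A : Vec d →ₗ[ℝ] Vec d).IsSymmetric) (v : Vec d) :
    lambdaMin A * ‖v‖ ^ 2 ≤ ⟪A v, v⟫ := by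
  have hn : Module.finrank ℝ (Vec d) = d := finrank_euclideanSpace_fin
  calc lambdaMin A * ‖v‖ ^ 2
      = ∑ i, lambdaMin A * ⟪hA.eigenvectorBasis hn i, v⟫ ^ 2 := by
        rw [← Finset.mul_sum, (hA.eigenvectorBasis hn).sum_sq_inner_right]
    _ ≤ ∑ i, hA.eigenvalues hn i * ⟪hA.eigenvectorBasis hn i, v⟫ ^ 2 := by
        gcongr with i
        exact lambdaMin_le_eigenvalues hA hn i
    _ = ⟪A v, v⟫ := (inner_apply_self_eq_sum_eigenvalues hA hn v).symm

lemma lambdaMin_sub_norm_sub_le (hd : 0 < d) (hA : (A : Vec d →ₗ[ℝ] Vec d).IsSymmetric)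
    (hA' : (A' : Vec d →ₗ[ℝ] Vec d).IsSymmetric) : lambdaMin A - ‖A' - A‖ ≤ lambdaMin A' := by
  have hn : Module.finrank ℝ (Vec d) = d := finrank_euclideanSpace_fin
  obtain ⟨i, hi⟩ := exists_eigenvalues_eq_lambdaMin hd hA' hn
  set e := hA'.eigenvectorBasis hn i
  have he : ‖e‖ = 1 := (hA'.eigenvectorBasis hn).orthonormal.1 i
  have h_min : ⟪A' e, e⟫ = lambdaMin A' := by
    have h : A' e = hA'.eigenvalues hn i • e := hA'.apply_eigenvectorBasis hn i
    rw [h, real_inner_smul_left, real_inner_self_eq_norm_sq, he, hi, one_pow, mul_one]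
  have h_rayleigh : lambdaMin A ≤ ⟪A e, e⟫ := by
    simpa [he] using lambdaMin_mul_norm_sq_le hA e
  have h_diff : |⟪(A' - A) e, e⟫| ≤ ‖A' - A‖ := by
    simpa [he] using (abs_real_inner_le_norm _ _).trans
      (mul_le_mul_of_nonneg_right ((A' - A).le_opNorm e) (norm_nonneg e))
  rw [sub_apply, inner_sub_left, h_min] at h_diff
  linarith [(abs_le.1 h_diff).1]

end Spectral

section Momentum

/-- The extrapolated sequence `u_k + (1 - θ) (u_k - u_{k-1})`. Since `0 - 1 = 0` in `ℕ`, the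
sequence is continued to the left by `u_{-1} = u_0`. -/
def withMomentum {E : Type*} [AddCommGroup E] [Module ℝ E] (θ : ℝ) (u : ℕ → E) (k : ℕ) : E :=
  u k + (1 - θ) • (u k - u (k - 1))

lemma withMomentum_sub_const {E : Type*} [AddCommGroup E] [Module ℝ E] (θ : ℝ) (u : ℕ → E) (x : E)
    (k : ℕ) : withMomentum θ (fun j => u j - x) k = withMomentum θ u k - x := by
  simp only [withMomentum, sub_sub_sub_cancel_right]
  abel

lemma inner_withMomentum {E : Type*} [NormedAddCommGroup E] [InnerProductSpace ℝ E] (θ : ℝ)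
    (e : E) (u : ℕ → E) (k : ℕ) :
    ⟪e, withMomentum θ u k⟫ = withMomentum θ (fun j => ⟪e, u j⟫) k := by
  simp only [withMomentum, inner_add_right, inner_sub_right, real_inner_smul_right, smul_eq_mul]

/-- The sum `∑_{t<n} ‖u_{t+1} - u_t‖²` that the restart condition monitors. -/
def sumSqSteps {E : Type*} [SeminormedAddGroup E] (u : ℕ → E) (n : ℕ) : ℝ :=
  ∑ t ∈ Finset.range n, ‖u (t + 1) - u t‖ ^ 2

section SumSqSteps

variable {E : Type*} [SeminormedAddCommGroup E] (u : ℕ → E) (n : ℕ)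

lemma sumSqSteps_nonneg : 0 ≤ sumSqSteps u n :=
  Finset.sum_nonneg fun _ _ => sq_nonneg _

lemma sumSqSteps_succ : sumSqSteps u (n + 1) = sumSqSteps u n + ‖u (n + 1) - u n‖ ^ 2 :=
  Finset.sum_range_succ _ n

lemma sumSqSteps_sub_const (x : E) : sumSqSteps (fun k => u k - x) n = sumSqSteps u n := by
  simp only [sumSqSteps, sub_sub_sub_cancel_right]

lemma sumSqSteps_eq_add_pred :
    sumSqSteps u n = sumSqSteps u (n - 1) + ‖u n - u (n - 1)‖ ^ 2 := by
  cases n with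
  | zero => simp [sumSqSteps]
  | succ n => exact sumSqSteps_succ u n

lemma norm_sub_sq_le_mul_sumSqSteps : ‖u n - u 0‖ ^ 2 ≤ n * sumSqSteps u n :=
  calc ‖u n - u 0‖ ^ 2 ≤ (∑ t ∈ Finset.range n, ‖u (t + 1) - u t‖) ^ 2 := by
        rw [← Finset.sum_range_sub]
        gcongr
        exact norm_sum_le _ _
    _ ≤ n * sumSqSteps u n := by
        simpa [sumSqSteps] using
          sq_sum_le_card_mul_sum_sq (s := Finset.range n) (f := fun t => ‖u (t + 1) - u t‖)

end SumSqSteps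

section Scalar

variable {η θ l c : ℝ}

-- The difference of the two sides is a combination of squares with nonnegative coefficients.
lemma scalar_quadratic_step_of_mild_curvature {δ a₀ a b a₁ : ℝ} (hη : 0 < η) (hθ : 0 < θ)
    (hθ1 : θ < 1) (hl : l * η ≤ 1) (hl' : -θ ≤ l * η) (hb : b = a + (1 - θ) * (a - a₀))
    (ha₁ : a₁ = b - η * (c + l * b + δ)) :
    c * a₁ + l / 2 * a₁ ^ 2 + (1 - θ) / (2 * η) * (a₁ - a) ^ 2 ≤
      c * a + l / 2 * a ^ 2 + (1 - θ) / (2 * η) * (a - a₀) ^ 2 - 3 * θ / (8 * η) * (a₁ - a) ^ 2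
        + 2 * η / θ * δ ^ 2 := by
  have hc : c = (b - a₁) / η - l * b - δ := by field_simp; linarith
  have h_momentum : (1 - θ) * (1 - (1 - θ) * (1 - l * η)) / (2 * η) * (a - a₀) ^ 2
      = (1 - θ) / (2 * η) * (a - a₀) ^ 2 - (1 - l * η) / (2 * η) * (b - a) ^ 2 := by
    rw [hb]; ring
  have h_squares : c * a + l / 2 * a ^ 2 + (1 - θ) / (2 * η) * (a - a₀) ^ 2
        - 3 * θ / (8 * η) * (a₁ - a) ^ 2 + 2 * η / θ * δ ^ 2
        - (c * a₁ + l / 2 * a₁ ^ 2 + (1 - θ) / (2 * η) * (a₁ - a) ^ 2)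
      = (1 - θ) * (1 - (1 - θ) * (1 - l * η)) / (2 * η) * (a - a₀) ^ 2
        + (1 - l * η) / (2 * η) * (a₁ - b) ^ 2
        + (θ * (a₁ - a) + 4 * η * δ) ^ 2 / (8 * η * θ) := by
    rw [h_momentum, hc]
    field_simp
    ring
  have : 0 ≤ 1 - θ := by linarith
  have : 0 ≤ 1 - l * η := by linarith
  have h_coeff : 0 ≤ 1 - (1 - θ) * (1 - l * η) := by nlinarith
  rw [← sub_nonneg, h_squares]
  positivity

lemma scalar_power_step_of_negative_curvature {δ a₀ a b a₁ : ℝ} (hη : 0 < η) (hθ : 0 < θ)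
    (hθ1 : θ < 1) (hl : -1 ≤ l * η) (hl' : l * η ≤ 0) (hb : b = a + (1 - θ) * (a - a₀))
    (ha₁ : a₁ = b - η * (c + l * b + δ)) :
    (a₁ - a) * (l * a + c) ≤ (1 - θ) * ((a - a₀) * (l * a₀ + c)) + η / 2 * δ ^ 2 := by
  have h_squares : (1 - θ) * ((a - a₀) * (l * a₀ + c)) + η / 2 * δ ^ 2 - (a₁ - a) * (l * a + c)
      = η / 2 * (l * a + c + δ) ^ 2 + η / 2 * (l * a + c + l * (1 - θ) * (a - a₀)) ^ 2
        + -l * (1 - θ) * (a - a₀) ^ 2 * (1 + (1 - θ) * (l * η) / 2) := by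
    rw [ha₁, hb]
    ring
  have h_l : 0 ≤ -l := neg_nonneg.2 (nonpos_of_mul_nonpos_left hl' hη)
  have : 0 ≤ 1 - θ := by linarith
  have h_coeff : 0 ≤ 1 + (1 - θ) * (l * η) / 2 := by nlinarith
  rw [← sub_nonneg, h_squares]
  positivity

lemma scalar_quadratic_step_of_negative_curvature {δ a₀ a b a₁ : ℝ} (hη : 0 < η) (hθ : 0 < θ)
    (hθ1 : θ < 1) (hl : -1 ≤ l * η) (hl' : l * η ≤ -θ) (hb : b = a + (1 - θ) * (a - a₀))
    (ha₁ : a₁ = b - η * (c + l * b + δ)) :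
    c * a₁ + l / 2 * a₁ ^ 2 + (1 - θ) / θ * max 0 ((a₁ - a) * (l * a + c)) ≤
      c * a + l / 2 * a ^ 2 + (1 - θ) / θ * max 0 ((a - a₀) * (l * a₀ + c))
        - 3 * θ / (8 * η) * (a₁ - a) ^ 2 + 2 * η / θ * δ ^ 2 := by
  have h_power := scalar_power_step_of_negative_curvature hη hθ hθ1 hl (by linarith) hb ha₁
  set s₁ := (a₁ - a) * (l * a + c) with hs₁
  set s := (a - a₀) * (l * a₀ + c)
  have : 0 ≤ 1 - θ := by linarith
  have h_contract : max 0 s₁ ≤ (1 - θ) * max 0 s + η / 2 * δ ^ 2 :=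
    max_le (by positivity) (h_power.trans (by gcongr; exact le_max_right 0 s))
  have h_step : l / 2 * (a₁ - a) ^ 2 ≤ -(3 * θ / (8 * η)) * (a₁ - a) ^ 2 := by
    gcongr
    have h_l : l ≤ -θ / η := (le_div_iff₀ hη).2 hl'
    have h_nonneg : 0 ≤ θ / η := by positivity
    rw [show 3 * θ / (8 * η) = 3 / 8 * (θ / η) by ring]
    rw [neg_div] at h_l
    linarith
  calc c * a₁ + l / 2 * a₁ ^ 2 + (1 - θ) / θ * max 0 s₁
      = c * a + l / 2 * a ^ 2 + s₁ + l / 2 * (a₁ - a) ^ 2 + (1 - θ) / θ * max 0 s₁ := by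
        rw [hs₁]; ring
    _ ≤ c * a + l / 2 * a ^ 2 + l / 2 * (a₁ - a) ^ 2 + max 0 s₁ / θ := by
        have h_unit : max 0 s₁ / θ = max 0 s₁ + (1 - θ) / θ * max 0 s₁ := by field_simp; ring
        linarith [le_max_right 0 s₁]
    _ ≤ c * a + l / 2 * a ^ 2 + -(3 * θ / (8 * η)) * (a₁ - a) ^ 2
          + ((1 - θ) * max 0 s + η / 2 * δ ^ 2) / θ := by gcongr
    _ = c * a + l / 2 * a ^ 2 + (1 - θ) / θ * max 0 s - 3 * θ / (8 * η) * (a₁ - a) ^ 2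
          + 1 / 4 * (2 * η / θ * δ ^ 2) := by ring
    _ ≤ _ := by
        have h_nonneg : 0 ≤ 2 * η / θ * δ ^ 2 := by positivity
        linarith

lemma le_sum_of_step_le {Φ s e : ℕ → ℝ} {α β : ℝ} (h0 : Φ 0 = 0)
    (h : ∀ k, Φ (k + 1) ≤ Φ k - α * s k + β * e k) (n : ℕ) :
    Φ n ≤ -α * ∑ k ∈ Finset.range n, s k + β * ∑ k ∈ Finset.range n, e k := by
  induction n with
  | zero => simp [h0]
  | succ n ih =>
    rw [Finset.sum_range_succ, Finset.sum_range_succ]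
    linarith [h n]

lemma scalar_quadratic_le_of_momentum {a δ : ℕ → ℝ} (hη : 0 < η) (hθ : 0 < θ) (hθ1 : θ < 1)
    (hl : |l| * η ≤ 1) (h0 : a 0 = 0)
    (ha : ∀ k, a (k + 1) = withMomentum θ a k - η * (c + l * withMomentum θ a k + δ k)) (n : ℕ) :
    c * a n + l / 2 * a n ^ 2 ≤ -(3 * θ / (8 * η)) * ∑ k ∈ Finset.range n, (a (k + 1) - a k) ^ 2
      + 2 * η / θ * ∑ k ∈ Finset.range n, δ k ^ 2 := by
  obtain ⟨hl₁, hl₂⟩ := abs_le.1 (by rwa [abs_mul, abs_of_pos hη] : |l * η| ≤ 1)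
  have : 0 ≤ 1 - θ := by linarith
  rcases le_total (-θ) (l * η) with h_mild | h_neg
  · refine le_trans ?_ (le_sum_of_step_le
      (Φ := fun k => c * a k + l / 2 * a k ^ 2 + (1 - θ) / (2 * η) * (a k - a (k - 1)) ^ 2)
      (by simp [h0])
      (fun k => scalar_quadratic_step_of_mild_curvature hη hθ hθ1 hl₂ h_mild rfl (ha k)) n)
    exact le_add_of_nonneg_right (by positivity)
  · refine le_trans ?_ (le_sum_of_step_le
      (Φ := fun k => c * a k + l / 2 * a k ^ 2
        + (1 - θ) / θ * max 0 ((a k - a (k - 1)) * (l * a (k - 1) + c)))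
      (by simp [h0])
      (fun k => scalar_quadratic_step_of_negative_curvature hη hθ hθ1 hl₁ h_neg rfl (ha k)) n)
    exact le_add_of_nonneg_right (by positivity)

end Scalar

-- In an eigenbasis of `T` the recursion splits into scalar ones.
lemma quadratic_le_of_momentum {E : Type*} [NormedAddCommGroup E] [InnerProductSpace ℝ E]
    [FiniteDimensional ℝ E] {T : E →L[ℝ] E} (hT : (T : E →ₗ[ℝ] E).IsSymmetric) {η θ : ℝ} {g : E}
    {w δ : ℕ → E} (hη : 0 < η) (hθ : 0 < θ) (hθ1 : θ < 1) (hTη : ‖T‖ * η ≤ 1) (h0 : w 0 = 0)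
    (hw : ∀ k, w (k + 1) =
      withMomentum θ w k - η • (g + T (withMomentum θ w k) + δ k)) (n : ℕ) :
    ⟪g, w n⟫ + 1 / 2 * ⟪T (w n), w n⟫ ≤
      -(3 * θ / (8 * η)) * sumSqSteps w n + 2 * η / θ * ∑ k ∈ Finset.range n, ‖δ k‖ ^ 2 := by
  set b := hT.eigenvectorBasis rfl
  set l := hT.eigenvalues rfl
  have h_coord (i) : ⟪b i, g⟫ * ⟪b i, w n⟫ + l i / 2 * ⟪b i, w n⟫ ^ 2 ≤
      -(3 * θ / (8 * η)) * ∑ k ∈ Finset.range n, (⟪b i, w (k + 1)⟫ - ⟪b i, w k⟫) ^ 2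
        + 2 * η / θ * ∑ k ∈ Finset.range n, ⟪b i, δ k⟫ ^ 2 := by
    have hl : |l i| ≤ ‖T‖ := abs_le_opNorm_of_hasEigenvalue (hT.hasEigenvalue_eigenvalues rfl i)
    refine scalar_quadratic_le_of_momentum (a := fun k => ⟪b i, w k⟫) (δ := fun k => ⟪b i, δ k⟫)
      hη hθ hθ1 (le_trans (by gcongr) hTη) (by simp [h0]) (fun k => ?_) n
    have hT_coord : ⟪b i, T (withMomentum θ w k)⟫ = l i * ⟪b i, withMomentum θ w k⟫ :=
      inner_eigenvectorBasis_apply hT rfl i _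
    rw [hw, inner_sub_right, real_inner_smul_right, inner_add_right, inner_add_right, hT_coord,
      inner_withMomentum]
  have h_quadratic : 1 / 2 * ⟪T (w n), w n⟫ = ∑ i, l i / 2 * ⟪b i, w n⟫ ^ 2 := by
    have h : ⟪T (w n), w n⟫ = ∑ i, l i * ⟪b i, w n⟫ ^ 2 :=
      inner_apply_self_eq_sum_eigenvalues hT rfl (w n)
    rw [h, Finset.mul_sum]
    exact Finset.sum_congr rfl fun i _ => by ring
  have h_linear : ⟪g, w n⟫ = ∑ i, ⟪b i, g⟫ * ⟪b i, w n⟫ := by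
    rw [← b.sum_inner_mul_inner]
    exact Finset.sum_congr rfl fun i _ => by rw [real_inner_comm]
  calc ⟪g, w n⟫ + 1 / 2 * ⟪T (w n), w n⟫
      = ∑ i, (⟪b i, g⟫ * ⟪b i, w n⟫ + l i / 2 * ⟪b i, w n⟫ ^ 2) := by
        rw [h_linear, h_quadratic, Finset.sum_add_distrib]
    _ ≤ _ := Finset.sum_le_sum fun i _ => h_coord i
    _ = _ := by
        simp only [Finset.sum_add_distrib, ← Finset.mul_sum, ← inner_sub_right]
        rw [Finset.sum_comm, Finset.sum_comm (f := fun i k => ⟪b i, δ k⟫ ^ 2)]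
        simp only [b.sum_sq_inner_right, sumSqSteps]

end Momentum

/-- The relations between the parameters on which the analysis of the method rests. They hold for
`params L ρ ε χ`, and they determine `ε` only through `B`. -/
structure Params.Tuned (p : Params) (L ρ χ : ℝ) : Prop where
  L_pos : 0 < L
  ρ_pos : 0 < ρ
  one_le : 1 ≤ χ
  η_eq : p.η = 1 / (4 * L)
  θ_pos : 0 < p.θ
  θ_lt : p.θ < 1
  B_pos : 0 < p.B
  K_eq : p.K = 2 * χ / p.θ
  B_eq : 288 * χ ^ 2 * (ρ * p.B * p.η) = p.θ ^ 2

/-- The unit `θ B² / (η K)` in which the decrease of the objective per epoch is measured. -/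
noncomputable def Params.decreaseUnit (p : Params) : ℝ := p.θ * p.B ^ 2 / (p.η * p.K)

namespace Params.Tuned

variable {p : Params} {L ρ χ : ℝ}

lemma η_pos (hp : p.Tuned L ρ χ) : 0 < p.η := by
  have := hp.L_pos
  rw [hp.η_eq]
  positivity

lemma χ_pos (hp : p.Tuned L ρ χ) : 0 < χ := one_pos.trans_le hp.one_le

lemma L_mul_η (hp : p.Tuned L ρ χ) : L * p.η = 1 / 4 := by
  have := hp.L_pos
  rw [hp.η_eq]
  field_simp

lemma L_eq (hp : p.Tuned L ρ χ) : L = 1 / (4 * p.η) := by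
  have := hp.η_pos
  rw [eq_div_iff (by positivity)]
  linarith [hp.L_mul_η]

lemma two_lt_K (hp : p.Tuned L ρ χ) : 2 < p.K := by
  rw [hp.K_eq, lt_div_iff₀ hp.θ_pos]
  linarith [hp.θ_lt, hp.one_le]

lemma K_pos (hp : p.Tuned L ρ χ) : 0 < p.K := two_pos.trans hp.two_lt_K

lemma two_lt_ceil_K (hp : p.Tuned L ρ χ) : 2 < ⌈p.K⌉₊ :=
  Nat.lt_ceil.2 (by exact_mod_cast hp.two_lt_K)

lemma ceil_K_le (hp : p.Tuned L ρ χ) : (⌈p.K⌉₊ : ℝ) ≤ 3 / 2 * p.K := by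
  linarith [Nat.ceil_lt_add_one hp.K_pos.le, hp.two_lt_K]

lemma decreaseUnit_pos (hp : p.Tuned L ρ χ) : 0 < p.decreaseUnit := by
  have := hp.θ_pos
  have := hp.B_pos
  have := hp.η_pos
  have := hp.K_pos
  unfold Params.decreaseUnit
  positivity

lemma decreaseUnit_le (hp : p.Tuned L ρ χ) : p.decreaseUnit ≤ p.B ^ 2 / p.η := by
  have hη := hp.η_pos
  have hθK : p.θ / p.K ≤ 1 := (div_le_one hp.K_pos).2 (by linarith [hp.θ_lt, hp.two_lt_K])
  calc p.decreaseUnit = p.θ / p.K * (p.B ^ 2 / p.η) := by unfold Params.decreaseUnit; ring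
    _ ≤ 1 * (p.B ^ 2 / p.η) := by gcongr
    _ = p.B ^ 2 / p.η := one_mul _

lemma ρ_B_η_K_le (hp : p.Tuned L ρ χ) : ρ * p.B * p.η * p.K ≤ p.θ / 144 := by
  have hθ := hp.θ_pos
  have hχ := hp.χ_pos
  calc ρ * p.B * p.η * p.K = 288 * χ ^ 2 * (ρ * p.B * p.η) / (144 * χ * p.θ) := by
        rw [hp.K_eq]
        field_simp
        ring
    _ = p.θ / 144 / χ := by
        rw [hp.B_eq]
        field_simp
    _ ≤ p.θ / 144 := div_le_self (by positivity) hp.one_le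

lemma sum_sq_error_le (hp : p.Tuned L ρ χ) :
    2 * p.η / p.θ * (3 / 2 * p.K * (2 * ρ * p.B ^ 2) ^ 2) ≤ 1 / 64 * p.decreaseUnit := by
  have hη := hp.η_pos
  have hB := hp.B_pos
  have hθ := hp.θ_pos
  have hK := hp.K_pos
  have hρ := hp.ρ_pos
  calc 2 * p.η / p.θ * (3 / 2 * p.K * (2 * ρ * p.B ^ 2) ^ 2)
      = 12 * (p.B ^ 2 / (p.η * p.K * p.θ)) * (ρ * p.B * p.η * p.K) ^ 2 := by
        field_simp
        ring
    _ ≤ 12 * (p.B ^ 2 / (p.η * p.K * p.θ)) * (p.θ / 144) ^ 2 := by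
        gcongr
        exact hp.ρ_B_η_K_le
    _ = 12 / 144 ^ 2 * p.decreaseUnit := by
        unfold Params.decreaseUnit
        field_simp
    _ ≤ 1 / 64 * p.decreaseUnit :=
        mul_le_mul_of_nonneg_right (by norm_num) hp.decreaseUnit_pos.le

lemma cubic_error_le (hp : p.Tuned L ρ χ) : ρ / 6 * (3 * p.B) ^ 3 ≤ 1 / 32 * p.decreaseUnit := by
  have hη := hp.η_pos
  have hK := hp.K_pos
  calc ρ / 6 * (3 * p.B) ^ 3 = 9 / 2 * (p.B ^ 2 / (p.η * p.K)) * (ρ * p.B * p.η * p.K) := by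
        field_simp
        ring
    _ ≤ 9 / 2 * (p.B ^ 2 / (p.η * p.K)) * (p.θ / 144) := by
        gcongr
        exact hp.ρ_B_η_K_le
    _ = 1 / 32 * p.decreaseUnit := by
        unfold Params.decreaseUnit
        field_simp
        ring

end Params.Tuned

section Epoch

variable {d : ℕ} {f : Vec d → ℝ} {p : Params} {L ρ χ : ℝ} {x₀ : Vec d} {n : ℕ}

lemma agdX_zero (f : Vec d → ℝ) (p : Params) (x₀ : Vec d) : agdX f p x₀ 0 = x₀ := rfl

lemma agdX_succ (f : Vec d → ℝ) (p : Params) (x₀ : Vec d) (k : ℕ) :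
    agdX f p x₀ (k + 1) = agdY f p x₀ k - p.η • gradient f (agdY f p x₀ k) := rfl

lemma agdY_eq_withMomentum (f : Vec d → ℝ) (p : Params) (x₀ : Vec d) (k : ℕ) :
    agdY f p x₀ k = withMomentum p.θ (agdX f p x₀) k := by
  cases k <;> rfl

lemma agdY_zero (f : Vec d → ℝ) (p : Params) (x₀ : Vec d) : agdY f p x₀ 0 = x₀ := by
  simp [agdY_eq_withMomentum, withMomentum, agdX_zero]

lemma triggers_iff : Triggers f p x₀ n ↔ p.B ^ 2 < n * sumSqSteps (agdX f p x₀) n := Iff.rfl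

lemma mul_sumSqSteps_le (hn : ¬ Triggers f p x₀ n) :
    n * sumSqSteps (agdX f p x₀) n ≤ p.B ^ 2 :=
  not_lt.1 (triggers_iff.not.1 hn)

lemma sumSqSteps_le (hn : ¬ Triggers f p x₀ n) : sumSqSteps (agdX f p x₀) n ≤ p.B ^ 2 := by
  rcases n.eq_zero_or_pos with rfl | h_pos
  · simpa [sumSqSteps] using sq_nonneg p.B
  · exact (le_mul_of_one_le_left (sumSqSteps_nonneg _ _) (by exact_mod_cast h_pos)).trans
      (mul_sumSqSteps_le hn)

lemma norm_agdX_sub_le (hB : 0 ≤ p.B) (hn : ¬ Triggers f p x₀ n) : ‖agdX f p x₀ n - x₀‖ ≤ p.B :=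
  le_of_sq_le_sq ((norm_sub_sq_le_mul_sumSqSteps (agdX f p x₀) n).trans (mul_sumSqSteps_le hn)) hB

lemma norm_agdX_sub_pred_le (hB : 0 ≤ p.B) (hn : ¬ Triggers f p x₀ n) :
    ‖agdX f p x₀ n - agdX f p x₀ (n - 1)‖ ≤ p.B := by
  have h := sumSqSteps_le hn
  rw [sumSqSteps_eq_add_pred] at h
  exact le_of_sq_le_sq (by linarith [sumSqSteps_nonneg (agdX f p x₀) (n - 1)]) hB

lemma norm_agdY_sub_agdX_le (hθ : 0 ≤ p.θ) (hθ1 : p.θ ≤ 1) :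
    ‖agdY f p x₀ n - agdX f p x₀ n‖ ≤ ‖agdX f p x₀ n - agdX f p x₀ (n - 1)‖ := by
  rw [agdY_eq_withMomentum, withMomentum, add_sub_cancel_left, norm_smul,
    Real.norm_of_nonneg (by linarith)]
  exact mul_le_of_le_one_left (norm_nonneg _) (by linarith)

lemma norm_agdY_sub_le (hp : p.Tuned L ρ χ) (hn : ¬ Triggers f p x₀ n) :
    ‖agdY f p x₀ n - x₀‖ ≤ 2 * p.B := by
  have h_momentum := (norm_agdY_sub_agdX_le hp.θ_pos.le hp.θ_lt.le).trans
    (norm_agdX_sub_pred_le hp.B_pos.le hn)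
  linarith [norm_sub_le_norm_sub_add_norm_sub (agdY f p x₀ n) (agdX f p x₀ n) x₀,
    norm_agdX_sub_le hp.B_pos.le hn]

lemma SmoothObjective.apply_gradient_step_le (hf : SmoothObjective f L ρ) (hp : p.Tuned L ρ χ)
    (x y : Vec d) :
    f (y - p.η • gradient f y) ≤ f x + 5 / (8 * p.η) * ‖y - x‖ ^ 2
      - 1 / (2 * p.η) * ‖y - p.η • gradient f y - x‖ ^ 2
      - 3 * p.η / 8 * ‖gradient f y‖ ^ 2 := by
  have hη := hp.η_pos
  set g := gradient f y
  have h_descent : f (y - p.η • g) - f y + p.η * ‖g‖ ^ 2 ≤ p.η / 8 * ‖g‖ ^ 2 := by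
    have h := (abs_le.1 (hf.abs_sub_linear_le y (y - p.η • g))).2
    rw [sub_sub_cancel_left, inner_neg_right, norm_neg, real_inner_smul_right,
      real_inner_self_eq_norm_sq, norm_smul, Real.norm_of_nonneg hη.le, hp.L_eq] at h
    have h_coeff : 1 / (4 * p.η) / 2 * (p.η * ‖g‖) ^ 2 = p.η / 8 * ‖g‖ ^ 2 := by
      field_simp
      ring
    linarith
  have h_linear : f y - f x - ⟪g, y - x⟫ ≤ 1 / (8 * p.η) * ‖y - x‖ ^ 2 := by
    have h := (abs_le.1 (hf.abs_sub_linear_le y x)).1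
    rw [← neg_sub y x, inner_neg_right, norm_neg, hp.L_eq] at h
    have h_coeff : 1 / (4 * p.η) / 2 = 1 / (8 * p.η) := by
      field_simp
      ring
    rw [h_coeff] at h
    linarith
  have h_square : 1 / (2 * p.η) * ‖y - p.η • g - x‖ ^ 2
      = 1 / (2 * p.η) * ‖y - x‖ ^ 2 - ⟪g, y - x⟫ + p.η / 2 * ‖g‖ ^ 2 := by
    rw [sub_right_comm, norm_sub_sq_real, norm_smul, Real.norm_of_nonneg hη.le,
      real_inner_smul_right, real_inner_comm]
    field_simp
  have h_coeff : 5 / (8 * p.η) * ‖y - x‖ ^ 2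
      = 1 / (2 * p.η) * ‖y - x‖ ^ 2 + 1 / (8 * p.η) * ‖y - x‖ ^ 2 := by
    field_simp
    ring
  linarith

lemma apply_agdX_succ_le (hf : SmoothObjective f L ρ) (hp : p.Tuned L ρ χ) (x₀ : Vec d) (k : ℕ) :
    f (agdX f p x₀ (k + 1)) ≤ f (agdX f p x₀ k)
      + 1 / (2 * p.η) * ‖agdX f p x₀ k - agdX f p x₀ (k - 1)‖ ^ 2
      + 1 / (8 * p.η) * ‖agdX f p x₀ k - agdX f p x₀ (k - 1)‖ ^ 2
      - 1 / (2 * p.η) * ‖agdX f p x₀ (k + 1) - agdX f p x₀ k‖ ^ 2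
      - 3 * p.η / 8 * ‖gradient f (agdY f p x₀ k)‖ ^ 2 := by
  have hη := hp.η_pos
  have h_step := hf.apply_gradient_step_le hp (agdX f p x₀ k) (agdY f p x₀ k)
  rw [← agdX_succ] at h_step
  have h_momentum : 5 / (8 * p.η) * ‖agdY f p x₀ k - agdX f p x₀ k‖ ^ 2
      ≤ 5 / (8 * p.η) * ‖agdX f p x₀ k - agdX f p x₀ (k - 1)‖ ^ 2 := by
    gcongr
    exact norm_agdY_sub_agdX_le hp.θ_pos.le hp.θ_lt.le
  have h_coeff : 5 / (8 * p.η) = 1 / (2 * p.η) + 1 / (8 * p.η) := by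
    field_simp
    ring
  rw [h_coeff] at h_step h_momentum
  linarith

lemma agd_energy_le (hf : SmoothObjective f L ρ) (hp : p.Tuned L ρ χ) (x₀ : Vec d) (k : ℕ) :
    f (agdX f p x₀ k) + 1 / (2 * p.η) * ‖agdX f p x₀ k - agdX f p x₀ (k - 1)‖ ^ 2
      ≤ f x₀ + 1 / (8 * p.η) * sumSqSteps (agdX f p x₀) (k - 1) := by
  have hη := hp.η_pos
  induction k with
  | zero => simp [agdX_zero, sumSqSteps]
  | succ k ih =>
    rw [Nat.add_sub_cancel, sumSqSteps_eq_add_pred, mul_add]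
    have h_gradient : 0 ≤ 3 * p.η / 8 * ‖gradient f (agdY f p x₀ k)‖ ^ 2 := by positivity
    linarith [apply_agdX_succ_le hf hp x₀ k]

lemma decrease_of_large_gradient (hf : SmoothObjective f L ρ) (hp : p.Tuned L ρ χ)
    (hn : ¬ Triggers f p x₀ n) (hg : p.B / p.η < ‖gradient f (agdY f p x₀ n)‖) :
    f (agdX f p x₀ (n + 1)) ≤ f x₀ - 1 / 4 * (p.B ^ 2 / p.η) := by
  have hη := hp.η_pos
  have hB := hp.B_pos
  have h_gradient : p.B ^ 2 / p.η ≤ p.η * ‖gradient f (agdY f p x₀ n)‖ ^ 2 :=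
    calc p.B ^ 2 / p.η = p.η * (p.B / p.η) ^ 2 := by field_simp
      _ ≤ p.η * ‖gradient f (agdY f p x₀ n)‖ ^ 2 := by gcongr
  have h_steps : 1 / (8 * p.η) * sumSqSteps (agdX f p x₀) (n - 1)
      + 1 / (8 * p.η) * ‖agdX f p x₀ n - agdX f p x₀ (n - 1)‖ ^ 2
      ≤ 1 / 8 * (p.B ^ 2 / p.η) := by
    rw [← mul_add, ← sumSqSteps_eq_add_pred]
    calc 1 / (8 * p.η) * sumSqSteps (agdX f p x₀) n ≤ 1 / (8 * p.η) * p.B ^ 2 := by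
          gcongr
          exact sumSqSteps_le hn
      _ = 1 / 8 * (p.B ^ 2 / p.η) := by field_simp
  have h_last : 0 ≤ 1 / (2 * p.η) * ‖agdX f p x₀ (n + 1) - agdX f p x₀ n‖ ^ 2 := by positivity
  linarith [apply_agdX_succ_le hf hp x₀ n, agd_energy_le hf hp x₀ n]

end Epoch

section Decrease

variable {d : ℕ} {f : Vec d → ℝ} {p : Params} {L ρ χ : ℝ} {x₀ : Vec d} {n : ℕ}

/-- The error of the affine model of the gradient field around `x₀`. -/
noncomputable def gradientRemainder (f : Vec d → ℝ) (x₀ y : Vec d) : Vec d :=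
  gradient f y - gradient f x₀ - hess f x₀ (y - x₀)

lemma norm_gradientRemainder_le (hf : SmoothObjective f L ρ) (hp : p.Tuned L ρ χ) {y : Vec d}
    (hy : ‖y - x₀‖ ≤ 2 * p.B) : ‖gradientRemainder f x₀ y‖ ≤ 2 * ρ * p.B ^ 2 := by
  have hρ := hp.ρ_pos
  calc ‖gradientRemainder f x₀ y‖ ≤ ρ / 2 * ‖y - x₀‖ ^ 2 := hf.norm_gradient_sub_linear_le x₀ y
    _ ≤ ρ / 2 * (2 * p.B) ^ 2 := by gcongr
    _ = 2 * ρ * p.B ^ 2 := by ring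

lemma quadratic_model_agdX_le (hf : SmoothObjective f L ρ) (hp : p.Tuned L ρ χ) (x₀ : Vec d)
    (n : ℕ) :
    ⟪gradient f x₀, agdX f p x₀ n - x₀⟫
        + 1 / 2 * ⟪hess f x₀ (agdX f p x₀ n - x₀), agdX f p x₀ n - x₀⟫
      ≤ -(3 * p.θ / (8 * p.η)) * sumSqSteps (agdX f p x₀) n
        + 2 * p.η / p.θ * ∑ k ∈ Finset.range n, ‖gradientRemainder f x₀ (agdY f p x₀ k)‖ ^ 2 := by
  have hη := hp.η_pos
  have h_step : ‖hess f x₀‖ * p.η ≤ 1 :=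
    calc ‖hess f x₀‖ * p.η ≤ L * p.η := by
          gcongr
          exact hf.norm_hess_le hp.L_pos.le x₀
      _ ≤ 1 := by rw [hp.L_mul_η]; norm_num
  rw [← sumSqSteps_sub_const _ _ x₀]
  refine quadratic_le_of_momentum (hf.isSymmetric_hess x₀) (w := fun k => agdX f p x₀ k - x₀) hη
    hp.θ_pos hp.θ_lt h_step (sub_self x₀) (fun k => ?_) n
  have h_model : gradient f x₀ + hess f x₀ (agdY f p x₀ k - x₀)
      + gradientRemainder f x₀ (agdY f p x₀ k) = gradient f (agdY f p x₀ k) := by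
    simp only [gradientRemainder, sub_sub, add_sub_cancel]
  rw [withMomentum_sub_const, ← agdY_eq_withMomentum, h_model, agdX_succ, sub_right_comm]

lemma sum_norm_sq_gradientRemainder_le (hf : SmoothObjective f L ρ) (hp : p.Tuned L ρ χ)
    (hn : ∀ k < n, ¬ Triggers f p x₀ k) (hnK : n ≤ ⌈p.K⌉₊) :
    ∑ k ∈ Finset.range n, ‖gradientRemainder f x₀ (agdY f p x₀ k)‖ ^ 2
      ≤ 3 / 2 * p.K * (2 * ρ * p.B ^ 2) ^ 2 := by
  have hnK' : (n : ℝ) ≤ 3 / 2 * p.K := le_trans (by exact_mod_cast hnK) hp.ceil_K_le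
  calc ∑ k ∈ Finset.range n, ‖gradientRemainder f x₀ (agdY f p x₀ k)‖ ^ 2
      ≤ ∑ k ∈ Finset.range n, (2 * ρ * p.B ^ 2) ^ 2 := by
        gcongr with k hk
        exact norm_gradientRemainder_le hf hp (norm_agdY_sub_le hp (hn k (Finset.mem_range.1 hk)))
    _ = n * (2 * ρ * p.B ^ 2) ^ 2 := by rw [Finset.sum_const, Finset.card_range, nsmul_eq_mul]
    _ ≤ 3 / 2 * p.K * (2 * ρ * p.B ^ 2) ^ 2 := by gcongr

lemma le_sumSqSteps_of_triggers (hp : p.Tuned L ρ χ) (hT : Triggers f p x₀ n)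
    (hnK : n ≤ ⌈p.K⌉₊) : 2 * p.B ^ 2 / (3 * p.K) ≤ sumSqSteps (agdX f p x₀) n := by
  have hK := hp.K_pos
  have hnK' : (n : ℝ) ≤ 3 / 2 * p.K := le_trans (by exact_mod_cast hnK) hp.ceil_K_le
  rw [div_le_iff₀ (by positivity)]
  linarith [triggers_iff.1 hT,
    mul_le_mul_of_nonneg_right hnK' (sumSqSteps_nonneg (agdX f p x₀) n)]

lemma norm_agdX_succ_sub_le (hp : p.Tuned L ρ χ) (hn : ¬ Triggers f p x₀ n)
    (hg : ‖gradient f (agdY f p x₀ n)‖ ≤ p.B / p.η) : ‖agdX f p x₀ (n + 1) - x₀‖ ≤ 3 * p.B := by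
  have hη := hp.η_pos
  have h_gradient : ‖p.η • gradient f (agdY f p x₀ n)‖ ≤ p.B := by
    rw [norm_smul, Real.norm_of_nonneg hη.le]
    calc p.η * ‖gradient f (agdY f p x₀ n)‖ ≤ p.η * (p.B / p.η) := by gcongr
      _ = p.B := mul_div_cancel₀ _ hη.ne'
  rw [agdX_succ, sub_right_comm]
  exact (norm_sub_le _ _).trans (by linarith [norm_agdY_sub_le hp hn])

lemma decrease_of_small_gradient (hf : SmoothObjective f L ρ) (hp : p.Tuned L ρ χ)
    (hn : ∀ k ≤ n, ¬ Triggers f p x₀ k) (hT : Triggers f p x₀ (n + 1))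
    (hnK : n + 1 ≤ ⌈p.K⌉₊) (hg : ‖gradient f (agdY f p x₀ n)‖ ≤ p.B / p.η) :
    f (agdX f p x₀ (n + 1)) ≤ f x₀ - 3 / 16 * p.decreaseUnit := by
  have hη := hp.η_pos
  have hθ := hp.θ_pos
  have hK := hp.K_pos
  have hρ := hp.ρ_pos
  have h_model := quadratic_model_agdX_le hf hp x₀ (n + 1)
  have h_taylor := (abs_le.1 (hf.abs_sub_quadratic_le x₀ (agdX f p x₀ (n + 1)))).2
  have h_steps : 1 / 4 * p.decreaseUnit
      ≤ 3 * p.θ / (8 * p.η) * sumSqSteps (agdX f p x₀) (n + 1) :=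
    calc 1 / 4 * p.decreaseUnit = 3 * p.θ / (8 * p.η) * (2 * p.B ^ 2 / (3 * p.K)) := by
          unfold Params.decreaseUnit
          field_simp
          ring
      _ ≤ 3 * p.θ / (8 * p.η) * sumSqSteps (agdX f p x₀) (n + 1) := by
          gcongr
          exact le_sumSqSteps_of_triggers hp hT hnK
  have h_errors : 2 * p.η / p.θ * ∑ k ∈ Finset.range (n + 1),
      ‖gradientRemainder f x₀ (agdY f p x₀ k)‖ ^ 2 ≤ 1 / 64 * p.decreaseUnit := by
    refine le_trans ?_ hp.sum_sq_error_le
    gcongr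
    exact sum_norm_sq_gradientRemainder_le hf hp (fun k hk => hn k (Nat.lt_succ_iff.1 hk)) hnK
  have h_cubic : ρ / 6 * ‖agdX f p x₀ (n + 1) - x₀‖ ^ 3 ≤ 1 / 32 * p.decreaseUnit := by
    refine le_trans ?_ hp.cubic_error_le
    gcongr
    exact norm_agdX_succ_sub_le hp (hn n le_rfl) hg
  linarith [hp.decreaseUnit_pos]

lemma apply_add_le_of_norm_le_radius (hf : SmoothObjective f L ρ) (hp : p.Tuned L ρ χ)
    {x ξ : Vec d} (hg : ‖gradient f x‖ ≤ 5 / 4 * (p.B / p.η)) (hξ : ‖ξ‖ ≤ p.radius) :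
    f (x + ξ) ≤ f x + 1 / 8 * p.decreaseUnit := by
  have hη := hp.η_pos
  have hB := hp.B_pos
  have hθ := hp.θ_pos
  have hK := hp.K_pos
  obtain ⟨-, hξ_linear, hξ_sqrt⟩ : ‖ξ‖ ≤ p.B / 2 ∧ ‖ξ‖ ≤ p.θ * p.B / (20 * p.K) ∧
      ‖ξ‖ ≤ √(p.θ * p.B ^ 2 / (2 * p.K)) := by simpa [Params.radius] using hξ
  have hξ_sq : ‖ξ‖ ^ 2 ≤ p.θ * p.B ^ 2 / (2 * p.K) :=
    (Real.le_sqrt (norm_nonneg ξ) (by positivity)).1 hξ_sqrt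
  have h_taylor := (abs_le.1 (hf.abs_sub_linear_le x (x + ξ))).2
  rw [add_sub_cancel_left, hp.L_eq] at h_taylor
  calc f (x + ξ) ≤ f x + (‖gradient f x‖ * ‖ξ‖ + 1 / (4 * p.η) / 2 * ‖ξ‖ ^ 2) := by
        linarith [real_inner_le_norm (gradient f x) ξ]
    _ ≤ f x + (5 / 4 * (p.B / p.η) * (p.θ * p.B / (20 * p.K))
          + 1 / (4 * p.η) / 2 * (p.θ * p.B ^ 2 / (2 * p.K))) := by gcongr
    _ = f x + 1 / 8 * p.decreaseUnit := by
        unfold Params.decreaseUnit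
        field_simp
        ring

lemma norm_gradient_agdX_succ_sub_le (hf : SmoothObjective f L ρ) (hp : p.Tuned L ρ χ)
    (x₀ : Vec d) (n : ℕ) :
    ‖gradient f (agdX f p x₀ (n + 1)) - gradient f (agdY f p x₀ n)‖
      ≤ 1 / 4 * ‖gradient f (agdY f p x₀ n)‖ := by
  have h := hf.lip_grad (agdX f p x₀ (n + 1)) (agdY f p x₀ n)
  rwa [agdX_succ, sub_sub_cancel_left, norm_neg, norm_smul, Real.norm_of_nonneg hp.η_pos.le,
    ← mul_assoc, hp.L_mul_η] at h

lemma restart_decrease (hf : SmoothObjective f L ρ) (hp : p.Tuned L ρ χ) {ξ : Vec d}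
    (hn : ∀ k ≤ n, ¬ Triggers f p x₀ k) (hT : Triggers f p x₀ (n + 1))
    (hnK : n + 1 ≤ ⌈p.K⌉₊) (hξ : ‖ξ‖ ≤ p.radius) :
    f (perturb f p (agdX f p x₀ (n + 1)) (agdY f p x₀ n) ξ) ≤ f x₀ - 1 / 16 * p.decreaseUnit := by
  rw [perturb]
  split_ifs with hg
  · have h_gradient : ‖gradient f (agdX f p x₀ (n + 1))‖ ≤ 5 / 4 * (p.B / p.η) := by
      linarith [norm_gradient_agdX_succ_sub_le hf hp x₀ n,
        norm_sub_norm_le (gradient f (agdX f p x₀ (n + 1))) (gradient f (agdY f p x₀ n))]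
    linarith [decrease_of_small_gradient hf hp hn hT hnK hg,
      apply_add_le_of_norm_le_radius hf hp h_gradient hξ]
  · linarith [decrease_of_large_gradient hf hp (hn n le_rfl) (not_le.1 hg), hp.decreaseUnit_pos,
      hp.decreaseUnit_le]

-- The first step alone is longer than `B / √2`.
lemma epochRestarts_of_large_gradient (hp : p.Tuned L ρ χ)
    (hg : 3 / 4 * (p.B / p.η) < ‖gradient f x₀‖) : EpochRestarts f p x₀ := by
  have hη := hp.η_pos
  have hB := hp.B_pos
  have h_step : 3 / 4 * p.B < ‖agdX f p x₀ 1 - agdX f p x₀ 0‖ := by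
    have h_eq : agdX f p x₀ 1 - agdX f p x₀ 0 = -(p.η • gradient f x₀) := by
      rw [agdX_zero, ← zero_add 1, agdX_succ, agdY_zero, sub_sub_cancel_left]
    rw [h_eq, norm_neg, norm_smul, Real.norm_of_nonneg hη.le]
    calc 3 / 4 * p.B = p.η * (3 / 4 * (p.B / p.η)) := by field_simp
      _ < p.η * ‖gradient f x₀‖ := by gcongr
  have h_sq : (3 / 4 * p.B) ^ 2 < ‖agdX f p x₀ 1 - agdX f p x₀ 0‖ ^ 2 := by gcongr
  refine ⟨2, hp.two_lt_ceil_K.le, triggers_iff.2 ?_⟩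
  rw [sumSqSteps_succ, sumSqSteps_succ, sumSqSteps, Finset.sum_range_zero, zero_add, Nat.cast_two]
  nlinarith [sq_nonneg ‖agdX f p x₀ (1 + 1) - agdX f p x₀ 1‖]

end Decrease

section RunningMean

variable {E F : Type*} [AddCommGroup E] [Module ℝ E] [AddCommGroup F] [Module ℝ F]

/-- The average of `u_0, …, u_n`. The method outputs an average of this kind. -/
noncomputable def runningMean (u : ℕ → E) (n : ℕ) : E :=
  (1 / ((n : ℝ) + 1)) • ∑ k ∈ Finset.range (n + 1), u k

lemma runningMean_const (x : E) (n : ℕ) : runningMean (fun _ => x) n = x := by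
  have hn : (n : ℝ) + 1 ≠ 0 := by positivity
  rw [runningMean, Finset.sum_const, Finset.card_range, ← Nat.cast_smul_eq_nsmul ℝ, smul_smul,
    Nat.cast_succ, one_div_mul_cancel hn, one_smul]

lemma runningMean_sub (u v : ℕ → E) (n : ℕ) :
    runningMean (fun k => u k - v k) n = runningMean u n - runningMean v n := by
  simp only [runningMean, Finset.sum_sub_distrib, smul_sub]

lemma map_runningMean (T : E →ₗ[ℝ] F) (u : ℕ → E) (n : ℕ) :
    T (runningMean u n) = runningMean (fun k => T (u k)) n := by
  simp only [runningMean, map_smul, map_sum]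

lemma norm_runningMean_le {G : Type*} [SeminormedAddCommGroup G] [NormedSpace ℝ G] {u : ℕ → G}
    {n : ℕ} {R : ℝ} (h : ∀ k ≤ n, ‖u k‖ ≤ R) : ‖runningMean u n‖ ≤ R := by
  have hn : (0 : ℝ) < n + 1 := by positivity
  rw [runningMean, norm_smul, Real.norm_of_nonneg (by positivity), one_div, inv_mul_le_iff₀ hn]
  calc ‖∑ k ∈ Finset.range (n + 1), u k‖ ≤ ∑ _ ∈ Finset.range (n + 1), R :=
        norm_sum_le_of_le _ fun k hk => h k (Nat.lt_succ_iff.1 (Finset.mem_range.1 hk))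
    _ = (n + 1) * R := by simp

end RunningMean

section Output

variable {d : ℕ} {f : Vec d → ℝ} {p : Params} {L ρ χ : ℝ} {x₀ yhat : Vec d}

lemma Params.Tuned.two_le_floor_K (hp : p.Tuned L ρ χ) : 2 ≤ ⌊p.K⌋₊ :=
  Nat.le_floor (by exact_mod_cast hp.two_lt_K.le)

lemma Params.Tuned.floor_K_div_two_mul_two_le (hp : p.Tuned L ρ χ) : ⌊p.K / 2⌋₊ * 2 ≤ ⌊p.K⌋₊ := by
  refine Nat.le_floor ?_
  push_cast
  linarith [Nat.floor_le (half_pos hp.K_pos).le]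

lemma mem_Ico_floor_iff (hp : p.Tuned L ρ χ) {k : ℕ} :
    k ∈ Finset.Ico ⌊p.K / 2⌋₊ ⌊p.K⌋₊ ↔ ⌊p.K / 2⌋₊ ≤ k ∧ (k : ℝ) ≤ p.K - 1 := by
  rw [Finset.mem_Ico, ← Nat.succ_le_iff, Nat.le_floor_iff hp.K_pos.le, Nat.cast_succ,
    le_sub_iff_add_le]

lemma exists_isOutput (hp : p.Tuned L ρ χ) (x₀ : Vec d) : ∃ yhat, IsOutput f p x₀ yhat := by
  have h_nonempty : (Finset.Ico ⌊p.K / 2⌋₊ ⌊p.K⌋₊).Nonempty := by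
    rw [Finset.nonempty_Ico]
    have := hp.floor_K_div_two_mul_two_le
    have := hp.two_le_floor_K
    omega
  obtain ⟨K₀, hK₀, hmin⟩ := Finset.exists_min_image _
    (fun k => ‖agdX f p x₀ (k + 1) - agdX f p x₀ k‖) h_nonempty
  exact ⟨_, K₀, (mem_Ico_floor_iff hp).1 hK₀,
    fun k h h' => hmin k ((mem_Ico_floor_iff hp).2 ⟨h, h'⟩), rfl⟩

lemma half_floor_mul_sq_le_sumSqSteps (hp : p.Tuned L ρ χ) {s : ℝ} (hs : 0 ≤ s)
    (hmin : ∀ k : ℕ, ⌊p.K / 2⌋₊ ≤ k → (k : ℝ) ≤ p.K - 1 →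
      s ≤ ‖agdX f p x₀ (k + 1) - agdX f p x₀ k‖) :
    ⌊p.K⌋₊ / 2 * s ^ 2 ≤ sumSqSteps (agdX f p x₀) ⌊p.K⌋₊ := by
  have h_half : (⌊p.K / 2⌋₊ : ℝ) * 2 ≤ ⌊p.K⌋₊ := by exact_mod_cast hp.floor_K_div_two_mul_two_le
  have h_card : (⌊p.K⌋₊ / 2 : ℝ) ≤ (Finset.Ico ⌊p.K / 2⌋₊ ⌊p.K⌋₊).card := by
    rw [Nat.card_Ico, Nat.cast_sub (by have := hp.floor_K_div_two_mul_two_le; omega)]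
    linarith
  calc ⌊p.K⌋₊ / 2 * s ^ 2 ≤ (Finset.Ico ⌊p.K / 2⌋₊ ⌊p.K⌋₊).card * s ^ 2 := by gcongr
    _ = (Finset.Ico ⌊p.K / 2⌋₊ ⌊p.K⌋₊).card • s ^ 2 := (nsmul_eq_mul _ _).symm
    _ ≤ ∑ t ∈ Finset.Ico ⌊p.K / 2⌋₊ ⌊p.K⌋₊, ‖agdX f p x₀ (t + 1) - agdX f p x₀ t‖ ^ 2 :=
        Finset.card_nsmul_le_sum _ _ _ fun k hk => by
          obtain ⟨h, h'⟩ := (mem_Ico_floor_iff hp).1 hk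
          exact pow_le_pow_left₀ hs (hmin k h h') 2
    _ ≤ sumSqSteps (agdX f p x₀) ⌊p.K⌋₊ :=
        Finset.sum_le_sum_of_subset_of_nonneg
          (fun k hk => Finset.mem_range.2 (Finset.mem_Ico.1 hk).2) fun _ _ _ => sq_nonneg _

lemma min_step_le (hp : p.Tuned L ρ χ) {s : ℝ} (hs : 0 ≤ s)
    (hn : ∀ k ≤ ⌈p.K⌉₊, ¬ Triggers f p x₀ k)
    (hmin : ∀ k : ℕ, ⌊p.K / 2⌋₊ ≤ k → (k : ℝ) ≤ p.K - 1 →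
      s ≤ ‖agdX f p x₀ (k + 1) - agdX f p x₀ k‖) :
    s ≤ 3 * p.B / p.K := by
  have hK := hp.K_pos
  have hB := hp.B_pos
  have h_floor : 2 / 3 * p.K ≤ ⌊p.K⌋₊ := by
    have h_two : (2 : ℝ) ≤ ⌊p.K⌋₊ := by exact_mod_cast hp.two_le_floor_K
    linarith [Nat.lt_floor_add_one p.K]
  have h_sq : 2 / 3 * p.K * (2 / 3 * p.K / 2 * s ^ 2) ≤ p.B ^ 2 :=
    calc 2 / 3 * p.K * (2 / 3 * p.K / 2 * s ^ 2) ≤ ⌊p.K⌋₊ * (⌊p.K⌋₊ / 2 * s ^ 2) := by gcongr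
      _ ≤ ⌊p.K⌋₊ * sumSqSteps (agdX f p x₀) ⌊p.K⌋₊ := by
          gcongr
          exact half_floor_mul_sq_le_sumSqSteps hp hs hmin
      _ ≤ p.B ^ 2 := mul_sumSqSteps_le (hn _ (Nat.floor_le_ceil _))
  rw [le_div_iff₀ hK]
  exact le_of_sq_le_sq (by nlinarith) (by positivity)

-- The sum telescopes: each gradient step is a difference of consecutive momentum steps, up to `θ`.
lemma smul_sum_gradient_agdY (x₀ : Vec d) (n : ℕ) :
    p.η • ∑ k ∈ Finset.range (n + 1), gradient f (agdY f p x₀ k)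
      = -((agdX f p x₀ (n + 1) - agdX f p x₀ n) + p.θ • (agdX f p x₀ n - x₀)) := by
  induction n with
  | zero =>
    rw [Finset.sum_range_one, agdX_succ, agdY_zero, agdX_zero]
    simp
  | succ n ih =>
    rw [Finset.sum_range_succ, smul_add, ih, agdX_succ f p x₀ (n + 1), agdY_eq_withMomentum,
      withMomentum, Nat.add_sub_cancel]
    module

lemma gradient_runningMean_sub (f : Vec d → ℝ) (x₀ : Vec d) (u : ℕ → Vec d) (n : ℕ) :
    gradient f (runningMean u n) - runningMean (fun k => gradient f (u k)) n
      = gradientRemainder f x₀ (runningMean u n)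
        - runningMean (fun k => gradientRemainder f x₀ (u k)) n := by
  have h_hess : runningMean (fun k => hess f x₀ (u k)) n = hess f x₀ (runningMean u n) :=
    (map_runningMean (hess f x₀ : Vec d →ₗ[ℝ] Vec d) u n).symm
  simp only [gradientRemainder, map_sub, runningMean_sub, runningMean_const, h_hess]
  abel

lemma le_ceil_of_le_sub_one {K : ℝ} {K₀ k : ℕ} (hK₀ : (K₀ : ℝ) ≤ K - 1) (hk : k ≤ K₀) :
    k ≤ ⌈K⌉₊ := by
  have h : (K₀ : ℝ) ≤ ⌈K⌉₊ := by linarith [Nat.le_ceil K]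
  exact hk.trans (by exact_mod_cast h)

lemma IsOutput.norm_sub_start_le (hp : p.Tuned L ρ χ) (hn : ∀ k ≤ ⌈p.K⌉₊, ¬ Triggers f p x₀ k)
    (hy : IsOutput f p x₀ yhat) : ‖yhat - x₀‖ ≤ 2 * p.B := by
  obtain ⟨K₀, ⟨-, hK₀⟩, -, rfl⟩ := hy
  have h_mean : runningMean (agdY f p x₀) K₀ - x₀
      = runningMean (fun k => agdY f p x₀ k - x₀) K₀ := by
    rw [runningMean_sub, runningMean_const]
  exact (congrArg norm h_mean).trans_le (norm_runningMean_le fun k hk =>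
    norm_agdY_sub_le hp (hn k (le_ceil_of_le_sub_one hK₀ hk)))

lemma norm_runningMean_gradient_le (hp : p.Tuned L ρ χ) {K₀ : ℕ} (hK₀ : ⌊p.K / 2⌋₊ ≤ K₀)
    (hn : ¬ Triggers f p x₀ K₀) (hs : ‖agdX f p x₀ (K₀ + 1) - agdX f p x₀ K₀‖ ≤ 3 * p.B / p.K) :
    ‖runningMean (fun k => gradient f (agdY f p x₀ k)) K₀‖ ≤ 5 / 2 * (p.B * p.θ ^ 2 / p.η) := by
  have hη := hp.η_pos
  have hB := hp.B_pos
  have hθ := hp.θ_pos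
  have hK := hp.K_pos
  have h_sum : p.η * ‖∑ k ∈ Finset.range (K₀ + 1), gradient f (agdY f p x₀ k)‖
      ≤ 3 * p.B / p.K + p.θ * p.B := by
    rw [← Real.norm_of_nonneg hη.le, ← norm_smul, smul_sum_gradient_agdY, norm_neg]
    refine (norm_add_le _ _).trans (add_le_add hs ?_)
    rw [norm_smul, Real.norm_of_nonneg hθ.le]
    gcongr
    exact norm_agdX_sub_le hB.le hn
  have h_count : 1 / ((K₀ : ℝ) + 1) ≤ 2 * (1 / p.K) := by
    have h_floor : (⌊p.K / 2⌋₊ : ℝ) ≤ K₀ := by exact_mod_cast hK₀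
    rw [mul_one_div, div_le_div_iff₀ (by positivity) hK]
    linarith [Nat.lt_floor_add_one (p.K / 2)]
  have h_inv : 1 / p.K ≤ p.θ / 2 := by
    rw [hp.K_eq, one_div_div]
    gcongr
    linarith [hp.one_le]
  rw [runningMean, norm_smul, Real.norm_of_nonneg (by positivity)]
  calc 1 / ((K₀ : ℝ) + 1) * ‖∑ k ∈ Finset.range (K₀ + 1), gradient f (agdY f p x₀ k)‖
      ≤ 2 * (1 / p.K) * ((3 * p.B / p.K + p.θ * p.B) / p.η) := by
        gcongr
        exact (le_div_iff₀' hη).2 h_sum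
    _ = 2 * (1 / p.K) * ((3 * (1 / p.K) + p.θ) * p.B / p.η) := by ring
    _ ≤ 2 * (p.θ / 2) * ((3 * (p.θ / 2) + p.θ) * p.B / p.η) := by gcongr
    _ = 5 / 2 * (p.B * p.θ ^ 2 / p.η) := by ring

lemma Params.Tuned.ρ_B_le (hp : p.Tuned L ρ χ) : ρ * p.B ≤ p.θ ^ 2 / p.η / 288 := by
  have hη := hp.η_pos
  have hχ := hp.χ_pos
  calc ρ * p.B = p.θ ^ 2 / p.η / 288 / χ ^ 2 := by
        rw [← hp.B_eq]
        field_simp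
    _ ≤ p.θ ^ 2 / p.η / 288 := div_le_self (by positivity) (one_le_pow₀ hp.one_le)

lemma IsOutput.norm_gradient_le (hf : SmoothObjective f L ρ) (hp : p.Tuned L ρ χ)
    (hn : ∀ k ≤ ⌈p.K⌉₊, ¬ Triggers f p x₀ k) (hy : IsOutput f p x₀ yhat) :
    ‖gradient f yhat‖ ≤ 288 * χ ^ 2 * p.B * p.θ ^ 2 / p.η := by
  have hη := hp.η_pos
  have hB := hp.B_pos
  have h_remainder := norm_gradientRemainder_le hf hp (hy.norm_sub_start_le hp hn)
  obtain ⟨K₀, ⟨hK₀, hK₀'⟩, hmin, rfl⟩ := hy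
  have hn' (k) (hk : k ≤ K₀) : ¬ Triggers f p x₀ k := hn k (le_ceil_of_le_sub_one hK₀' hk)
  change ‖gradient f (runningMean (agdY f p x₀) K₀)‖ ≤ _
  change ‖gradientRemainder f x₀ (runningMean (agdY f p x₀) K₀)‖ ≤ _ at h_remainder
  have h_gradients := norm_runningMean_gradient_le hp hK₀ (hn' K₀ le_rfl)
    (min_step_le hp (norm_nonneg _) hn hmin)
  have h_remainders : ‖runningMean (fun k => gradientRemainder f x₀ (agdY f p x₀ k)) K₀‖
      ≤ 2 * ρ * p.B ^ 2 :=
    norm_runningMean_le fun k hk =>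
      norm_gradientRemainder_le hf hp (norm_agdY_sub_le hp (hn' k hk))
  set V := p.B * p.θ ^ 2 / p.η
  have h_V : 0 ≤ V := by positivity
  have h_sq : ρ * p.B ^ 2 ≤ V / 288 := by
    calc ρ * p.B ^ 2 = p.B * (ρ * p.B) := by ring
      _ ≤ p.B * (p.θ ^ 2 / p.η / 288) := by gcongr; exact hp.ρ_B_le
      _ = V / 288 := by ring
  calc ‖gradient f (runningMean (agdY f p x₀) K₀)‖
      = ‖runningMean (fun k => gradient f (agdY f p x₀ k)) K₀
          + (gradientRemainder f x₀ (runningMean (agdY f p x₀) K₀)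
            - runningMean (fun k => gradientRemainder f x₀ (agdY f p x₀ k)) K₀)‖ := by
        rw [← gradient_runningMean_sub, add_sub_cancel]
    _ ≤ 5 / 2 * V + (2 * ρ * p.B ^ 2 + 2 * ρ * p.B ^ 2) :=
        (norm_add_le _ _).trans (add_le_add h_gradients
          ((norm_sub_le _ _).trans (add_le_add h_remainder h_remainders)))
    _ ≤ 288 * 1 * V := by linarith
    _ ≤ 288 * χ ^ 2 * V := by
        gcongr
        exact one_le_pow₀ hp.one_le
    _ = 288 * χ ^ 2 * p.B * p.θ ^ 2 / p.η := by ring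

end Output

section Epochs

variable {d : ℕ} (f : Vec d → ℝ) (p : Params)

open Classical in
/-- The counter at which the epoch that starts at `z` ends, by a restart or by reaching `K`. -/
noncomputable def stopTime (z : Vec d) : ℕ :=
  Nat.find (p := fun k => Triggers f p z k ∨ k = ⌈p.K⌉₊) ⟨⌈p.K⌉₊, Or.inr rfl⟩

/-- The last iterate of the epoch that starts at `z`. -/
noncomputable def epochEnd (z : Vec d) : Vec d := agdX f p z (stopTime f p z)

/-- The point at which the last gradient of the epoch that starts at `z` is evaluated. -/
noncomputable def epochLastY (z : Vec d) : Vec d := agdY f p z (stopTime f p z - 1)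

/-- The starting points of the successive epochs. The sequence is also continued past an epoch that
does not end in a restart, where it no longer describes the method. -/
noncomputable def epochStart (x₀ : Vec d) (ξ : ℕ → Vec d) : ℕ → Vec d
  | 0 => x₀
  | n + 1 => perturb f p (epochEnd f p (epochStart x₀ ξ n)) (epochLastY f p (epochStart x₀ ξ n))
      (ξ n)

variable {f p}

section StopTime

variable {z : Vec d}

lemma not_epochRestarts_iff :
    ¬ EpochRestarts f p z ↔ ∀ k ≤ ⌈p.K⌉₊, ¬ Triggers f p z k := by
  simp only [EpochRestarts, not_exists, not_and]

lemma not_triggers_zero (z : Vec d) : ¬ Triggers f p z 0 := by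
  simp only [Triggers, Nat.cast_zero, zero_mul, not_lt]
  positivity

lemma not_triggers_of_lt_stopTime {k : ℕ} (hk : k < stopTime f p z) : ¬ Triggers f p z k := by
  classical
  exact fun h => Nat.find_min (p := fun k => Triggers f p z k ∨ k = ⌈p.K⌉₊) _ hk (Or.inl h)

lemma stopTime_le (z : Vec d) : stopTime f p z ≤ ⌈p.K⌉₊ := by
  classical
  exact Nat.find_min' (p := fun k => Triggers f p z k ∨ k = ⌈p.K⌉₊) _ (Or.inr rfl)

lemma natCast_lt_K_of_lt_stopTime {k : ℕ} (hk : k < stopTime f p z) : (k : ℝ) < p.K :=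
  Nat.lt_ceil.1 (hk.trans_le (stopTime_le z))

lemma triggers_stopTime (h : EpochRestarts f p z) : Triggers f p z (stopTime f p z) := by
  classical
  obtain ⟨k, hk, hT⟩ := h
  rcases Nat.find_spec (p := fun k => Triggers f p z k ∨ k = ⌈p.K⌉₊) ⟨⌈p.K⌉₊, Or.inr rfl⟩
    with h_triggers | h_stop
  · exact h_triggers
  · have h_le : stopTime f p z ≤ k :=
      Nat.find_min' (p := fun k => Triggers f p z k ∨ k = ⌈p.K⌉₊) _ (Or.inl hT)
    have h_stop : stopTime f p z = ⌈p.K⌉₊ := h_stop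
    rwa [show stopTime f p z = k by omega]

lemma exists_stopTime_eq_succ (h : EpochRestarts f p z) : ∃ m, stopTime f p z = m + 1 :=
  Nat.exists_eq_succ_of_ne_zero fun h_zero => not_triggers_zero z (h_zero ▸ triggers_stopTime h)

end StopTime

section Run

variable {x₀ : Vec d} {ξ : ℕ → Vec d} {N : ℕ}

lemma run_add (x₀ : Vec d) (ξ : ℕ → Vec d) (T j : ℕ) :
    run f p x₀ ξ (T + j) = (step f p ξ)^[j] (run f p x₀ ξ T) := by
  rw [run, run, add_comm, Function.iterate_add_apply]

lemma iterate_step_of_not_triggers (ξ : ℕ → Vec d) (z : Vec d) (n : ℕ) {k : ℕ} (hk : k ≤ ⌈p.K⌉₊)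
    (hn : ∀ j ≤ k, ¬ Triggers f p z j) : (step f p ξ)^[k] ⟨z, 0, n⟩ = ⟨z, k, n⟩ := by
  induction k with
  | zero => rfl
  | succ k ih =>
    rw [Function.iterate_succ_apply', ih (by omega) fun j hj => hn j (by omega), step,
      if_pos (Nat.lt_ceil.1 hk), if_neg (hn (k + 1) le_rfl)]

lemma iterate_step_of_lt_stopTime (ξ : ℕ → Vec d) {z : Vec d} (n : ℕ) {k : ℕ}
    (hk : k < stopTime f p z) : (step f p ξ)^[k] ⟨z, 0, n⟩ = ⟨z, k, n⟩ :=
  iterate_step_of_not_triggers ξ z n (hk.le.trans (stopTime_le z))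
    fun _ hj => not_triggers_of_lt_stopTime (hj.trans_lt hk)

lemma iterate_step_stopTime (ξ : ℕ → Vec d) {z : Vec d} (n : ℕ) (h : EpochRestarts f p z) :
    (step f p ξ)^[stopTime f p z] ⟨z, 0, n⟩
      = ⟨perturb f p (epochEnd f p z) (epochLastY f p z) (ξ n), 0, n + 1⟩ := by
  obtain ⟨m, hm⟩ := exists_stopTime_eq_succ h
  have hm_lt : m < stopTime f p z := hm ▸ m.lt_succ_self
  have h_triggers : Triggers f p z (m + 1) := hm ▸ triggers_stopTime h
  rw [epochEnd, epochLastY, hm, Function.iterate_succ_apply', iterate_step_of_lt_stopTime ξ n hm_lt,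
    step, if_pos (natCast_lt_K_of_lt_stopTime hm_lt), if_pos h_triggers, Nat.add_sub_cancel]

lemma exists_run_eq_epochStart (h : ∀ n < N, EpochRestarts f p (epochStart f p x₀ ξ n)) :
    ∃ T ≤ N * ⌈p.K⌉₊, run f p x₀ ξ T = ⟨epochStart f p x₀ ξ N, 0, N⟩ ∧
      ∀ t < T, ((run f p x₀ ξ t).k : ℝ) < p.K := by
  induction N with
  | zero => exact ⟨0, Nat.zero_le _, rfl, fun t ht => absurd ht t.not_lt_zero⟩
  | succ N ih =>
    obtain ⟨T, hT, h_run, h_lt⟩ := ih fun n hn => h n (by omega)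
    refine ⟨T + stopTime f p (epochStart f p x₀ ξ N), ?_, ?_, fun t ht => ?_⟩
    · rw [Nat.succ_mul]
      exact Nat.add_le_add hT (stopTime_le _)
    · rw [run_add, h_run, iterate_step_stopTime ξ N (h N N.lt_succ_self), epochStart]
    · rcases lt_or_ge t T with h_before | h_after
      · exact h_lt t h_before
      · obtain ⟨j, rfl⟩ := Nat.exists_eq_add_of_le h_after
        have hj : j < stopTime f p (epochStart f p x₀ ξ N) := Nat.lt_of_add_lt_add_left ht
        rw [run_add, h_run, iterate_step_of_lt_stopTime ξ N hj]
        exact natCast_lt_K_of_lt_stopTime hj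

lemma exists_haltsAt (h : ∀ n < N, EpochRestarts f p (epochStart f p x₀ ξ n))
    (hN : ¬ EpochRestarts f p (epochStart f p x₀ ξ N)) :
    ∃ T ≤ (N + 1) * ⌈p.K⌉₊, HaltsAt f p x₀ ξ T ∧
      (run f p x₀ ξ T).start = epochStart f p x₀ ξ N := by
  obtain ⟨T, hT, h_run, h_lt⟩ := exists_run_eq_epochStart h
  have h_last : ∀ j ≤ ⌈p.K⌉₊, run f p x₀ ξ (T + j) = ⟨epochStart f p x₀ ξ N, j, N⟩ := by
    intro j hj
    rw [run_add, h_run]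
    exact iterate_step_of_not_triggers ξ _ N hj
      fun i hi => not_epochRestarts_iff.1 hN i (hi.trans hj)
  refine ⟨T + ⌈p.K⌉₊, ?_, ⟨?_, fun t ht => ?_⟩, ?_⟩
  · rw [Nat.succ_mul]
    exact Nat.add_le_add_right hT _
  · rw [h_last _ le_rfl]
    exact Nat.le_ceil _
  · rcases lt_or_ge t T with h_before | h_after
    · exact h_lt t h_before
    · obtain ⟨j, rfl⟩ := Nat.exists_eq_add_of_le h_after
      have hj : j < ⌈p.K⌉₊ := Nat.lt_of_add_lt_add_left ht
      rw [h_last j hj.le]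
      exact Nat.lt_ceil.1 hj
  · rw [h_last _ le_rfl]

end Run

section Progress

variable {L ρ χ : ℝ} {x₀ : Vec d} {ξ : ℕ → Vec d} {N : ℕ}

lemma apply_epochStart_succ_le (hf : SmoothObjective f L ρ) (hp : p.Tuned L ρ χ) {n : ℕ}
    (hξ : ‖ξ n‖ ≤ p.radius) (h : EpochRestarts f p (epochStart f p x₀ ξ n)) :
    f (epochStart f p x₀ ξ (n + 1)) ≤ f (epochStart f p x₀ ξ n) - 1 / 16 * p.decreaseUnit := by
  obtain ⟨m, hm⟩ := exists_stopTime_eq_succ h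
  rw [epochStart, epochEnd, epochLastY, hm]
  exact restart_decrease hf hp (fun k hk => not_triggers_of_lt_stopTime (by omega))
    (hm ▸ triggers_stopTime h) (hm ▸ stopTime_le _) hξ

lemma natCast_mul_decreaseUnit_le (hf : SmoothObjective f L ρ) (hp : p.Tuned L ρ χ)
    (hξ : ∀ n, ‖ξ n‖ ≤ p.radius) (h : ∀ n < N, EpochRestarts f p (epochStart f p x₀ ξ n)) :
    N * p.decreaseUnit ≤ 16 * gap f x₀ := by
  have h_decrease : f (epochStart f p x₀ ξ N) ≤ f x₀ - N * (1 / 16 * p.decreaseUnit) := by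
    induction N with
    | zero => simp only [epochStart, Nat.cast_zero, zero_mul, sub_zero, le_refl]
    | succ N ih =>
      push_cast
      linarith [ih fun n hn => h n (by omega),
        apply_epochStart_succ_le hf hp (hξ N) (h N N.lt_succ_self)]
  rw [gap]
  linarith [ciInf_le hf.bdd (epochStart f p x₀ ξ N)]

lemma exists_last_epoch (hf : SmoothObjective f L ρ) (hp : p.Tuned L ρ χ) (x₀ : Vec d)
    (hξ : ∀ n, ‖ξ n‖ ≤ p.radius) :
    ∃ N : ℕ, N * p.decreaseUnit ≤ 16 * gap f x₀ ∧
      (∀ n < N, EpochRestarts f p (epochStart f p x₀ ξ n)) ∧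
      ¬ EpochRestarts f p (epochStart f p x₀ ξ N) := by
  classical
  have h_exists : ∃ N, ¬ EpochRestarts f p (epochStart f p x₀ ξ N) := by
    by_contra! h_all
    obtain ⟨N, hN⟩ := exists_nat_gt (16 * gap f x₀ / p.decreaseUnit)
    rw [div_lt_iff₀ hp.decreaseUnit_pos] at hN
    exact hN.not_ge (natCast_mul_decreaseUnit_le hf hp hξ fun n _ => h_all n)
  have h_before : ∀ n < Nat.find h_exists, EpochRestarts f p (epochStart f p x₀ ξ n) :=
    fun n hn => not_not.1 (Nat.find_min h_exists hn)
  exact ⟨Nat.find h_exists, natCast_mul_decreaseUnit_le hf hp hξ h_before, h_before,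
    Nat.find_spec h_exists⟩

lemma achieves_of_last_epoch (hp : p.Tuned L ρ χ) {b : ℝ} {Q : Vec d → Prop}
    (h : ∀ n < N, EpochRestarts f p (epochStart f p x₀ ξ n))
    (hN : ¬ EpochRestarts f p (epochStart f p x₀ ξ N))
    (hb : ((N : ℝ) + 1) * (3 / 2 * p.K) ≤ b)
    (hQ : ∀ yhat, IsOutput f p (epochStart f p x₀ ξ N) yhat → Q yhat) :
    Achieves f p x₀ ξ b Q := by
  obtain ⟨T, hT, h_halts, h_start⟩ := exists_haltsAt h hN
  obtain ⟨y, hy⟩ := exists_isOutput (f := f) hp (epochStart f p x₀ ξ N)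
  refine ⟨T, ?_, ⟨y, h_halts, h_start ▸ hy⟩, fun y hy => hQ y (h_start ▸ hy.2)⟩
  calc (T : ℝ) ≤ ((N + 1) * ⌈p.K⌉₊ : ℕ) := by exact_mod_cast hT
    _ = ((N : ℝ) + 1) * ⌈p.K⌉₊ := by push_cast; ring
    _ ≤ ((N : ℝ) + 1) * (3 / 2 * p.K) := by
      gcongr
      exact hp.ceil_K_le
    _ ≤ b := hb

end Progress

end Epochs

section MomentumRecurrence

lemma exists_nonneg_roots {s q : ℝ} (hs : 0 ≤ s) (hq : 0 ≤ q) (h_disc : 0 ≤ s ^ 2 - 4 * q) :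
    ∃ μ ν, μ + ν = s ∧ μ * ν = q ∧ 0 ≤ ν ∧ ν ≤ μ := by
  have h_sq := Real.sq_sqrt h_disc
  have h_sqrt_le : √(s ^ 2 - 4 * q) ≤ s := by
    rw [Real.sqrt_le_left hs]
    linarith
  refine ⟨(s + √(s ^ 2 - 4 * q)) / 2, (s - √(s ^ 2 - 4 * q)) / 2, by ring, ?_, by linarith,
    by linarith [Real.sqrt_nonneg (s ^ 2 - 4 * q)]⟩
  linear_combination (-1 / 4) * h_sq

lemma exists_conj_roots {s q : ℝ} (h_disc : s ^ 2 - 4 * q ≤ 0) :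
    ∃ z : ℂ, z + starRingEnd ℂ z = s ∧ z * starRingEnd ℂ z = q ∧ ‖z‖ ^ 2 = q := by
  have h_normSq : Complex.normSq ⟨s / 2, √(4 * q - s ^ 2) / 2⟩ = q := by
    rw [Complex.normSq_mk]
    linear_combination (1 / 4) * Real.sq_sqrt (show 0 ≤ 4 * q - s ^ 2 by linarith)
  refine ⟨⟨s / 2, √(4 * q - s ^ 2) / 2⟩, ?_, ?_, ?_⟩
  · rw [Complex.add_conj]
    congr 1
    ring
  · rw [Complex.mul_conj, h_normSq]
  · rw [Complex.sq_norm, h_normSq]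

/-- `μ` and `ν` are the characteristic roots of the momentum recurrence
`u_{k+1} = a (u_k + (1 - θ) (u_k - u_{k-1}))` with an expanding factor `a`. -/
structure MomentumRoots (θ a μ ν : ℝ) : Prop where
  add_eq : μ + ν = a * (2 - θ)
  mul_eq : μ * ν = a * (1 - θ)
  ν_nonneg : 0 ≤ ν
  ν_le : ν ≤ μ
  le_μ : 1 + θ / 2 ≤ μ
  factor_le : a ≤ μ

-- The characteristic polynomial is negative at `1 + θ / 2` and at `a`, so both lie below `μ`.
lemma exists_momentumRoots {θ a : ℝ} (hθ : 0 < θ) (hθ1 : θ < 1) (ha : 1 + θ ^ 2 ≤ a) :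
    ∃ μ ν, MomentumRoots θ a μ ν := by
  have ha1 : 1 < a := by nlinarith
  have h_disc : 0 ≤ (a * (2 - θ)) ^ 2 - 4 * (a * (1 - θ)) := by
    have h_eq : (a * (2 - θ)) ^ 2 - 4 * (a * (1 - θ))
        = a * (θ ^ 2 + (a - 1) * (2 - θ) ^ 2) := by ring
    rw [h_eq]
    have := sub_nonneg.2 ha1.le
    positivity
  obtain ⟨μ, ν, h_add, h_mul, h_nonneg, h_le⟩ := exists_nonneg_roots
    (mul_nonneg (by linarith) (by linarith)) (mul_nonneg (by linarith) (by linarith)) h_disc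
  have h_between (z : ℝ) (hz : z ^ 2 - a * (2 - θ) * z + a * (1 - θ) < 0) : z ≤ μ := by
    by_contra! hlt
    have h_pos : 0 < (z - μ) * (z - ν) := mul_pos (by linarith) (by linarith)
    have h_factor : (z - μ) * (z - ν) = z ^ 2 - a * (2 - θ) * z + a * (1 - θ) := by
      linear_combination -z * h_add + h_mul
    linarith
  refine ⟨μ, ν, h_add, h_mul, h_nonneg, h_le, h_between _ ?_, h_between _ ?_⟩
  · have h_eq : (1 + θ / 2) ^ 2 - a * (2 - θ) * (1 + θ / 2) + a * (1 - θ)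
        = 3 / 4 * θ ^ 2 - (a - 1) * (1 + θ - θ ^ 2 / 2) := by ring
    have h_factor : 1 ≤ 1 + θ - θ ^ 2 / 2 := by nlinarith
    rw [h_eq]
    nlinarith
  · have h_eq : a ^ 2 - a * (2 - θ) * a + a * (1 - θ) = -(a * (1 - θ) * (a - 1)) := by ring
    rw [h_eq, neg_lt_zero]
    exact mul_pos (mul_pos (by linarith) (by linarith)) (by linarith)

/-- The solution of the momentum recurrence with factor `a` that starts at rest at `1`. -/
noncomputable def momentumSol (θ a : ℝ) : ℕ → ℝ
  | 0 => 1
  | 1 => a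
  | k + 2 => a * ((2 - θ) * momentumSol θ a (k + 1) - (1 - θ) * momentumSol θ a k)

lemma momentumSol_succ (θ a : ℝ) (k : ℕ) :
    momentumSol θ a (k + 1) = a * withMomentum θ (momentumSol θ a) k := by
  cases k with
  | zero => simp only [momentumSol, withMomentum, Nat.zero_sub, sub_self, smul_zero, add_zero,
      mul_one]
  | succ k =>
    simp only [momentumSol, withMomentum, Nat.add_sub_cancel, smul_eq_mul]
    ring

/-- The impulse response of the momentum recurrence with factor `a`, which may be a number or an
operator. -/
noncomputable def impulse {R : Type*} [Ring R] [Algebra ℝ R] (θ : ℝ) (a : R) : ℕ → R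
  | 0 => 1
  | 1 => a * (2 - θ) • 1
  | m + 2 => a * ((2 - θ) • impulse θ a (m + 1) - (1 - θ) • impulse θ a m)

section Scalar

variable {θ a b μ ν : ℝ}

lemma MomentumRoots.one_le (h : MomentumRoots θ a μ ν) (hθ : 0 ≤ θ) : 1 ≤ μ := by
  linarith [h.le_μ]

lemma MomentumRoots.momentumSol_succ (h : MomentumRoots θ a μ ν) (k : ℕ) :
    momentumSol θ a (k + 1) = ν * momentumSol θ a k + μ ^ k * (a - ν) := by
  induction k with
  | zero =>
    simp only [momentumSol]
    ring
  | succ k ih =>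
    have h_rec : momentumSol θ a (k + 2)
        = (μ + ν) * momentumSol θ a (k + 1) - μ * ν * momentumSol θ a k := by
      rw [h.add_eq, h.mul_eq, momentumSol]
      ring
    rw [h_rec]
    linear_combination μ * ih

lemma MomentumRoots.momentumSol_mem_Icc (h : MomentumRoots θ a μ ν) (hθ : 0 ≤ θ) (ha : 1 ≤ a)
    (k : ℕ) : momentumSol θ a k ∈ Set.Icc (1 / 2 * μ ^ k) (μ ^ k) := by
  have h_one := h.one_le hθ
  induction k with
  | zero => simp only [momentumSol, pow_zero, Set.mem_Icc]; norm_num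
  | succ k ih =>
    have h_pow : 0 ≤ μ ^ k := by positivity
    have h_lower := mul_le_mul_of_nonneg_left ih.1 h.ν_nonneg
    have h_upper := mul_le_mul_of_nonneg_left ih.2 h.ν_nonneg
    rw [h.momentumSol_succ, pow_succ]
    constructor
    · have h_mean : (μ + ν) / 2 ≤ a := by
        rw [h.add_eq]
        nlinarith
      linarith [mul_le_mul_of_nonneg_left h_mean h_pow]
    · linarith [mul_le_mul_of_nonneg_left h.factor_le h_pow]

lemma MomentumRoots.le_of_real_root (h : MomentumRoots θ b μ ν) (hθ : 0 ≤ θ) (hθ1 : θ ≤ 1)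
    (hab : a ≤ b) {z : ℝ} (hz : z ^ 2 = a * ((2 - θ) * z - (1 - θ))) : z ≤ μ := by
  by_contra! h_lt
  have h_one := h.one_le hθ
  have h_nonneg : 0 ≤ (2 - θ) * z - (1 - θ) := by nlinarith
  have h_le : z ^ 2 ≤ b * ((2 - θ) * z - (1 - θ)) := hz.trans_le (by gcongr)
  have h_pos : 0 < (z - μ) * (z - ν) := mul_pos (by linarith) (by linarith [h.ν_le])
  have h_factor : (z - μ) * (z - ν) = z ^ 2 - b * ((2 - θ) * z - (1 - θ)) := by
    linear_combination (-z) * h.add_eq + h.mul_eq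
  linarith

lemma MomentumRoots.exists_complex_roots (h : MomentumRoots θ b μ ν) (hθ : 0 ≤ θ) (hθ1 : θ ≤ 1)
    (ha : 0 ≤ a) (hab : a ≤ b) :
    ∃ z w : ℂ, z + w = (a * (2 - θ) : ℝ) ∧ z * w = (a * (1 - θ) : ℝ) ∧ ‖z‖ ≤ μ ∧ ‖w‖ ≤ μ := by
  have h_one := h.one_le hθ
  rcases le_total 0 ((a * (2 - θ)) ^ 2 - 4 * (a * (1 - θ))) with h_disc | h_disc
  · obtain ⟨z, w, h_add, h_mul, hw, hwz⟩ := exists_nonneg_roots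
      (mul_nonneg ha (by linarith)) (mul_nonneg ha (by linarith)) h_disc
    have hz : z ≤ μ := h.le_of_real_root hθ hθ1 hab (by linear_combination z * h_add - h_mul)
    refine ⟨z, w, by rw [← h_add, Complex.ofReal_add], by rw [← h_mul, Complex.ofReal_mul], ?_, ?_⟩
    · rwa [Complex.norm_real, Real.norm_of_nonneg (hw.trans hwz)]
    · rw [Complex.norm_real, Real.norm_of_nonneg hw]
      exact hwz.trans hz
  · obtain ⟨z, h_add, h_mul, h_norm⟩ := exists_conj_roots h_disc
    have hz : ‖z‖ ≤ μ := by
      refine le_of_sq_le_sq ?_ (by linarith)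
      calc ‖z‖ ^ 2 = a * (1 - θ) := h_norm
        _ ≤ b * (1 - θ) := mul_le_mul_of_nonneg_right hab (by linarith)
        _ = μ * ν := h.mul_eq.symm
        _ ≤ μ ^ 2 := by nlinarith [h.ν_le]
    exact ⟨z, starRingEnd ℂ z, h_add, h_mul, hz, (Complex.norm_conj z).trans_le hz⟩

lemma MomentumRoots.abs_impulse_le (h : MomentumRoots θ b μ ν) (hθ : 0 ≤ θ) (hθ1 : θ ≤ 1)
    (ha : 0 ≤ a) (hab : a ≤ b) (m : ℕ) : |impulse θ a m| ≤ (m + 1) * μ ^ m := by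
  obtain ⟨z, w, h_add, h_mul, hz, hw⟩ := h.exists_complex_roots hθ hθ1 ha hab
  have h_one := h.one_le hθ
  have h_rec (m : ℕ) : ((impulse θ a (m + 1) : ℝ) : ℂ) = z * (impulse θ a m : ℝ) + w ^ (m + 1) := by
    induction m with
    | zero =>
      simp only [impulse, smul_eq_mul, mul_one]
      rw [← h_add, Complex.ofReal_one]
      ring
    | succ m ih =>
      have h_step : ((impulse θ a (m + 2) : ℝ) : ℂ)
          = (z + w) * (impulse θ a (m + 1) : ℝ) - z * w * (impulse θ a m : ℝ) := by
        rw [h_add, h_mul, impulse, smul_eq_mul, smul_eq_mul]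
        push_cast
        ring
      rw [h_step]
      linear_combination w * ih
  rw [← Real.norm_eq_abs, ← Complex.norm_real]
  induction m with
  | zero => simp [impulse]
  | succ m ih =>
    calc ‖((impulse θ a (m + 1) : ℝ) : ℂ)‖ ≤ ‖z‖ * ‖((impulse θ a m : ℝ) : ℂ)‖ + ‖w‖ ^ (m + 1) := by
          rw [h_rec, ← norm_mul, ← norm_pow]
          exact norm_add_le _ _
      _ ≤ μ * ((m + 1) * μ ^ m) + μ ^ (m + 1) := by gcongr
      _ = ((m + 1 : ℕ) + 1) * μ ^ (m + 1) := by
        push_cast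
        ring

end Scalar

section Operator

variable {ι E : Type*} [Fintype ι] [NormedAddCommGroup E] [InnerProductSpace ℝ E]
  {θ b μ ν : ℝ} {A : E →L[ℝ] E}

lemma inner_impulse_apply {e : E} {a : ℝ} (he : ∀ v, ⟪e, A v⟫ = a * ⟪e, v⟫) (m : ℕ) (v : E) :
    ⟪e, impulse θ A m v⟫ = impulse θ a m * ⟪e, v⟫ := by
  induction m using Nat.twoStepInduction with
  | zero => simp [impulse]
  | one =>
    simp only [impulse, mul_smul_comm, mul_one, smul_apply, he, real_inner_smul_right, smul_eq_mul]
    ring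
  | more m ih₀ ih₁ =>
    simp only [impulse, mul_apply_eq_comp, sub_apply,
      smul_apply, he, inner_sub_right, real_inner_smul_right, ih₀, ih₁,
      smul_eq_mul]
    ring

lemma MomentumRoots.norm_impulse_le (h : MomentumRoots θ b μ ν) (hθ : 0 ≤ θ) (hθ1 : θ ≤ 1)
    (e : OrthonormalBasis ι ℝ E) {a : ι → ℝ} (he : ∀ i v, ⟪e i, A v⟫ = a i * ⟪e i, v⟫)
    (ha : ∀ i, 0 ≤ a i) (hab : ∀ i, a i ≤ b) (m : ℕ) : ‖impulse θ A m‖ ≤ (m + 1) * μ ^ m := by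
  have h_one := h.one_le hθ
  refine ContinuousLinearMap.opNorm_le_bound _ (by positivity) fun v => ?_
  refine le_of_sq_le_sq ?_ (by positivity)
  rw [← e.sum_sq_inner_right, mul_pow, ← e.sum_sq_inner_right v, Finset.mul_sum]
  refine Finset.sum_le_sum fun i _ => ?_
  rw [inner_impulse_apply (he i), mul_pow, ← sq_abs (impulse θ (a i) m)]
  have := h.abs_impulse_le hθ hθ1 (ha i) (hab i) m
  gcongr

end Operator

section Growth

variable {E : Type*} [NormedAddCommGroup E] [NormedSpace ℝ E] {θ : ℝ} {A : E →L[ℝ] E}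

lemma eq_sum_impulse {u ψ : ℕ → E} (h_zero : u 0 = 0)
    (h_rec : ∀ k, u (k + 1) = A (withMomentum θ u k) + ψ k) (k : ℕ) :
    u k = ∑ j ∈ Finset.range k, impulse θ A (k - 1 - j) (ψ j) := by
  induction k using Nat.twoStepInduction with
  | zero => simpa using h_zero
  | one => simp [h_rec, withMomentum, h_zero, impulse]
  | more k ih₀ ih₁ =>
    have h_terms : ∀ j ∈ Finset.range k, impulse θ A (k + 2 - 1 - j) (ψ j)
        = A ((2 - θ) • impulse θ A (k + 1 - 1 - j) (ψ j)
          - (1 - θ) • impulse θ A (k - 1 - j) (ψ j)) := by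
      intro j hj
      have hjk := Finset.mem_range.1 hj
      rw [show k + 2 - 1 - j = (k - 1 - j) + 2 by omega,
        show k + 1 - 1 - j = (k - 1 - j) + 1 by omega]
      rfl
    have h_momentum : withMomentum θ u (k + 1) = (2 - θ) • u (k + 1) - (1 - θ) • u k := by
      rw [withMomentum, Nat.add_sub_cancel]
      module
    rw [h_rec (k + 1), h_momentum, Finset.sum_range_succ, Finset.sum_range_succ,
      Finset.sum_congr rfl h_terms, ← map_sum, Finset.sum_sub_distrib, ← Finset.smul_sum,
      ← Finset.smul_sum, ← ih₀, ih₁, Finset.sum_range_succ, Nat.add_sub_cancel, Nat.sub_self,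
      show k + 2 - 1 - k = 1 by omega, show k + 2 - 1 - (k + 1) = 0 by omega]
    simp only [impulse, one_apply_eq_self, mul_apply_eq_comp,
      smul_apply, map_sub, map_smul, map_add, smul_add]
    abel

variable {μ : ℝ}

lemma norm_sum_impulse_le (hμ : 1 ≤ μ) (hA : ∀ m, ‖impulse θ A m‖ ≤ (m + 1) * μ ^ m) {k : ℕ}
    {ψ : ℕ → E} {M : ℝ} (hψ : ∀ j < k, ‖ψ j‖ ≤ M * μ ^ j) :
    ‖∑ j ∈ Finset.range k, impulse θ A (k - 1 - j) (ψ j)‖ ≤ (k : ℝ) ^ 2 * (M * μ ^ k) := by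
  have h_term : ∀ j ∈ Finset.range k,
      ‖impulse θ A (k - 1 - j) (ψ j)‖ ≤ k * (M * μ ^ k) := by
    intro j hj
    have hjk := Finset.mem_range.1 hj
    have hM : 0 ≤ M := nonneg_of_mul_nonneg_left ((norm_nonneg _).trans (hψ j hjk)) (by positivity)
    have h_cast : ((k - 1 - j : ℕ) : ℝ) + 1 ≤ k := by exact_mod_cast (by omega)
    calc ‖impulse θ A (k - 1 - j) (ψ j)‖
        ≤ (((k - 1 - j : ℕ) + 1) * μ ^ (k - 1 - j)) * (M * μ ^ j) :=
          ContinuousLinearMap.le_of_opNorm_le_of_le _ (hA _) (hψ j hjk)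
      _ ≤ (k * μ ^ (k - 1 - j)) * (M * μ ^ j) := by gcongr
      _ = k * (M * μ ^ (k - 1 - j + j)) := by rw [pow_add]; ring
      _ ≤ k * (M * μ ^ k) := by
          gcongr
          omega
  calc ‖∑ j ∈ Finset.range k, impulse θ A (k - 1 - j) (ψ j)‖
      ≤ (Finset.range k).card • (k * (M * μ ^ k)) :=
        (norm_sum_le _ _).trans (Finset.sum_le_card_nsmul _ _ _ h_term)
    _ = (k : ℝ) ^ 2 * (M * μ ^ k) := by
        rw [Finset.card_range, nsmul_eq_mul]
        ring

lemma norm_withMomentum_le (hθ : 0 ≤ θ) (hθ1 : θ ≤ 1) {u : ℕ → E} {k : ℕ} {M : ℝ}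
    (hk : ‖u k‖ ≤ M) (hk' : ‖u (k - 1)‖ ≤ M) : ‖withMomentum θ u k‖ ≤ 3 * M := by
  have h_step : ‖(1 - θ) • (u k - u (k - 1))‖ ≤ 1 * (M + M) := by
    rw [norm_smul, Real.norm_of_nonneg (sub_nonneg.2 hθ1)]
    gcongr
    · linarith
    · exact (norm_sub_le _ _).trans (add_le_add hk hk')
  calc ‖withMomentum θ u k‖ ≤ ‖u k‖ + ‖(1 - θ) • (u k - u (k - 1))‖ := norm_add_le _ _
    _ ≤ 3 * M := by linarith

variable {a ν t κ : ℝ} {e₁ : E} {w ψ : ℕ → E} {n : ℕ}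

-- The perturbed sequence is compared with the unperturbed one, a multiple of `momentumSol • e₁`.
-- While their distance stays below `t / 4 * μ ^ k`, so do the accumulated errors.
lemma MomentumRoots.norm_sub_momentumSol_le (h : MomentumRoots θ a μ ν) (hθ : 0 ≤ θ) (hθ1 : θ ≤ 1)
    (ha : 1 ≤ a) (hA : ∀ m, ‖impulse θ A m‖ ≤ (m + 1) * μ ^ m) (he₁ : ‖e₁‖ = 1)
    (hAe : A e₁ = a • e₁) (ht : 0 ≤ t) (hκ : 0 ≤ κ) (h_zero : w 0 = t • e₁)
    (hw : ∀ k, w (k + 1) = A (withMomentum θ w k) + ψ k)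
    (hψ : ∀ k < n, ‖ψ k‖ ≤ κ * ‖withMomentum θ w k‖) (hn : 15 * κ * (n : ℝ) ^ 2 ≤ 1) {k : ℕ}
    (hk : k ≤ n) : ‖w k - (t * momentumSol θ a k) • e₁‖ ≤ t / 4 * μ ^ k := by
  have h_one := h.one_le hθ
  set u : ℕ → E := fun k => w k - (t * momentumSol θ a k) • e₁ with hu
  have hu_zero : u 0 = 0 := by simp only [hu, h_zero, momentumSol, mul_one, sub_self]
  have hu_rec (k : ℕ) : u (k + 1) = A (withMomentum θ u k) + ψ k := by
    simp only [hu, hw, _root_.momentumSol_succ, withMomentum, map_add, map_sub, map_smul, hAe,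
      smul_eq_mul]
    module
  induction k using Nat.strong_induction_on with
  | _ k ih =>
    have hw_le (j : ℕ) (hj : j < k) : ‖w j‖ ≤ 5 / 4 * t * μ ^ j := by
      have h_sol := h.momentumSol_mem_Icc hθ ha j
      have h_main : ‖(t * momentumSol θ a j) • e₁‖ ≤ t * μ ^ j := by
        rw [norm_smul, he₁, mul_one,
          Real.norm_of_nonneg (mul_nonneg ht ((by positivity : 0 ≤ 1 / 2 * μ ^ j).trans h_sol.1))]
        exact mul_le_mul_of_nonneg_left h_sol.2 ht
      linarith [norm_le_norm_sub_add (w j) ((t * momentumSol θ a j) • e₁), ih j hj (by omega)]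
    have hψ_le (j : ℕ) (hj : j < k) : ‖ψ j‖ ≤ κ * (15 / 4 * t) * μ ^ j := by
      have h_prev : ‖w (j - 1)‖ ≤ 5 / 4 * t * μ ^ j := by
        refine (hw_le (j - 1) (by omega)).trans ?_
        gcongr
        omega
      calc ‖ψ j‖ ≤ κ * ‖withMomentum θ w j‖ := hψ j (by omega)
        _ ≤ κ * (3 * (5 / 4 * t * μ ^ j)) := by
          gcongr
          exact norm_withMomentum_le hθ hθ1 (hw_le j hj) h_prev
        _ = κ * (15 / 4 * t) * μ ^ j := by ring
    calc ‖u k‖ ≤ (k : ℝ) ^ 2 * (κ * (15 / 4 * t) * μ ^ k) := by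
          rw [eq_sum_impulse hu_zero hu_rec k]
          exact norm_sum_impulse_le h_one hA hψ_le
      _ ≤ (n : ℝ) ^ 2 * (κ * (15 / 4 * t) * μ ^ k) := by gcongr
      _ = 15 * κ * (n : ℝ) ^ 2 * (t / 4 * μ ^ k) := by ring
      _ ≤ t / 4 * μ ^ k := mul_le_of_le_one_left (by positivity) hn

lemma MomentumRoots.le_norm_of_unstable (h : MomentumRoots θ a μ ν) (hθ : 0 ≤ θ) (hθ1 : θ ≤ 1)
    (ha : 1 ≤ a) (hA : ∀ m, ‖impulse θ A m‖ ≤ (m + 1) * μ ^ m) (he₁ : ‖e₁‖ = 1)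
    (hAe : A e₁ = a • e₁) (ht : 0 ≤ t) (hκ : 0 ≤ κ) (h_zero : w 0 = t • e₁)
    (hw : ∀ k, w (k + 1) = A (withMomentum θ w k) + ψ k)
    (hψ : ∀ k < n, ‖ψ k‖ ≤ κ * ‖withMomentum θ w k‖) (hn : 15 * κ * (n : ℝ) ^ 2 ≤ 1) :
    t / 4 * μ ^ n ≤ ‖w n‖ := by
  have h_deviation := h.norm_sub_momentumSol_le hθ hθ1 ha hA he₁ hAe ht hκ h_zero hw hψ hn le_rfl
  have h_main : t * (1 / 2 * μ ^ n) ≤ ‖(t * momentumSol θ a n) • e₁‖ := by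
    rw [norm_smul, he₁, mul_one]
    exact (mul_le_mul_of_nonneg_left (h.momentumSol_mem_Icc hθ ha n).1 ht).trans (le_abs_self _)
  linarith [norm_le_norm_add_norm_sub (w n) ((t * momentumSol θ a n) • e₁)]

end Growth

end MomentumRecurrence

section Separation

lemma withMomentum_sub {E : Type*} [AddCommGroup E] [Module ℝ E] (θ : ℝ) (u v : ℕ → E) (k : ℕ) :
    withMomentum θ (fun j => u j - v j) k = withMomentum θ u k - withMomentum θ v k := by
  simp only [withMomentum]
  module

lemma exp_div_three_le_one_add_half {θ : ℝ} (hθ : 0 ≤ θ) (hθ1 : θ ≤ 1) :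
    Real.exp (θ / 3) ≤ 1 + θ / 2 := by
  have h_inv : 1 - θ / 3 ≤ (Real.exp (θ / 3))⁻¹ := by
    rw [← Real.exp_neg]
    exact Real.one_sub_le_exp_neg (θ / 3)
  calc Real.exp (θ / 3) ≤ (1 - θ / 3)⁻¹ := (le_inv_comm₀ (by linarith) (Real.exp_pos _)).1 h_inv
    _ ≤ 1 + θ / 2 := by
      rw [inv_le_iff_one_le_mul₀ (by linarith)]
      nlinarith

variable {d : ℕ} {f : Vec d → ℝ} {p : Params} {L ρ χ : ℝ}

lemma Params.Tuned.exp_le_pow_floor_K (hp : p.Tuned L ρ χ) :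
    Real.exp (χ / 3) ≤ (1 + p.θ / 2) ^ ⌊p.K⌋₊ := by
  have hθ := hp.θ_pos
  have h_floor : χ / p.θ ≤ ⌊p.K⌋₊ := by
    have h_half : χ / p.θ = p.K / 2 := by
      rw [hp.K_eq]
      ring
    linarith [Nat.lt_floor_add_one p.K, hp.two_lt_K]
  calc Real.exp (χ / 3) = Real.exp (χ / p.θ * (p.θ / 3)) := by
        congr 1
        field_simp
    _ ≤ Real.exp (⌊p.K⌋₊ * (p.θ / 3)) := by gcongr
    _ = Real.exp (p.θ / 3) ^ ⌊p.K⌋₊ := Real.exp_nat_mul _ _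
    _ ≤ (1 + p.θ / 2) ^ ⌊p.K⌋₊ := by
      gcongr
      exact exp_div_three_le_one_add_half hθ.le hp.θ_lt.le

lemma Params.Tuned.relative_error_mul_sq_floor_K_le (hp : p.Tuned L ρ χ) :
    15 * (p.η * (ρ * (5 / 2 * p.B))) * (⌊p.K⌋₊ : ℝ) ^ 2 ≤ 1 := by
  have hη := hp.η_pos
  have hθ := hp.θ_pos
  have hχ := hp.χ_pos
  have h_floor : (⌊p.K⌋₊ : ℝ) ≤ 2 * χ / p.θ := hp.K_eq ▸ Nat.floor_le hp.K_pos.le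
  have h_error : p.η * (ρ * (5 / 2 * p.B)) = 5 / 2 / 288 * (p.θ ^ 2 / χ ^ 2) := by
    rw [← hp.B_eq]
    field_simp
  rw [h_error]
  calc 15 * (5 / 2 / 288 * (p.θ ^ 2 / χ ^ 2)) * (⌊p.K⌋₊ : ℝ) ^ 2
      ≤ 15 * (5 / 2 / 288 * (p.θ ^ 2 / χ ^ 2)) * (2 * χ / p.θ) ^ 2 := by gcongr
    _ = 15 * 5 / 2 / 288 * 4 := by
      field_simp
      norm_num
    _ ≤ 1 := by norm_num

lemma Params.radius_le_half (p : Params) : p.radius ≤ p.B / 2 := min_le_left _ _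

section Linearization

variable {c x z : Vec d}

/-- The error made in one step of the difference of two runs, started at `x` and at `z`, when the
gradient is replaced by its linearization with the Hessian at `c`. -/
noncomputable def linearizationError (f : Vec d → ℝ) (p : Params) (c x z : Vec d) (k : ℕ) : Vec d :=
  -(p.η • (gradient f (agdY f p x k) - gradient f (agdY f p z k)
    - hess f c (agdY f p x k - agdY f p z k)))

lemma withMomentum_agdX_sub_agdX (k : ℕ) :
    withMomentum p.θ (fun j => agdX f p x j - agdX f p z j) k = agdY f p x k - agdY f p z k := by
  rw [withMomentum_sub, agdY_eq_withMomentum, agdY_eq_withMomentum]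

lemma agdX_succ_sub_agdX_succ (c : Vec d) (k : ℕ) :
    agdX f p x (k + 1) - agdX f p z (k + 1)
      = (1 - p.η • hess f c) (withMomentum p.θ (fun j => agdX f p x j - agdX f p z j) k)
        + linearizationError f p c x z k := by
  rw [withMomentum_agdX_sub_agdX, agdX_succ, agdX_succ, linearizationError, sub_apply,
    one_apply_eq_self, smul_apply]
  module

lemma norm_agdY_sub_center_le (hp : p.Tuned L ρ χ) (hx : ‖x - c‖ ≤ p.radius)
    (hnx : ¬ EpochRestarts f p x) {k : ℕ} (hk : k ≤ ⌊p.K⌋₊) : ‖agdY f p x k - c‖ ≤ 5 / 2 * p.B := by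
  have h_path := norm_agdY_sub_le hp
    (not_epochRestarts_iff.1 hnx k (hk.trans (Nat.floor_le_ceil _)))
  linarith [norm_sub_le_norm_sub_add_norm_sub (agdY f p x k) x c, p.radius_le_half]

lemma norm_linearizationError_le (hf : SmoothObjective f L ρ) (hp : p.Tuned L ρ χ)
    (hx : ‖x - c‖ ≤ p.radius) (hz : ‖z - c‖ ≤ p.radius) (hnx : ¬ EpochRestarts f p x)
    (hnz : ¬ EpochRestarts f p z) {k : ℕ} (hk : k ≤ ⌊p.K⌋₊) :
    ‖linearizationError f p c x z k‖ ≤ p.η * (ρ * (5 / 2 * p.B))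
      * ‖withMomentum p.θ (fun j => agdX f p x j - agdX f p z j) k‖ := by
  have hη := hp.η_pos
  rw [withMomentum_agdX_sub_agdX, linearizationError, norm_neg, norm_smul,
    Real.norm_of_nonneg hη.le, mul_assoc]
  gcongr
  exact hf.norm_gradient_sub_gradient_sub_hess_le hp.ρ_pos.le c
    (norm_agdY_sub_center_le hp hx hnx hk) (norm_agdY_sub_center_le hp hz hnz hk)

lemma norm_agdX_floor_K_sub_le (hp : p.Tuned L ρ χ) (hx : ‖x - c‖ ≤ p.radius)
    (hz : ‖z - c‖ ≤ p.radius) (hnx : ¬ EpochRestarts f p x) (hnz : ¬ EpochRestarts f p z) :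
    ‖agdX f p x ⌊p.K⌋₊ - agdX f p z ⌊p.K⌋₊‖ ≤ 3 * p.B := by
  have h_near {y : Vec d} (hy : ‖y - c‖ ≤ p.radius) (hny : ¬ EpochRestarts f p y) :
      ‖agdX f p y ⌊p.K⌋₊ - c‖ ≤ 3 / 2 * p.B := by
    have h_path := norm_agdX_sub_le hp.B_pos.le
      (not_epochRestarts_iff.1 hny _ (Nat.floor_le_ceil _))
    linarith [norm_sub_le_norm_sub_add_norm_sub (agdX f p y ⌊p.K⌋₊) y c, p.radius_le_half]
  have h_triangle := norm_sub_le_norm_sub_add_norm_sub (agdX f p x ⌊p.K⌋₊) c (agdX f p z ⌊p.K⌋₊)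
  rw [norm_sub_rev c] at h_triangle
  linarith [h_near hx hnx, h_near hz hnz]

end Linearization

lemma exists_unstable_direction (hd : 0 < d) (hf : SmoothObjective f L ρ) (hp : p.Tuned L ρ χ)
    {c : Vec d} (hc : lambdaMin (hess f c) < -(p.θ ^ 2 / p.η)) :
    ∃ e₁ a μ ν, MomentumRoots p.θ a μ ν ∧ 1 ≤ a ∧ ‖e₁‖ = 1 ∧ (1 - p.η • hess f c) e₁ = a • e₁ ∧
      ∀ m, ‖impulse p.θ (1 - p.η • hess f c) m‖ ≤ (m + 1) * μ ^ m := by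
  have hη := hp.η_pos
  have hA := hf.isSymmetric_hess c
  have hn : Module.finrank ℝ (Vec d) = d := finrank_euclideanSpace_fin
  obtain ⟨i₀, hi₀⟩ := exists_eigenvalues_eq_lambdaMin hd hA hn
  set e := hA.eigenvectorBasis hn
  set l := hA.eigenvalues hn
  have h_factor : 1 + p.θ ^ 2 ≤ 1 - p.η * l i₀ := by
    have h_mul := mul_lt_mul_of_pos_left hc hη
    have h_sq : p.η * (p.θ ^ 2 / p.η) = p.θ ^ 2 := by field_simp
    rw [hi₀]
    linarith
  obtain ⟨μ, ν, h_roots⟩ := exists_momentumRoots hp.θ_pos hp.θ_lt h_factor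
  have h_eigenvector : hess f c (e i₀) = l i₀ • e i₀ := hA.apply_eigenvectorBasis hn i₀
  have h_diagonal (i : Fin d) (v : Vec d) :
      ⟪e i, (1 - p.η • hess f c) v⟫ = (1 - p.η * l i) * ⟪e i, v⟫ := by
    have h_hess : ⟪e i, hess f c v⟫ = l i * ⟪e i, v⟫ := inner_eigenvectorBasis_apply hA hn i v
    rw [sub_apply, one_apply_eq_self, smul_apply, inner_sub_right, real_inner_smul_right, h_hess]
    ring
  have h_nonneg (i : Fin d) : 0 ≤ 1 - p.η * l i := by
    have h_abs : |l i| ≤ L :=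
      (abs_le_opNorm_of_hasEigenvalue (hA.hasEigenvalue_eigenvalues _ i)).trans
        (hf.norm_hess_le hp.L_pos.le c)
    nlinarith [le_abs_self (l i), hp.L_mul_η]
  have h_max (i : Fin d) : 1 - p.η * l i ≤ 1 - p.η * l i₀ := by
    rw [hi₀]
    gcongr
    exact lambdaMin_le_eigenvalues hA hn i
  refine ⟨e i₀, 1 - p.η * l i₀, μ, ν, h_roots, by nlinarith, e.orthonormal.1 i₀, ?_,
    h_roots.norm_impulse_le hp.θ_pos.le hp.θ_lt.le e h_diagonal h_nonneg h_max⟩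
  rw [sub_apply, one_apply_eq_self, smul_apply, h_eigenvector]
  module

lemma exists_escape_direction (hd : 0 < d) (hf : SmoothObjective f L ρ) (hp : p.Tuned L ρ χ)
    {c : Vec d} (hc : lambdaMin (hess f c) < -(p.θ ^ 2 / p.η)) :
    ∃ e₁ : Vec d, ‖e₁‖ = 1 ∧ ∀ (z : Vec d) (t : ℝ), 0 ≤ t → ‖z - c‖ ≤ p.radius →
      ‖z + t • e₁ - c‖ ≤ p.radius → ¬ EpochRestarts f p z → ¬ EpochRestarts f p (z + t • e₁) →
      t ≤ 12 * p.B * Real.exp (-(χ / 3)) := by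
  have hη := hp.η_pos
  have hρ := hp.ρ_pos
  have hB := hp.B_pos
  have hθ := hp.θ_pos
  obtain ⟨e₁, a, μ, ν, h_roots, ha, he₁, hAe, hA⟩ := exists_unstable_direction hd hf hp hc
  refine ⟨e₁, he₁, fun z t ht hz hz' hnz hnz' => ?_⟩
  have h_growth : t / 4 * μ ^ ⌊p.K⌋₊
      ≤ ‖agdX f p (z + t • e₁) ⌊p.K⌋₊ - agdX f p z ⌊p.K⌋₊‖ :=
    h_roots.le_norm_of_unstable hθ.le hp.θ_lt.le ha hA he₁ hAe ht (by positivity)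
      (w := fun k => agdX f p (z + t • e₁) k - agdX f p z k)
      (by simp only [agdX_zero, add_sub_cancel_left]) (agdX_succ_sub_agdX_succ c)
      (fun k hk => norm_linearizationError_le hf hp hz' hz hnz' hnz hk.le)
      hp.relative_error_mul_sq_floor_K_le
  have h_exp : t / 4 * Real.exp (χ / 3) ≤ 3 * p.B :=
    calc t / 4 * Real.exp (χ / 3) ≤ t / 4 * (1 + p.θ / 2) ^ ⌊p.K⌋₊ := by
          gcongr
          exact hp.exp_le_pow_floor_K
      _ ≤ t / 4 * μ ^ ⌊p.K⌋₊ := by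
          gcongr
          exact h_roots.le_μ
      _ ≤ 3 * p.B := h_growth.trans (norm_agdX_floor_K_sub_le hp hz' hz hnz' hnz)
  rw [Real.exp_neg, ← div_eq_mul_inv, le_div_iff₀ (Real.exp_pos _)]
  linarith

end Separation

section ShortChords

open Module

variable {E : Type*} [NormedAddCommGroup E] [NormedSpace ℝ E]

lemma pairwise_disjoint_translates {G : Set E} {v : E} {τ : ℝ} (hτ : 0 ≤ τ)
    (h_chord : ∀ z ∈ G, ∀ t, 0 ≤ t → z + t • v ∈ G → t < τ) :
    Pairwise (Function.onFun Disjoint fun j : ℕ => (fun x => x + -((j * τ) • v)) ⁻¹' G) := by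
  refine (pairwise_disjoint_on _).2 fun i j hij => Set.disjoint_left.2 fun x hxi hxj => ?_
  have h_index : (i : ℝ) + 1 ≤ j := by exact_mod_cast hij
  have h_lt : (j - i) * τ < τ :=
    h_chord _ hxj _ (mul_nonneg (by linarith) hτ) (by
      convert Set.mem_preimage.1 hxi using 1
      module)
  nlinarith

lemma iUnion_translates_subset_closedBall {G : Set E} {v : E} {r τ s : ℝ} {M : ℕ} (hτ : 0 ≤ τ)
    (hG : G ⊆ Metric.closedBall 0 r) (hv : ‖v‖ ≤ 1) (hM : M * τ ≤ s) :
    ⋃ j ∈ Finset.range M, (fun x => x + -((j * τ) • v)) ⁻¹' G ⊆ Metric.closedBall 0 (r + s) := by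
  refine Set.iUnion₂_subset fun j hj x hx => ?_
  have hxG : ‖x - (j * τ) • v‖ ≤ r := by
    rw [sub_eq_add_neg]
    exact mem_closedBall_zero_iff.1 (hG hx)
  have hj : (j : ℝ) ≤ M := by exact_mod_cast (Finset.mem_range.1 hj).le
  have h_shift : ‖(j * τ) • v‖ ≤ M * τ * 1 := by
    rw [norm_smul, Real.norm_of_nonneg (by positivity)]
    gcongr
  rw [mem_closedBall_zero_iff]
  linarith [norm_sub_norm_le x ((j * τ) • v)]

variable [FiniteDimensional ℝ E] [MeasurableSpace E] [BorelSpace E] (μ : Measure E)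
  [μ.IsAddHaarMeasure]

lemma addHaar_closedBall_enlarged_le {r : ℝ} (hr : 0 ≤ r) :
    μ (Metric.closedBall 0 (r + r / finrank ℝ E)) ≤ 3 * μ (Metric.closedBall 0 r) := by
  have h_pow : (1 + 1 / (finrank ℝ E : ℝ)) ^ finrank ℝ E ≤ 3 :=
    calc (1 + 1 / (finrank ℝ E : ℝ)) ^ finrank ℝ E
        ≤ Real.exp (1 / finrank ℝ E) ^ finrank ℝ E := by
          gcongr
          linarith [Real.add_one_le_exp (1 / (finrank ℝ E : ℝ))]
      _ = Real.exp (finrank ℝ E * (1 / finrank ℝ E)) := (Real.exp_nat_mul _ _).symm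
      _ ≤ Real.exp 1 := by
          gcongr
          rw [mul_one_div]
          exact div_self_le_one _
      _ ≤ 3 := by linarith [Real.exp_one_lt_d9]
  rw [show r + r / finrank ℝ E = (1 + 1 / finrank ℝ E) * r by ring,
    Measure.addHaar_closedBall_mul _ _ (by positivity) hr]
  gcongr
  exact ENNReal.ofReal_le_of_le_toReal h_pow

lemma addHaar_le_of_short_chords {G : Set E} (hG : MeasurableSet G) {r τ : ℝ} (hr : 0 ≤ r)
    (hτ : 0 ≤ τ) (hGr : G ⊆ Metric.closedBall 0 r) {v : E} (hv : ‖v‖ ≤ 1)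
    (h_chord : ∀ z ∈ G, ∀ t, 0 ≤ t → z + t • v ∈ G → t < τ) {M : ℕ}
    (hM : M * τ ≤ r / finrank ℝ E) : M * μ G ≤ 3 * μ (Metric.closedBall 0 r) := by
  set T : ℕ → Set E := fun j => (fun x => x + -((j * τ) • v)) ⁻¹' G
  calc M * μ G = ∑ j ∈ Finset.range M, μ (T j) := by
        simp only [T, measure_preimage_add_right, Finset.sum_const, Finset.card_range,
          nsmul_eq_mul]
    _ = μ (⋃ j ∈ Finset.range M, T j) :=
        (measure_biUnion_finset (fun _ _ _ _ hij => pairwise_disjoint_translates hτ h_chord hij)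
          fun j _ => measurable_add_const _ hG).symm
    _ ≤ μ (Metric.closedBall 0 (r + r / finrank ℝ E)) :=
        measure_mono (iUnion_translates_subset_closedBall hτ hGr hv hM)
    _ ≤ 3 * μ (Metric.closedBall 0 r) := addHaar_closedBall_enlarged_le μ hr

end ShortChords

section Measurability

variable {d : ℕ} {f : Vec d → ℝ} {p : Params} {L ρ : ℝ}

lemma continuous_agdPair (hf : SmoothObjective f L ρ) (k : ℕ) :
    Continuous fun z => agdPair f p z k := by
  induction k with
  | zero => exact continuous_id.prodMk continuous_id
  | succ k ih =>
    have h_gradient := hf.continuous_gradient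
    simp only [agdPair, extrapolate]
    fun_prop

lemma continuous_agdX (hf : SmoothObjective f L ρ) (k : ℕ) : Continuous fun z => agdX f p z k :=
  (continuous_agdPair hf k).snd

lemma continuous_agdY (hf : SmoothObjective f L ρ) (k : ℕ) : Continuous fun z => agdY f p z k := by
  have h_pair := continuous_agdPair (p := p) hf k
  simp only [agdY, extrapolate]
  fun_prop

lemma measurableSet_triggers (hf : SmoothObjective f L ρ) (k : ℕ) :
    MeasurableSet {z | Triggers f p z k} := by
  have h_iterates := fun k => continuous_agdX (p := p) hf k
  refine (isOpen_lt continuous_const ?_).measurableSet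
  fun_prop

lemma measurableSet_epochRestarts (hf : SmoothObjective f L ρ) :
    MeasurableSet {z | EpochRestarts f p z} := by
  simp only [EpochRestarts, Set.ofPred_exists, Set.ofPred_and]
  exact .iUnion fun k => (MeasurableSet.const _).inter (measurableSet_triggers hf k)

lemma measurable_comp_stopTime {α : Type*} [MeasurableSpace α] (hf : SmoothObjective f L ρ)
    {g : ℕ → Vec d → α} (hg : ∀ k, Measurable (g k)) :
    Measurable fun z => g (stopTime f p z) z := by
  classical
  exact Measurable.find (p := fun k z => Triggers f p z k ∨ k = ⌈p.K⌉₊) hg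
    (fun k => (measurableSet_triggers hf k).union (MeasurableSet.const _)) _

lemma measurable_epochEnd (hf : SmoothObjective f L ρ) : Measurable (epochEnd f p) :=
  measurable_comp_stopTime hf fun k => (continuous_agdX hf k).measurable

lemma measurable_epochLastY (hf : SmoothObjective f L ρ) : Measurable (epochLastY f p) :=
  measurable_comp_stopTime hf (g := fun k z => agdY f p z (k - 1))
    fun k => (continuous_agdY hf (k - 1)).measurable

lemma measurable_perturb (hf : SmoothObjective f L ρ) {α : Type*} [MeasurableSpace α]
    {x y u : α → Vec d} (hx : Measurable x) (hy : Measurable y) (hu : Measurable u) :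
    Measurable fun a => perturb f p (x a) (y a) (u a) :=
  Measurable.ite (measurableSet_le (hf.continuous_gradient.measurable.comp hy).norm
    measurable_const) (hx.add hu) hx

lemma exists_measurable_epochStart_eq {α : Type*} (hf : SmoothObjective f L ρ)
    {ξ : ℕ → α → Vec d} {m : ℕ} {Z : α → Vec d} {g : (Finset.range m → Vec d) → Vec d}
    (hg : Measurable g) (hZ : ∀ ω, Z ω = g fun i => ξ i ω) (n : ℕ) :
    ∃ G : (Finset.range (n + m) → Vec d) → Vec d, Measurable G ∧
      ∀ ω, epochStart f p (Z ω) (fun j => ξ (j + m) ω) n = G fun i => ξ i ω := by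
  induction n with
  | zero =>
    rw [Nat.zero_add]
    exact ⟨g, hg, hZ⟩
  | succ n ih =>
    obtain ⟨G, hG, hG_eq⟩ := ih
    have h_subset : Finset.range (n + m) ⊆ Finset.range (n + 1 + m) :=
      Finset.range_subset_range.2 (by omega)
    have h_last : n + m ∈ Finset.range (n + 1 + m) := Finset.mem_range.2 (by omega)
    set H := fun t : Finset.range (n + 1 + m) → Vec d => G fun i => t ⟨i, h_subset i.2⟩
    have hH : Measurable H := hG.comp (measurable_pi_lambda _ fun i => measurable_pi_apply _)
    refine ⟨fun t => perturb f p (epochEnd f p (H t)) (epochLastY f p (H t)) (t ⟨n + m, h_last⟩),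
      measurable_perturb hf ((measurable_epochEnd hf).comp hH)
        ((measurable_epochLastY hf).comp hH) (measurable_pi_apply _), fun ω => ?_⟩
    rw [epochStart, hG_eq]

end Measurability

section Escape

variable {d : ℕ} {f : Vec d → ℝ} {p : Params} {L ρ χ : ℝ}

variable (f p) in
/-- The perturbation `u` of the point `c` is wasted: although `c` has a direction of curvature below
`-θ²/η`, the epoch that starts at `c + u` does not end in a restart. -/
def IsStuck (c u : Vec d) : Prop :=
  lambdaMin (hess f c) < -(p.θ ^ 2 / p.η) ∧ ¬ EpochRestarts f p (c + u)

/-- Approximate second-order stationarity, with tolerance `ε` for the gradient and `δ` for the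
negative part of the spectrum of the Hessian. -/
def IsSecondOrderStationary (f : Vec d → ℝ) (ε δ : ℝ) (x : Vec d) : Prop :=
  ‖gradient f x‖ ≤ ε ∧ -δ ≤ lambdaMin (hess f x)

lemma mul_cond_volume_not_epochRestarts_le (hd : 0 < d) (hf : SmoothObjective f L ρ)
    (hp : p.Tuned L ρ χ) (hr : 0 < p.radius) {c : Vec d}
    (hc : lambdaMin (hess f c) < -(p.θ ^ 2 / p.η)) {M : ℕ}
    (hM : M * (13 * p.B * Real.exp (-(χ / 3))) ≤ p.radius / d) :
    M * volume[|Metric.closedBall (0 : Vec d) p.radius] {u | ¬ EpochRestarts f p (c + u)}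
      ≤ 3 := by
  have hB := hp.B_pos
  set S := {u | ¬ EpochRestarts f p (c + u)}
  have hS : MeasurableSet S :=
    (measurableSet_epochRestarts hf).compl.preimage (measurable_const_add c)
  have h_ball := Metric.isClosed_closedBall (x := (0 : Vec d)) (ε := p.radius) |>.measurableSet
  obtain ⟨v, hv, h_escape⟩ := exists_escape_direction hd hf hp hc
  have h_chord : ∀ u ∈ Metric.closedBall 0 p.radius ∩ S, ∀ t : ℝ, 0 ≤ t →
      u + t • v ∈ Metric.closedBall 0 p.radius ∩ S → t < 13 * p.B * Real.exp (-(χ / 3)) := by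
    intro u hu t ht hut
    calc t ≤ 12 * p.B * Real.exp (-(χ / 3)) := by
          refine h_escape (c + u) t ht ?_ ?_ hu.2 ?_
          · simpa using hu.1
          · simpa [add_assoc] using hut.1
          · rw [add_assoc]
            exact hut.2
      _ < 13 * p.B * Real.exp (-(χ / 3)) := by gcongr; norm_num
  have h_volume : M * volume (Metric.closedBall 0 p.radius ∩ S)
      ≤ 3 * volume (Metric.closedBall (0 : Vec d) p.radius) :=
    addHaar_le_of_short_chords volume (h_ball.inter hS) hr.le (by positivity)
      Set.inter_subset_left hv.le h_chord (by rwa [finrank_euclideanSpace_fin])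
  calc M * volume[|Metric.closedBall (0 : Vec d) p.radius] S
      = (volume (Metric.closedBall (0 : Vec d) p.radius))⁻¹
          * (M * volume (Metric.closedBall 0 p.radius ∩ S)) := by
        rw [cond_apply h_ball, mul_left_comm]
    _ ≤ (volume (Metric.closedBall (0 : Vec d) p.radius))⁻¹
          * (3 * volume (Metric.closedBall (0 : Vec d) p.radius)) := by gcongr
    _ = 3 := by
        rw [mul_left_comm, ENNReal.inv_mul_cancel (Metric.measure_closedBall_pos _ _ hr).ne'
          measure_closedBall_lt_top.ne, mul_one]

-- The output is within `5B/2` of `c`, and `5/2 * 1/288 < 0.011`.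
lemma IsOutput.le_lambdaMin_hess (hd : 0 < d) (hf : SmoothObjective f L ρ) (hp : p.Tuned L ρ χ)
    {z c yhat : Vec d} (hz : ¬ EpochRestarts f p z) (hzc : ‖z - c‖ ≤ p.radius)
    (hc : -(p.θ ^ 2 / p.η) ≤ lambdaMin (hess f c)) (hy : IsOutput f p z yhat) :
    -(1.011 * (p.θ ^ 2 / p.η)) ≤ lambdaMin (hess f yhat) := by
  have hη := hp.η_pos
  have hρ := hp.ρ_pos
  have h_dist : ‖yhat - c‖ ≤ 5 / 2 * p.B := by
    calc ‖yhat - c‖ ≤ ‖yhat - z‖ + ‖z - c‖ := norm_sub_le_norm_sub_add_norm_sub ..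
      _ ≤ 2 * p.B + p.B / 2 := add_le_add (hy.norm_sub_start_le hp (not_epochRestarts_iff.1 hz))
          (hzc.trans p.radius_le_half)
      _ = 5 / 2 * p.B := by ring
  have h_hess : ‖hess f yhat - hess f c‖ ≤ 5 / 2 * (p.θ ^ 2 / p.η / 288) := by
    calc ‖hess f yhat - hess f c‖ ≤ ρ * (5 / 2 * p.B) := (hf.lip_hess _ _).trans (by gcongr)
      _ = 5 / 2 * (ρ * p.B) := by ring
      _ ≤ 5 / 2 * (p.θ ^ 2 / p.η / 288) := by gcongr; exact hp.ρ_B_le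
  have h_curvature : 0 ≤ p.θ ^ 2 / p.η := by positivity
  linarith [lambdaMin_sub_norm_sub_le hd (hf.isSymmetric_hess c) (hf.isSymmetric_hess yhat)]

lemma epochRestarts_epochEnd_of_large_gradient (hf : SmoothObjective f L ρ) (hp : p.Tuned L ρ χ)
    {z : Vec d} (hz : EpochRestarts f p z) (hg : p.B / p.η < ‖gradient f (epochLastY f p z)‖) :
    EpochRestarts f p (epochEnd f p z) := by
  refine epochRestarts_of_large_gradient hp ?_
  obtain ⟨m, hm⟩ := exists_stopTime_eq_succ hz
  rw [epochLastY, hm, Nat.add_sub_cancel] at hg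
  rw [epochEnd, hm]
  have h_diff := norm_gradient_agdX_succ_sub_le hf hp z m
  have h_norm := norm_sub_norm_le (gradient f (agdY f p z m)) (gradient f (agdX f p z (m + 1)))
  rw [norm_sub_rev] at h_norm
  linarith

lemma exists_near_of_not_isStuck {x y u : Vec d} (hu : ‖u‖ ≤ p.radius)
    (hx : p.B / p.η < ‖gradient f y‖ → EpochRestarts f p x) (h_stuck : ¬ IsStuck f p x u)
    (h : ¬ EpochRestarts f p (perturb f p x y u)) :
    ∃ c, ‖perturb f p x y u - c‖ ≤ p.radius ∧ -(p.θ ^ 2 / p.η) ≤ lambdaMin (hess f c) := by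
  rw [perturb] at h ⊢
  split_ifs at h ⊢ with h_small
  · refine ⟨x, by simpa only [add_sub_cancel_left] using hu, ?_⟩
    by_contra! h_lt
    exact h_stuck ⟨h_lt, h⟩
  · exact absurd (hx (not_le.1 h_small)) h

lemma achieves_stationary (hf : SmoothObjective f L ρ) (hp : p.Tuned L ρ χ) {x₀ : Vec d}
    {ξ : ℕ → Vec d} (hξ : ∀ n, ‖ξ n‖ ≤ p.radius) {k : ℕ} {b : ℝ}
    (hk : 16 * gap f x₀ ≤ k * p.decreaseUnit) (hb : ((k : ℝ) + 1) * (3 / 2 * p.K) ≤ b) :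
    Achieves f p x₀ ξ b fun yhat => ‖gradient f yhat‖ ≤ 288 * χ ^ 2 * p.B * p.θ ^ 2 / p.η := by
  obtain ⟨N, hN_unit, h_restarts, hN⟩ := exists_last_epoch hf hp x₀ hξ
  have hNk : (N : ℝ) ≤ k := le_of_mul_le_mul_right (hN_unit.trans hk) hp.decreaseUnit_pos
  have hK := hp.K_pos
  exact achieves_of_last_epoch hp h_restarts hN (le_trans (by gcongr) hb)
    fun y hy => hy.norm_gradient_le hf hp (not_epochRestarts_iff.1 hN)

lemma achieves_secondOrderStationary (hd : 0 < d) (hf : SmoothObjective f L ρ)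
    (hp : p.Tuned L ρ χ) {x₀ : Vec d} {ξ : ℕ → Vec d} (hξ : ∀ n, ‖ξ n‖ ≤ p.radius) {k : ℕ} {b : ℝ}
    (hk : 16 * gap f x₀ ≤ k * p.decreaseUnit) (hb : ((k : ℝ) + 1) * (3 / 2 * p.K) ≤ b)
    (h_first : ¬ EpochRestarts f p x₀ →
      ∃ c, ‖x₀ - c‖ ≤ p.radius ∧ -(p.θ ^ 2 / p.η) ≤ lambdaMin (hess f c))
    (h_stuck : ∀ n < k, ¬ IsStuck f p (epochEnd f p (epochStart f p x₀ ξ n)) (ξ n)) :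
    Achieves f p x₀ ξ b (IsSecondOrderStationary f (288 * χ ^ 2 * p.B * p.θ ^ 2 / p.η)
      (1.011 * (p.θ ^ 2 / p.η))) := by
  obtain ⟨N, hN_unit, h_restarts, hN⟩ := exists_last_epoch hf hp x₀ hξ
  have hNk : N ≤ k := by
    exact_mod_cast le_of_mul_le_mul_right (hN_unit.trans hk) hp.decreaseUnit_pos
  have h_near : ∃ c, ‖epochStart f p x₀ ξ N - c‖ ≤ p.radius ∧
      -(p.θ ^ 2 / p.η) ≤ lambdaMin (hess f c) := by
    rcases N with _ | n
    · exact h_first hN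
    · exact exists_near_of_not_isStuck (hξ n)
        (epochRestarts_epochEnd_of_large_gradient hf hp (h_restarts n n.lt_succ_self))
        (h_stuck n hNk) hN
  obtain ⟨c, hc_near, hc⟩ := h_near
  have hK := hp.K_pos
  exact achieves_of_last_epoch hp h_restarts hN (le_trans (by gcongr) hb) fun y hy =>
    ⟨hy.norm_gradient_le hf hp (not_epochRestarts_iff.1 hN),
      hy.le_lambdaMin_hess hd hf hp hN hc_near hc⟩

end Escape

section UniformNoise

variable {Ω : Type*} [MeasurableSpace Ω] {P : Measure Ω}

lemma ae_mem_of_isUniform {E : Type*} [MeasurableSpace E] {μ : Measure E} {X : Ω → E} {s : Set E}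
    (hs : MeasurableSet s) (h_zero : μ s ≠ 0) (h_top : μ s ≠ ⊤) (hX : pdf.IsUniform X s P μ) :
    ∀ᵐ ω ∂P, X ω ∈ s := by
  have h_compl := hX.measure_preimage h_zero h_top hs.compl
  rw [Set.inter_compl_self, measure_empty, ENNReal.zero_div] at h_compl
  exact h_compl

lemma ae_forall_norm_le_of_isUniform {d : ℕ} {r : ℝ} (hr : 0 < r) {ξ : ℕ → Ω → Vec d}
    (h_unif : ∀ n, pdf.IsUniform (ξ n) (Metric.closedBall 0 r) P volume) :
    ∀ᵐ ω ∂P, ∀ n, ‖ξ n ω‖ ≤ r := by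
  refine ae_all_iff.2 fun n => ?_
  simpa only [mem_closedBall_zero_iff] using
    ae_mem_of_isUniform Metric.isClosed_closedBall.measurableSet
      (Metric.measure_closedBall_pos _ _ hr).ne' measure_closedBall_lt_top.ne (h_unif n)

end UniformNoise

section Probability

variable {Ω : Type*} [MeasurableSpace Ω] {P : Measure Ω} [IsProbabilityMeasure P]

lemma one_sub_sum_measure_le {ι : Type*} {s : Finset ι} {E : ι → Set Ω} {S : Set Ω}
    (hS : ∀ᵐ ω ∂P, (∀ i ∈ s, ω ∉ E i) → ω ∈ S) : 1 - ∑ i ∈ s, P (E i) ≤ P S := by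
  have h_cover : ∀ᵐ ω ∂P, ω ∈ Set.univ → ω ∈ S ∪ ⋃ i ∈ s, E i := by
    filter_upwards [hS] with ω hω _
    by_contra h_not
    simp only [Set.mem_union, Set.mem_iUnion, not_or, not_exists] at h_not
    exact h_not.1 (hω h_not.2)
  rw [tsub_le_iff_right]
  calc 1 = P Set.univ := measure_univ.symm
    _ ≤ P (S ∪ ⋃ i ∈ s, E i) := measure_mono_ae h_cover
    _ ≤ P S + P (⋃ i ∈ s, E i) := measure_union_le _ _
    _ ≤ P S + ∑ i ∈ s, P (E i) := by gcongr; exact measure_biUnion_finset_le _ _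

lemma sum_range_le_ofReal {a : ℕ → ENNReal} {k M : ℕ} {ζ : ℝ} (hM : 0 < M)
    (ha : ∀ i < k, M * a i ≤ 3) (hk : 3 * (k : ℝ) ≤ ζ * M) :
    ∑ i ∈ Finset.range k, a i ≤ ENNReal.ofReal ζ := by
  rw [← ENNReal.mul_le_mul_iff_right (a := M) (by simpa using hM.ne') (by simp)]
  calc M * ∑ i ∈ Finset.range k, a i = ∑ i ∈ Finset.range k, M * a i := Finset.mul_sum ..
    _ ≤ ∑ _ ∈ Finset.range k, (3 : ENNReal) :=
        Finset.sum_le_sum fun i hi => ha i (Finset.mem_range.1 hi)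
    _ = ENNReal.ofReal (3 * k) := by
        rw [Finset.sum_const, Finset.card_range, nsmul_eq_mul, mul_comm,
          ENNReal.ofReal_mul (by norm_num), ENNReal.ofReal_natCast, ENNReal.ofReal_ofNat]
    _ ≤ ENNReal.ofReal (ζ * M) := ENNReal.ofReal_le_ofReal hk
    _ = M * ENNReal.ofReal ζ := by
        rw [ENNReal.ofReal_mul' M.cast_nonneg, ENNReal.ofReal_natCast, mul_comm]

lemma ofReal_one_sub_le_measure {ζ : ℝ} (hζ : 0 ≤ ζ) {S : Set Ω} {k M : ℕ} (hM : 0 < M)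
    (hk : 3 * (k : ℝ) ≤ ζ * M) {E : ℕ → Set Ω} (hE : ∀ i < k, M * P (E i) ≤ 3)
    (hS : ∀ᵐ ω ∂P, (∀ i < k, ω ∉ E i) → ω ∈ S) : ENNReal.ofReal (1 - ζ) ≤ P S := by
  rw [ENNReal.ofReal_sub _ hζ, ENNReal.ofReal_one]
  calc 1 - ENNReal.ofReal ζ ≤ 1 - ∑ i ∈ Finset.range k, P (E i) :=
        tsub_le_tsub_left (sum_range_le_ofReal hM hE hk) 1
    _ ≤ P S := one_sub_sum_measure_le (by simpa only [Finset.mem_range] using hS)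

lemma mul_measure_prod_le {α β : Type*} [MeasurableSpace α] [MeasurableSpace β] {μ : Measure α}
    [IsProbabilityMeasure μ] {ν : Measure β} [SFinite ν] {T : Set (α × β)} (hT : MeasurableSet T)
    {M B : ENNReal} (h : ∀ x, M * ν (Prod.mk x ⁻¹' T) ≤ B) : M * (μ.prod ν) T ≤ B := by
  calc M * (μ.prod ν) T = ∫⁻ x, M * ν (Prod.mk x ⁻¹' T) ∂μ := by
        rw [Measure.prod_apply hT, lintegral_const_mul _ (measurable_measure_prodMk_left hT)]
    _ ≤ ∫⁻ _, B ∂μ := lintegral_mono h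
    _ = B := by rw [lintegral_const, measure_univ, mul_one]

-- `D` need not be measurable: it may be replaced by the condition that the bound on the section
-- at `x` holds, which is measurable in `x`.
lemma mul_measure_and_le_of_indepFun {α β : Type*} [MeasurableSpace α] [MeasurableSpace β]
    {X : Ω → α} {Y : Ω → β} (hX : Measurable X) (hY : Measurable Y) (hXY : IndepFun X Y P)
    {R : α → β → Prop} (hR : MeasurableSet {q : α × β | R q.1 q.2}) {D : α → Prop}
    {M B : ENNReal} (hD : ∀ x, D x → M * (P.map Y) {y | R x y} ≤ B) :
    M * P {ω | D (X ω) ∧ R (X ω) (Y ω)} ≤ B := by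
  have := Measure.isProbabilityMeasure_map (μ := P) hX.aemeasurable
  have := Measure.isProbabilityMeasure_map (μ := P) hY.aemeasurable
  set T : Set (α × β) := {q | M * (P.map Y) {y | R q.1 y} ≤ B} ∩ {q | R q.1 q.2}
  have h_section : Measurable fun x => (P.map Y) {y | R x y} := measurable_measure_prodMk_left hR
  have hT : MeasurableSet T :=
    (measurableSet_le ((h_section.comp measurable_fst).const_mul M) measurable_const).inter hR
  calc M * P {ω | D (X ω) ∧ R (X ω) (Y ω)} ≤ M * P ((fun ω => (X ω, Y ω)) ⁻¹' T) := by
        gcongr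
        exact fun ω hω => ⟨hD _ hω.1, hω.2⟩
    _ = M * ((P.map X).prod (P.map Y)) T := by
        rw [← (indepFun_iff_map_prod_eq_prod_map_map hX.aemeasurable hY.aemeasurable).1 hXY,
          Measure.map_apply (hX.prodMk hY) hT]
    _ ≤ B := by
        refine mul_measure_prod_le hT fun x => ?_
        by_cases hx : M * (P.map Y) {y | R x y} ≤ B
        · exact le_trans (by gcongr; exact fun y hy => hy.2) hx
        · have h_empty : Prod.mk x ⁻¹' T = ∅ := Set.eq_empty_of_forall_notMem fun y hy => hx hy.1
          rw [h_empty, measure_empty, mul_zero]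
          exact zero_le

variable {d : ℕ} {f : Vec d → ℝ} {p : Params} {L ρ χ : ℝ} {M : ℕ}

lemma mul_measure_isStuck_le (hd : 0 < d) (hf : SmoothObjective f L ρ) (hp : p.Tuned L ρ χ)
    (hr : 0 < p.radius) (hM : M * (13 * p.B * Real.exp (-(χ / 3))) ≤ p.radius / d)
    {X ξ : Ω → Vec d} (hX : Measurable X) (hξ : Measurable ξ) (hXξ : IndepFun X ξ P)
    (h_unif : pdf.IsUniform ξ (Metric.closedBall 0 p.radius) P volume) :
    M * P {ω | IsStuck f p (X ω) (ξ ω)} ≤ 3 := by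
  refine mul_measure_and_le_of_indepFun (R := fun x u => ¬ EpochRestarts f p (x + u))
    (D := fun x => lambdaMin (hess f x) < -(p.θ ^ 2 / p.η)) hX hξ hXξ
    ((measurableSet_epochRestarts hf).compl.preimage (measurable_fst.add measurable_snd))
    fun x hx => ?_
  rw [h_unif]
  exact mul_cond_volume_not_epochRestarts_le hd hf hp hr hx hM

variable {ξ : ℕ → Ω → Vec d}

lemma mul_measure_isStuck_epochEnd_le (hd : 0 < d) (hf : SmoothObjective f L ρ)
    (hp : p.Tuned L ρ χ) (hr : 0 < p.radius)
    (hM : M * (13 * p.B * Real.exp (-(χ / 3))) ≤ p.radius / d)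
    (hξ : ∀ n, Measurable (ξ n)) (h_indep : iIndepFun ξ P)
    (h_unif : ∀ n, pdf.IsUniform (ξ n) (Metric.closedBall 0 p.radius) P volume) {m : ℕ}
    {Z : Ω → Vec d} {g : (Finset.range m → Vec d) → Vec d} (hg : Measurable g)
    (hZ : ∀ ω, Z ω = g fun i => ξ i ω) (n : ℕ) :
    M * P {ω | IsStuck f p (epochEnd f p (epochStart f p (Z ω) (fun j => ξ (j + m) ω) n))
      (ξ (n + m) ω)} ≤ 3 := by
  obtain ⟨G, hG, hG_eq⟩ := exists_measurable_epochStart_eq (p := p) hf hg hZ n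
  simp only [hG_eq]
  have h_end := (measurable_epochEnd (p := p) hf).comp hG
  have h_last : n + m ∈ ({n + m} : Finset ℕ) := Finset.mem_singleton_self _
  have h_disjoint : Disjoint (Finset.range (n + m)) {n + m} := by
    rw [Finset.disjoint_singleton_right]
    exact Finset.notMem_range_self
  exact mul_measure_isStuck_le hd hf hp hr hM
    (h_end.comp (measurable_pi_lambda _ fun i => hξ i)) (hξ (n + m))
    ((h_indep.indepFun_finset _ _ h_disjoint hξ).comp h_end
      (measurable_pi_apply (⟨n + m, h_last⟩ : ({n + m} : Finset ℕ)))) (h_unif (n + m))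

variable (f p) in
/-- The points that are perturbed when the perturbation rule is applied to the initial point as
well: the initial point, then the end points of the epochs. -/
noncomputable def perturbedPoint (x₀ : Vec d) (ξ : ℕ → Vec d) : ℕ → Vec d
  | 0 => x₀
  | n + 1 => epochEnd f p (epochStart f p (perturb f p x₀ x₀ (ξ 0)) (fun j => ξ (j + 1)) n)

lemma mul_measure_isStuck_perturbedPoint_le (hd : 0 < d) (hf : SmoothObjective f L ρ)
    (hp : p.Tuned L ρ χ) (hr : 0 < p.radius)
    (hM : M * (13 * p.B * Real.exp (-(χ / 3))) ≤ p.radius / d)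
    (hξ : ∀ n, Measurable (ξ n)) (h_indep : iIndepFun ξ P)
    (h_unif : ∀ n, pdf.IsUniform (ξ n) (Metric.closedBall 0 p.radius) P volume)
    (x₀ : Vec d) (i : ℕ) :
    M * P {ω | IsStuck f p (perturbedPoint f p x₀ (fun n => ξ n ω) i) (ξ i ω)} ≤ 3 := by
  rcases i with _ | n
  · exact mul_measure_isStuck_le hd hf hp hr hM (X := fun _ => x₀) measurable_const (hξ 0)
      (indepFun_const_left _ _) (h_unif 0)
  · have h_zero : 0 ∈ Finset.range 1 := Finset.mem_range.2 one_pos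
    have h_start : Measurable fun t : Finset.range 1 → Vec d =>
        perturb f p x₀ x₀ (t ⟨0, h_zero⟩) :=
      measurable_perturb hf measurable_const measurable_const (measurable_pi_apply _)
    exact mul_measure_isStuck_epochEnd_le hd hf hp hr hM hξ h_indep h_unif h_start
      (Z := fun ω => perturb f p x₀ x₀ (ξ 0 ω)) (fun _ => rfl) n

lemma gap_perturb_le (hf : SmoothObjective f L ρ) (hp : p.Tuned L ρ χ) (x₀ : Vec d) {u : Vec d}
    (hu : ‖u‖ ≤ p.radius) : gap f (perturb f p x₀ x₀ u) ≤ gap f x₀ + 1 / 8 * p.decreaseUnit := by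
  have h_threshold : 0 < p.B / p.η := div_pos hp.B_pos hp.η_pos
  rw [gap, gap, perturb]
  split_ifs with h_small
  · linarith [apply_add_le_of_norm_le_radius hf hp (h_small.trans (by linarith)) hu]
  · linarith [hp.decreaseUnit_pos]

lemma probability_achieves (hd : 0 < d) (hf : SmoothObjective f L ρ) (hp : p.Tuned L ρ χ)
    (hr : 0 < p.radius) (hM : M * (13 * p.B * Real.exp (-(χ / 3))) ≤ p.radius / d)
    (hξ : ∀ n, Measurable (ξ n)) (h_indep : iIndepFun ξ P)
    (h_unif : ∀ n, pdf.IsUniform (ξ n) (Metric.closedBall 0 p.radius) P volume) {k : ℕ} {b ζ : ℝ}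
    (hζ : 0 ≤ ζ) (hM_pos : 0 < M) (hkM : 3 * (k : ℝ) ≤ ζ * M) {x₀ : Vec d}
    (hk : 16 * gap f x₀ ≤ k * p.decreaseUnit) (hb : ((k : ℝ) + 1) * (3 / 2 * p.K) ≤ b)
    (h_first : EpochRestarts f p x₀ ∨ -(p.θ ^ 2 / p.η) ≤ lambdaMin (hess f x₀)) :
    ENNReal.ofReal (1 - ζ) ≤ P {ω | Achieves f p x₀ (fun n => ξ n ω) b
      (IsSecondOrderStationary f (288 * χ ^ 2 * p.B * p.θ ^ 2 / p.η)
        (1.011 * (p.θ ^ 2 / p.η)))} := by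
  refine ofReal_one_sub_le_measure hζ hM_pos hkM (fun i _ =>
    mul_measure_isStuck_epochEnd_le hd hf hp hr hM hξ h_indep h_unif (m := 0) (Z := fun _ => x₀)
      (g := fun _ => x₀) measurable_const (fun _ => rfl) i) ?_
  filter_upwards [ae_forall_norm_le_of_isUniform hr h_unif] with ω hω h_stuck
  exact achieves_secondOrderStationary hd hf hp hω hk hb
    (fun h => ⟨x₀, by simpa only [sub_self, norm_zero] using hr.le, h_first.resolve_left h⟩) h_stuck

lemma probability_achieves_perturbed (hd : 0 < d) (hf : SmoothObjective f L ρ)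
    (hp : p.Tuned L ρ χ) (hr : 0 < p.radius)
    (hM : M * (13 * p.B * Real.exp (-(χ / 3))) ≤ p.radius / d)
    (hξ : ∀ n, Measurable (ξ n)) (h_indep : iIndepFun ξ P)
    (h_unif : ∀ n, pdf.IsUniform (ξ n) (Metric.closedBall 0 p.radius) P volume) {k : ℕ} {b ζ : ℝ}
    (hζ : 0 ≤ ζ) (hM_pos : 0 < M) (hkM : 3 * ((k + 1 : ℕ) : ℝ) ≤ ζ * M) {x₀ : Vec d}
    (hk : 16 * gap f x₀ + 2 * p.decreaseUnit ≤ k * p.decreaseUnit)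
    (hb : ((k : ℝ) + 1) * (3 / 2 * p.K) ≤ b) :
    ENNReal.ofReal (1 - ζ) ≤ P {ω | Achieves f p (perturb f p x₀ x₀ (ξ 0 ω))
      (fun n => ξ (n + 1) ω) b
      (IsSecondOrderStationary f (288 * χ ^ 2 * p.B * p.θ ^ 2 / p.η)
        (1.011 * (p.θ ^ 2 / p.η)))} := by
  have h_threshold : 0 < p.B / p.η := div_pos hp.B_pos hp.η_pos
  refine ofReal_one_sub_le_measure hζ hM_pos hkM (fun i _ =>
    mul_measure_isStuck_perturbedPoint_le hd hf hp hr hM hξ h_indep h_unif x₀ i) ?_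
  filter_upwards [ae_forall_norm_le_of_isUniform hr h_unif] with ω hω h_stuck
  refine achieves_secondOrderStationary hd hf hp (fun n => hω (n + 1)) ?_ hb ?_
    (fun n hn => h_stuck (n + 1) (by omega))
  · linarith [gap_perturb_le hf hp x₀ (hω 0)]
  · exact exists_near_of_not_isStuck (hω 0)
      (fun h_large => epochRestarts_of_large_gradient hp (by linarith)) (h_stuck 0 (by omega))

end Probability

section Budget

variable {p : Params} {L ρ χ Δ : ℝ}

/-- The number of epochs that the analysis allows for: the decrease of the objective admits
`16 Δ / decreaseUnit` of them, and a perturbation of the initial point costs at most two more. -/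
noncomputable def epochBudget (p : Params) (Δ : ℝ) : ℕ := ⌈16 * Δ / p.decreaseUnit⌉₊ + 2

lemma le_epochBudget_mul (hp : p.Tuned L ρ χ) (Δ : ℝ) :
    16 * Δ + 2 * p.decreaseUnit ≤ epochBudget p Δ * p.decreaseUnit := by
  have h_ceil := Nat.le_ceil (16 * Δ / p.decreaseUnit)
  rw [div_le_iff₀ hp.decreaseUnit_pos] at h_ceil
  rw [epochBudget]
  push_cast
  linarith

lemma epochBudget_le (hp : p.Tuned L ρ χ) (hΔ : 0 ≤ Δ) :
    (epochBudget p Δ : ℝ) ≤ 16 * Δ / p.decreaseUnit + 3 := by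
  have h_unit := hp.decreaseUnit_pos
  have h_ceil := Nat.ceil_lt_add_one (show 0 ≤ 16 * Δ / p.decreaseUnit by positivity)
  rw [epochBudget]
  push_cast
  linarith

lemma Params.Tuned.radius_eq (hp : p.Tuned L ρ χ) : p.radius = p.θ ^ 2 * p.B / (40 * χ) := by
  have hθ := hp.θ_pos
  have hB := hp.B_pos
  have hχ := hp.χ_pos
  have h_sq : p.θ ^ 2 ≤ 1 := pow_le_one₀ hθ.le hp.θ_lt.le
  have h_sq_le : p.θ ^ 2 ≤ 20 * χ := by linarith [hp.one_le]
  have h_middle : p.θ * p.B / (20 * p.K) = p.θ ^ 2 * p.B / (40 * χ) := by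
    rw [hp.K_eq]
    field_simp
    norm_num
  have h_half : p.θ ^ 2 * p.B / (40 * χ) ≤ p.B / 2 := by
    calc p.θ ^ 2 * p.B / (40 * χ) ≤ 20 * χ * p.B / (40 * χ) := by gcongr
      _ = p.B / 2 := by field_simp; norm_num
  have h_sqrt : p.θ ^ 2 * p.B / (40 * χ) ≤ √(p.θ * p.B ^ 2 / (2 * p.K)) := by
    refine Real.le_sqrt_of_sq_le ?_
    calc (p.θ ^ 2 * p.B / (40 * χ)) ^ 2
        = p.θ ^ 2 * p.B ^ 2 / (1600 * χ ^ 2) * p.θ ^ 2 := by ring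
      _ ≤ p.θ ^ 2 * p.B ^ 2 / (1600 * χ ^ 2) * (20 * χ) := by gcongr
      _ = p.θ ^ 2 * p.B ^ 2 / (4 * χ) / 20 := by field_simp; norm_num
      _ ≤ p.θ ^ 2 * p.B ^ 2 / (4 * χ) := div_le_self (by positivity) (by norm_num)
      _ = p.θ * p.B ^ 2 / (2 * p.K) := by rw [hp.K_eq]; field_simp; norm_num
  rw [Params.radius, h_middle, min_eq_left h_sqrt, min_eq_right h_half]

lemma Params.Tuned.radius_pos (hp : p.Tuned L ρ χ) : 0 < p.radius := by
  have hθ := hp.θ_pos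
  have hB := hp.B_pos
  have hχ := hp.χ_pos
  rw [hp.radius_eq]
  positivity

end Budget

section Parameters

variable {L ρ ε χ Δ : ℝ}

lemma params_θ_sq_div_η (hL : 0 < L) (hρ : 0 ≤ ρ) (hε : 0 ≤ ε) :
    (params L ρ ε χ).θ ^ 2 / (params L ρ ε χ).η = √(ε * ρ) := by
  have h_root : ((ε * ρ / L ^ 2) ^ (1 / 4 : ℝ)) ^ 2 = √(ε * ρ) / L := by
    rw [← Real.rpow_mul_natCast (by positivity), show (1 / 4 : ℝ) * (2 : ℕ) = 1 / 2 by norm_num,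
      ← Real.sqrt_eq_rpow, Real.sqrt_div (by positivity), Real.sqrt_sq hL.le]
  simp only [params]
  rw [mul_pow, h_root]
  field_simp
  ring

lemma params_B (hρ : 0 < ρ) : (params L ρ ε χ).B = √(ε * ρ) / (288 * χ ^ 2 * ρ) := by
  have h_sqrt : √(ε / ρ) = √(ε * ρ) / ρ := by
    rw [← mul_div_mul_right ε ρ hρ.ne', ← sq, Real.sqrt_div' _ (by positivity),
      Real.sqrt_sq hρ.le]
  simp only [params, h_sqrt]
  ring

lemma params_tuned (hL : 0 < L) (hρ : 0 < ρ) (hε : 0 < ε) (hχ : 1 ≤ χ)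
    (hθ : (params L ρ ε χ).θ < 1) : (params L ρ ε χ).Tuned L ρ χ where
  L_pos := hL
  ρ_pos := hρ
  one_le := hχ
  η_eq := rfl
  θ_pos := by
    simp only [params]
    positivity
  θ_lt := hθ
  B_pos := by
    rw [params_B hρ]
    positivity
  K_eq := rfl
  B_eq := by
    have hη : 0 < (params L ρ ε χ).η := by
      simp only [params]
      positivity
    rw [params_B hρ, (div_eq_iff hη.ne').1 (params_θ_sq_div_η hL hρ.le hε.le)]
    field_simp

lemma params_gradient_bound (hL : 0 < L) (hρ : 0 < ρ) (hε : 0 ≤ ε) (hχ : χ ≠ 0) :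
    288 * χ ^ 2 * (params L ρ ε χ).B * (params L ρ ε χ).θ ^ 2 / (params L ρ ε χ).η = ε := by
  have h_sq : √(ε * ρ) * √(ε * ρ) = ε * ρ := Real.mul_self_sqrt (by positivity)
  rw [mul_div_assoc, params_θ_sq_div_η hL hρ.le hε, params_B hρ]
  field_simp
  linarith

lemma rpow_three_halves (hε : 0 < ε) : ε ^ (3 / 2 : ℝ) = ε * √ε := by
  rw [show (3 / 2 : ℝ) = 1 + 1 / 2 by norm_num, Real.rpow_add hε, Real.rpow_one,
    ← Real.sqrt_eq_rpow]

lemma params_decreaseUnit (hL : 0 < L) (hρ : 0 < ρ) (hε : 0 < ε) (hχ : 0 < χ) :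
    (params L ρ ε χ).decreaseUnit = ε ^ (3 / 2 : ℝ) / (2 * 288 ^ 2 * χ ^ 5 * √ρ) := by
  have hθ : 0 < (params L ρ ε χ).θ := by
    simp only [params]
    positivity
  have hK : (params L ρ ε χ).K = 2 * χ / (params L ρ ε χ).θ := rfl
  have h_sqrt : √(ε * ρ) = √ε * √ρ := Real.sqrt_mul hε.le ρ
  calc (params L ρ ε χ).decreaseUnit
      = (params L ρ ε χ).θ ^ 2 / (params L ρ ε χ).η * (params L ρ ε χ).B ^ 2 / (2 * χ) := by
        rw [Params.decreaseUnit, hK]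
        field_simp
    _ = (√ε * √ρ) ^ 3 / (2 * 288 ^ 2 * χ ^ 5 * ρ ^ 2) := by
        rw [params_θ_sq_div_η hL hρ.le hε.le, params_B hρ, h_sqrt]
        ring
    _ = √ε ^ 2 * √ε * √ρ ^ 4 / (2 * 288 ^ 2 * χ ^ 5 * √ρ * ρ ^ 2) := by field_simp
    _ = ε ^ (3 / 2 : ℝ) / (2 * 288 ^ 2 * χ ^ 5 * √ρ) := by
        rw [rpow_three_halves hε, show √ρ ^ 4 = (√ρ ^ 2) ^ 2 by ring, Real.sq_sqrt hε.le,
          Real.sq_sqrt hρ.le]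
        field_simp

lemma evalBound_eq (hL : 0 < L) (hρ : 0 < ρ) (hε : 0 < ε) (hχ : 0 < χ) (Δ : ℝ) :
    evalBound L ρ ε χ Δ = (params L ρ ε χ).K / 4
      * (1 + Δ / (2 * 288 ^ 2 * (params L ρ ε χ).decreaseUnit)) := by
  have h_L : (L ^ 2) ^ (1 / 4 : ℝ) = L ^ (1 / 2 : ℝ) := by
    rw [← Real.rpow_natCast_mul hL.le]
    norm_num
  have h_ρ : √ρ = ρ ^ (1 / 4 : ℝ) * ρ ^ (1 / 4 : ℝ) := by
    rw [Real.sqrt_eq_rpow, ← Real.rpow_add hρ]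
    norm_num
  have h_ε : ε ^ (7 / 4 : ℝ) = ε ^ (3 / 2 : ℝ) * ε ^ (1 / 4 : ℝ) := by
    rw [← Real.rpow_add hε]
    norm_num
  have hK : (params L ρ ε χ).K
      = 4 * χ * L ^ (1 / 2 : ℝ) / (ε ^ (1 / 4 : ℝ) * ρ ^ (1 / 4 : ℝ)) := by
    simp only [params]
    rw [Real.div_rpow (by positivity) (by positivity), Real.mul_rpow hε.le hρ.le, h_L]
    field_simp
    norm_num
  rw [evalBound, params_decreaseUnit hL hρ hε hχ, hK, h_ρ, h_ε, Real.mul_rpow hε.le hρ.le]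
  field_simp
  ring

lemma epochBudget_mul_le_evalBound (hL : 0 < L) (hρ : 0 < ρ) (hε : 0 < ε) (hχ : 1 ≤ χ)
    (hθ : (params L ρ ε χ).θ < 1) (hΔ : 0 ≤ Δ) :
    ((epochBudget (params L ρ ε χ) Δ : ℝ) + 1) * (3 / 2 * (params L ρ ε χ).K)
      ≤ 16000000 * evalBound L ρ ε χ Δ := by
  have hp := params_tuned hL hρ hε hχ hθ
  rw [evalBound_eq hL hρ hε hp.χ_pos]
  set p := params L ρ ε χ
  have hK := hp.K_pos
  have h_unit := hp.decreaseUnit_pos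
  have h_ratio : 0 ≤ Δ / p.decreaseUnit := by positivity
  calc ((epochBudget p Δ : ℝ) + 1) * (3 / 2 * p.K)
      ≤ (16 * Δ / p.decreaseUnit + 3 + 1) * (3 / 2 * p.K) := by
        gcongr
        exact epochBudget_le hp hΔ
    _ = p.K * (24 * (Δ / p.decreaseUnit) + 6) := by ring
    _ ≤ p.K * (4000000 * (1 + Δ / p.decreaseUnit / (2 * 288 ^ 2))) := by gcongr; linarith
    _ = 16000000 * (p.K / 4 * (1 + Δ / (2 * 288 ^ 2 * p.decreaseUnit))) := by
        rw [div_div, mul_comm p.decreaseUnit]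
        ring

lemma params_radius_le (hL : 0 < L) (hρ : 0 < ρ) (hε : 0 < ε) (hχ : 1 ≤ χ)
    (hθ : (params L ρ ε χ).θ < 1) : (params L ρ ε χ).radius ≤ ε / L := by
  have hp := params_tuned hL hρ hε hχ hθ
  have hχ_pos := hp.χ_pos
  have h_eps := params_gradient_bound hL hρ hε.le hχ_pos.ne'
  set p := params L ρ ε χ
  calc p.radius = 288 * χ ^ 2 * p.B * p.θ ^ 2 / p.η / L / (46080 * χ ^ 3) := by
        rw [hp.radius_eq, hp.η_eq]
        have := hp.L_pos
        field_simp
        ring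
    _ = ε / L / (46080 * χ ^ 3) := by rw [h_eps]
    _ ≤ ε / L := div_le_self (by positivity) (by linarith [one_le_pow₀ hχ (n := 3)])

end Parameters

section LogFactor

variable {L ρ ε ζ χ Δ : ℝ} {d : ℕ}

open Filter in
lemma exists_forall_mul_pow_le_exp (A c₀ : ℝ) (n : ℕ) {b : ℝ} (hb : 0 < b) :
    ∃ c ≥ c₀, ∀ x ≥ c, A * x ^ n ≤ Real.exp (b * x) := by
  have h_eventually : ∀ᶠ x in atTop, A * x ^ n ≤ Real.exp (b * x) := by
    filter_upwards [((isLittleO_pow_exp_pos_mul_atTop n hb).const_mul_left A).bound one_pos]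
      with x hx
    rw [Real.norm_of_nonneg (Real.exp_pos _).le, one_mul] at hx
    exact (Real.le_norm_self _).trans hx
  obtain ⟨c, hc⟩ := ((eventually_ge_atTop c₀).and h_eventually).exists_forall_of_atTop
  exact ⟨c, (hc c le_rfl).1, fun x hx => (hc x hx).2⟩

lemma mul_pow_mul_le_exp {A X c : ℝ} {n : ℕ} (hX : 0 < X) (hc : 6 ≤ c)
    (h_exp : ∀ x ≥ c, A * x ^ n ≤ Real.exp (1 / 6 * x)) (hχ : c * max 1 (Real.log X) ≤ χ) :
    A * χ ^ n * X ≤ Real.exp (χ / 3) := by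
  have h_log : 6 * max 1 (Real.log X) ≤ c * max 1 (Real.log X) := by gcongr
  have hX_exp : X ≤ Real.exp (1 / 6 * χ) := by
    rw [← Real.log_le_iff_le_exp hX]
    linarith [le_max_right 1 (Real.log X)]
  have h_pow : A * χ ^ n ≤ Real.exp (1 / 6 * χ) :=
    h_exp χ ((le_mul_of_one_le_right (by linarith) (le_max_left _ _)).trans hχ)
  calc A * χ ^ n * X ≤ Real.exp (1 / 6 * χ) * Real.exp (1 / 6 * χ) := by gcongr
    _ = Real.exp (χ / 3) := by
      rw [← Real.exp_add]
      ring_nf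

lemma epochBudget_add_one_le (hL : 0 < L) (hρ : 0 < ρ) (hε : 0 < ε) (hχ : 1 ≤ χ)
    (hθ : (params L ρ ε χ).θ < 1) (hΔ : 0 ≤ Δ) :
    (epochBudget (params L ρ ε χ) Δ : ℝ) + 1
      ≤ 2700000 * χ ^ 5 * (1 + Δ * √ρ / ε ^ (3 / 2 : ℝ)) := by
  have hp := params_tuned hL hρ hε hχ hθ
  have h_ratio : 0 ≤ χ ^ 5 * (Δ * √ρ / ε ^ (3 / 2 : ℝ)) := by
    have := hp.χ_pos
    positivity
  calc (epochBudget (params L ρ ε χ) Δ : ℝ) + 1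
      ≤ 16 * Δ / (params L ρ ε χ).decreaseUnit + 3 + 1 := by gcongr; exact epochBudget_le hp hΔ
    _ = 2654208 * (χ ^ 5 * (Δ * √ρ / ε ^ (3 / 2 : ℝ))) + 4 := by
        rw [params_decreaseUnit hL hρ hε hp.χ_pos]
        field_simp
        ring
    _ ≤ 2700000 * χ ^ 5 * (1 + Δ * √ρ / ε ^ (3 / 2 : ℝ)) := by
        linarith [one_le_pow₀ hχ (n := 5)]

lemma exists_nat_three_mul_le_le_four_mul {x : ℝ} (hx : 1 ≤ x) :
    ∃ M : ℕ, 0 < M ∧ 3 * x ≤ M ∧ M ≤ 4 * x := by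
  refine ⟨⌈3 * x⌉₊, Nat.ceil_pos.2 (by linarith), Nat.le_ceil _, ?_⟩
  linarith [Nat.ceil_lt_add_one (show 0 ≤ 3 * x by linarith)]

-- `M` translates of the set of wasted perturbations fit into the ball of radius `(1 + 1/d) r`, so
-- each epoch fails with probability at most `3 / M`, which summed over the epochs is at most `ζ`.
lemma exists_translates (hL : 0 < L) (hρ : 0 < ρ) (hε : 0 < ε) (hχ : 1 ≤ χ)
    (hθ : (params L ρ ε χ).θ < 1) (hd : 0 < d) (hζ : 0 < ζ) (hζ1 : ζ ≤ 1) (hΔ : 0 ≤ Δ) {c : ℝ}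
    (hc : 6 ≤ c) (h_exp : ∀ x ≥ c, 8320 * 2700000 * x ^ 6 ≤ Real.exp (1 / 6 * x))
    (hχc : c * logFactor d L ρ ε ζ Δ ≤ χ) :
    ∃ M : ℕ, 0 < M ∧ 3 * ((epochBudget (params L ρ ε χ) Δ + 1 : ℕ) : ℝ) ≤ ζ * M ∧
      M * (13 * (params L ρ ε χ).B * Real.exp (-(χ / 3))) ≤ (params L ρ ε χ).radius / d := by
  have hp := params_tuned hL hρ hε hχ hθ
  have := hp.χ_pos
  have hB := hp.B_pos
  have : (0 : ℝ) < d := by exact_mod_cast hd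
  set N := epochBudget (params L ρ ε χ) Δ
  set S := 1 + Δ * √ρ / ε ^ (3 / 2 : ℝ)
  set X := d * L * S / (ζ * √(ε * ρ))
  have hS : 0 < S := by positivity
  have hX : 0 < X := by positivity
  have hX_exp : 8320 * 2700000 * χ ^ 6 * X ≤ Real.exp (χ / 3) := mul_pow_mul_le_exp hX hc h_exp hχc
  have h_one_le : 1 ≤ ((N : ℝ) + 1) / ζ := by
    rw [le_div_iff₀ hζ]
    linarith [N.cast_nonneg (α := ℝ)]
  obtain ⟨M, hM_pos, hM_ge, hM_le⟩ := exists_nat_three_mul_le_le_four_mul h_one_le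
  refine ⟨M, hM_pos, ?_, ?_⟩
  · push_cast
    rwa [mul_div_assoc', div_le_iff₀ hζ, mul_comm (M : ℝ)] at hM_ge
  · have hθ_sq : (params L ρ ε χ).θ ^ 2 = √(ε * ρ) / (4 * L) := by
      rw [← params_θ_sq_div_η hL hρ.le hε.le, hp.η_eq]
      field_simp
    calc M * (13 * (params L ρ ε χ).B * Real.exp (-(χ / 3)))
        ≤ 4 * (2700000 * χ ^ 5 * S / ζ)
            * (13 * (params L ρ ε χ).B * (8320 * 2700000 * χ ^ 6 * X)⁻¹) := by
          rw [Real.exp_neg]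
          gcongr
          refine hM_le.trans ?_
          gcongr
          exact epochBudget_add_one_le hL hρ hε hχ hθ hΔ
      _ = (params L ρ ε χ).radius / d := by
          rw [hp.radius_eq, hθ_sq]
          simp only [X]
          field_simp
          norm_num

lemma le_of_params_θ_lt_one (hL : 0 < L) (hρ : 0 < ρ) (hε : 0 ≤ ε)
    (hθ : (params L ρ ε χ).θ < 1) : ε ≤ 16 * L ^ 2 / ρ := by
  have hθ_nonneg : 0 ≤ (params L ρ ε χ).θ := by
    simp only [params]
    positivity
  have h_sqrt : √(ε * ρ) ≤ 4 * L := by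
    rw [← params_θ_sq_div_η (χ := χ) hL hρ.le hε, show (params L ρ ε χ).η = 1 / (4 * L) from rfl,
      div_div_eq_mul_div, div_one]
    exact mul_le_of_le_one_left (by positivity) (pow_le_one₀ hθ_nonneg hθ.le)
  rw [Real.sqrt_le_left (by positivity)] at h_sqrt
  rw [le_div_iff₀ hρ]
  linarith

lemma log_argument_le {E Δmax : ℝ} (hL : 0 < L) (hρ : 0 < ρ) (hε : 0 < ε) (hεE : ε ≤ E)
    (hζ : 0 < ζ) (hζ1 : ζ ≤ 1) (hΔ : 0 ≤ Δ) (hΔmax : Δ ≤ Δmax) (hd : 0 < d) :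
    d * L * (1 + Δ * √ρ / ε ^ (3 / 2 : ℝ)) / (ζ * √(ε * ρ))
      ≤ L * (E ^ (3 / 2 : ℝ) + Δmax * √ρ) / √ρ * (d / (ζ * ε)) ^ 2 := by
  have hE : 0 < E := hε.trans_le hεE
  have hΔmax_nonneg : 0 ≤ Δmax := hΔ.trans hΔmax
  have h_inner : 1 + Δ * √ρ / ε ^ (3 / 2 : ℝ)
      ≤ (E ^ (3 / 2 : ℝ) + Δmax * √ρ) / ε ^ (3 / 2 : ℝ) := by
    rw [add_div]
    gcongr
    rw [one_le_div (by positivity)]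
    gcongr
  have h_one_le : 1 ≤ d / ζ := (one_le_div hζ).2 (hζ1.trans (by exact_mod_cast hd))
  calc d * L * (1 + Δ * √ρ / ε ^ (3 / 2 : ℝ)) / (ζ * √(ε * ρ))
      ≤ d * L * ((E ^ (3 / 2 : ℝ) + Δmax * √ρ) / ε ^ (3 / 2 : ℝ)) / (ζ * √(ε * ρ)) := by gcongr
    _ = L * (E ^ (3 / 2 : ℝ) + Δmax * √ρ) / (ε * √ε ^ 2 * √ρ) * (d / ζ) := by
        rw [rpow_three_halves hε, Real.sqrt_mul hε.le]
        field_simp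
    _ ≤ L * (E ^ (3 / 2 : ℝ) + Δmax * √ρ) / (ε * √ε ^ 2 * √ρ) * (d / ζ) ^ 2 := by
        gcongr
        exact le_self_pow₀ h_one_le two_ne_zero
    _ = L * (E ^ (3 / 2 : ℝ) + Δmax * √ρ) / √ρ * (d / (ζ * ε)) ^ 2 := by
        rw [Real.sq_sqrt hε.le]
        field_simp

lemma max_one_log_le_mul_of_le_mul_sq {A X Y : ℝ} (hA : 0 < A) (hX : 0 < X) (hY : 0 < Y)
    (h : X ≤ A * Y ^ 2) : max 1 (Real.log X) ≤ (|Real.log A| + 2) * max 1 (Real.log Y) := by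
  have h_one : 1 ≤ max 1 (Real.log Y) := le_max_left _ _
  have h_abs : |Real.log A| ≤ |Real.log A| * max 1 (Real.log Y) :=
    le_mul_of_one_le_right (abs_nonneg _) h_one
  refine max_le (by linarith [abs_nonneg (Real.log A)]) ?_
  calc Real.log X ≤ Real.log (A * Y ^ 2) := Real.log_le_log hX h
    _ = Real.log A + 2 * Real.log Y := by
      rw [Real.log_mul hA.ne' (by positivity), Real.log_pow, Nat.cast_ofNat]
    _ ≤ (|Real.log A| + 2) * max 1 (Real.log Y) := by
      linarith [le_abs_self (Real.log A), le_max_right 1 (Real.log Y)]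

lemma logFactor_le {Δmax : ℝ} (hL : 0 < L) (hρ : 0 < ρ) :
    ∃ c' : ℝ, ∀ (d : ℕ) (ε ζ Δ χ : ℝ),
      0 < d → 0 < ε → 0 < ζ → ζ < 1 → 0 ≤ Δ → Δ ≤ Δmax → (params L ρ ε χ).θ < 1 →
      logFactor d L ρ ε ζ Δ ≤ c' * max 1 (Real.log (d / (ζ * ε))) := by
  set E := 16 * L ^ 2 / ρ
  refine ⟨|Real.log (L * (E ^ (3 / 2 : ℝ) + Δmax * √ρ) / √ρ)| + 2,
    fun d ε ζ Δ χ hd hε hζ hζ1 hΔ hΔmax hθ => ?_⟩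
  have : 0 < E := by positivity
  have hΔmax_nonneg : 0 ≤ Δmax := hΔ.trans hΔmax
  exact max_one_log_le_mul_of_le_mul_sq (by positivity) (by positivity) (by positivity)
    (log_argument_le hL hρ hε (le_of_params_θ_lt_one hL hρ hε.le hθ) hζ hζ1.le hΔ hΔmax hd)

end LogFactor

theorem theorem3 :
    ∃ c C : ℝ, 0 < c ∧ 0 < C ∧
      -- for fixed `L`, `ρ` and bounded `Δ`, the logarithmic factor is `O(log (d / (ζ ε)))`
      (∀ L ρ Δmax : ℝ, 0 < L → 0 < ρ → ∃ c' : ℝ, ∀ (d : ℕ) (ε ζ Δ χ : ℝ),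
        0 < d → 0 < ε → 0 < ζ → ζ < 1 → 0 ≤ Δ → Δ ≤ Δmax → (params L ρ ε χ).θ < 1 →
        logFactor d L ρ ε ζ Δ ≤ c' * max 1 (Real.log (d / (ζ * ε)))) ∧
      ∀ (d : ℕ) (f : Vec d → ℝ) (L ρ ε χ : ℝ) (x_int : Vec d),
        0 < d → 0 < L → 0 < ρ → 0 < ε → 1 ≤ χ → SmoothObjective f L ρ →
        (params L ρ ε χ).θ < 1 →
        (params L ρ ε χ).radius ≤ C * ε / L ∧
        -- termination and first-order stationarity, for all perturbations in the ball
        (∀ ξ : ℕ → Vec d, (∀ n, ‖ξ n‖ ≤ (params L ρ ε χ).radius) →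
          Achieves f (params L ρ ε χ) x_int ξ (C * evalBound L ρ ε χ (gap f x_int))
            (fun yhat => ‖gradient f yhat‖ ≤ ε)) ∧
        -- second-order stationarity with probability at least `1 - ζ`
        ∀ (ζ : ℝ) (Ω : Type*) (_ : MeasurableSpace Ω) (P : Measure Ω) (ξ : ℕ → Ω → Vec d),
          0 < ζ → ζ < 1 → c * logFactor d L ρ ε ζ (gap f x_int) ≤ χ →
          IsProbabilityMeasure P → (∀ n, Measurable (ξ n)) → iIndepFun ξ P →
          (∀ n, pdf.IsUniform (ξ n) (Metric.closedBall 0 (params L ρ ε χ).radius) P volume) →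
          -- the method as it stands, started at `x_int`
          ((EpochRestarts f (params L ρ ε χ) x_int ∨ -√(ε * ρ) ≤ lambdaMin (hess f x_int)) →
            ENNReal.ofReal (1 - ζ) ≤
              P {ω | Achieves f (params L ρ ε χ) x_int (fun n => ξ n ω)
                (C * evalBound L ρ ε χ (gap f x_int))
                (fun yhat => ‖gradient f yhat‖ ≤ ε ∧
                  -(1.011 * √(ε * ρ)) ≤ lambdaMin (hess f yhat))}) ∧
          -- the method with the perturbation rule applied to the initial point as well
          ENNReal.ofReal (1 - ζ) ≤
            P {ω | Achieves f (params L ρ ε χ) (perturb f (params L ρ ε χ) x_int x_int (ξ 0 ω))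
              (fun n => ξ (n + 1) ω)
              (C * evalBound L ρ ε χ (gap f x_int))
              (fun yhat => ‖gradient f yhat‖ ≤ ε ∧
                -(1.011 * √(ε * ρ)) ≤ lambdaMin (hess f yhat))} := by
  obtain ⟨c, hc_six, hc⟩ := exists_forall_mul_pow_le_exp (8320 * 2700000) 6 6
    (by norm_num : (0 : ℝ) < 1 / 6)
  refine ⟨c, 16000000, by linarith, by norm_num, fun L ρ Δmax hL hρ => logFactor_le hL hρ, ?_⟩
  intro d f L ρ ε χ x_int hd hL hρ hε hχ hf hθ
  have hp := params_tuned hL hρ hε hχ hθ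
  have hΔ := hf.gap_nonneg x_int
  have h_eps := params_gradient_bound hL hρ hε.le hp.χ_pos.ne'
  have h_curvature := params_θ_sq_div_η (χ := χ) hL hρ.le hε.le
  have h_evals := epochBudget_mul_le_evalBound hL hρ hε hχ hθ hΔ
  have h_budget := le_epochBudget_mul hp (gap f x_int)
  have h_epochs :=
    (le_add_of_nonneg_right (mul_pos two_pos hp.decreaseUnit_pos).le).trans h_budget
  refine ⟨(params_radius_le hL hρ hε hχ hθ).trans (by gcongr; linarith), fun ξ hξ => ?_, ?_⟩
  · simpa only [h_eps] using achieves_stationary hf hp hξ h_epochs h_evals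
  intro ζ Ω _ P ξ hζ hζ1 hχ_log _ hξ h_indep h_unif
  obtain ⟨M, hM_pos, hkM, hM⟩ := exists_translates hL hρ hε hχ hθ hd hζ hζ1.le hΔ
    hc_six hc hχ_log
  refine ⟨fun h_first => ?_, ?_⟩
  · have h := probability_achieves hd hf hp hp.radius_pos hM hξ h_indep h_unif hζ.le hM_pos
      (by push_cast at hkM; linarith) h_epochs h_evals (by rwa [h_curvature])
    rwa [h_eps, h_curvature] at h
  · have h := probability_achieves_perturbed hd hf hp hp.radius_pos hM hξ h_indep h_unif hζ.le
      hM_pos hkM h_budget h_evals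
    rwa [h_eps, h_curvature] at h
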